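/- **Setting.** Let $U\subset\mathbb R^3$ be a connected open set, with coordinates $(x,y,z)$, such that every line parallel to the $z$-axis meets $U$ in a connected (possibly empty) set. Let $V\subset\mathbb R^2$ and $J\subset\mathbb R$ be the projections of $U$ to the $(x,y)$-plane and to the $z$-axis. All data are $C^\infty$. Let $\varphi(x,y,z)=\lambda(x,y)+\mu(z)$ take values in $(-\pi,\pi)$ with $\sin\varphi\cos\varphi\ne0$ on $U$, and suppose that, for non-zero constants $c_1,c_2$, $$\lambda_{xx}-\lambda_{yy}=\tfrac{c_1^2}{2}\sin(2\lambda),\qquad \mu\equiv0\ \text{ or }\ \bigl(\mu_z\not\equiv0,\ \mu_z^2=c_2^2-c_1^2\sin^2\mu\bigr).\tag{1}$$ Condition (d): $\lambda_x\not\equiv0$ and $\lambda_y\not\equiv0$. Let $f:U\to\mathbb R^4$ be a generic conformally flat hypersurface with canonical Guichard net $g=\cos^2\varphi\,dx^2+\sin^2\varphi\,dy^2+dz^2$. That is, $f$ has first fundamental form $I_f=P^2g$ with $P>0$, the coordinates $(x,y,z)$ are principal curvature line coordinates, and for the unit normal field $N$ (with $N_x=-\kappa_1f_x$, $N_y=-\kappa_2f_y$,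 $N_z=-\kappa_3f_z$) the principal curvatures satisfy $\kappa_1=P^{-1}\tan\varphi+\kappa_3$ and $\kappa_2=-P^{-1}\cot\varphi+\kappa_3$. Let $$\sigma_1=\tfrac12(\kappa_1\kappa_2-\kappa_2\kappa_3+\kappa_3\kappa_1),\quad \sigma_2=\tfrac12(\kappa_1\kappa_2+\kappa_2\kappa_3-\kappa_3\kappa_1),\quad \sigma_3=\tfrac12(-\kappa_1\kappa_2+\kappa_2\kappa_3+\kappa_3\kappa_1)$$ be the eigenvalues of the Schouten $(1,1)$-tensor $S$ of $f$. A dual of $f$ is a map $f^*:U\to\mathbb R^4$ with $df^*=df\circ S$, i.e. $df^*=\sigma_1f_x\,dx+\sigma_2f_y\,dy+\sigma_3f_z\,dz$; it is unique up to translation. Put $U^*=\{\sigma_1\sigma_2\sigma_3\neq0\}\subset U$, $P^*=\sigma_3P$, $\kappa_i^*=-\kappa_i/\sigma_i$, $N^*=-N$, and define $X_\gamma=P^{-1}f_z$, $A=-X_\gamma+\varphi_zN$, $K=-(P^{-1})_z+\kappa_3\varphi_z$. For $\varphi^*$ as in the theorem, let $X_\gamma^*,A^*,K^*$ be given by the same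 formulas from $(f^*,P^*,\kappa_3^*,N^*,\varphi^*)$. Suppose that $f$ is a normal form, i.e. has one of the following structures. * (a) For each $z$ the surface $f(\cdot,\cdot,z)$ lies in a hyperplane $H(z)$, and all $H(z)$ have the same unit normal. * (b) For each $z$ the surface $f(\cdot,\cdot,z)$ lies in a linear hyperplane $H(z)$ whose unit normal $B(z)$ moves smoothly, with non-vanishing velocity, on the unit circle of a linear plane $L$. * (c) For each $z$ the surface $f(\cdot,\cdot,z)$ lies on a 3-sphere centered at the origin. Two maps are called conformally equivalent if one is $T\circ$ the other, at the same points $(x,y,z)$, for a Möbius transformation $T$ of $\mathbb R^4\cup\{\infty\}$. **Theorem 4.3.** Let $f^*$ be a dual of $f$. Then there are smooth functions $\lambda^*(x,y)$ on $V$ and $\mu^*(z)$ on $J$, satisfying (1) with some non-zero constants $c_1^*,c_2^*$, such that $\varphi^*=\lambda^*+\mu^*$ satisfies $\cos\varphi^*=(\sigma_1/\sigma_3)\cos\varphi$ and $\sin\varphi^*=(\sigma_2/\sigma_3)\sin\varphi$ on $U$, and such that $f^*$ is on $U^*$ a generic conformally flat hypersurface with canonical Guichard net given by $\varphi^*$,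 with conformal factor $P^*$, principal curvatures $\kappa_i^*$ and unit normal $N^*$. Moreover $\mu^*\equiv0$ if $\mu\equiv0$, and $\mu^*_z\not\equiv0$ if $\mu_z\not\equiv0$. After a suitable translation, $f^*$ has the same structure (a), (b) or (c) as $f$, with the same normal vectors in cases (a) and (b), and the following holds for this translate. 1. *Structure (a), $\mu\equiv0$.* $\varphi^*=\lambda\pm\pi$ (one sign, with values in $(-\pi,\pi)$), $P$ is constant, $B=X_\gamma$ is a constant vector, $f=f^1(x,y)+(Pz+t)B$ with $f^1\perp B$ and a constant $t$, and $f^*=\frac{P^{-2}}2\bigl(-f^1(x,y)+PzB\bigr)$. The maps $f$ and $f^*$ are conformally equivalent. 2. *Structure (a), $\mu_z\not\equiv0$.* $\lambda^*=\lambda\pm\pi$ (one sign), $\mu^*=-\mu$, and $B=-A/\sqrt{1+\mu_z^2}$ is a constant unit vector, normal to the hyperplanes of both $f$ and $f^*$. There is a constant $C\ne0$ with $P^{-1}=C\cos\mu$ and $\kappa_3=-C\sin\mu$, and $$f^*=-\tfrac{C^2}2f-\kappa_3N+q(z)B,\qquad q'=P^{-1}\sqrt{1+\mu_z^2}$$ (so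 $q'=Cc_1\cos^2\mu$ if the sign of $c_1$ is such that $c_1\cos\mu>0$). 3. *Structure (b).* $\mu^*=-\mu$, and for each $z$ the surfaces of $f$ and $f^*$ lie in the same linear hyperplane $H(z)$. Neither $(\lambda^*_x,\lambda^*_y)=(\lambda_x,\lambda_y)$ on all of $V$ nor $(\lambda^*_x,\lambda^*_y)=-(\lambda_x,\lambda_y)$ on all of $V$. The function $\sigma_3$ depends only on $(x,y)$, and $f^*=\sigma_3(x,y)f+W(x,y)$ with a smooth map $W:V\to L^\perp$. 4. *Structure (c), $\mu\equiv0$.* $\varphi^*=\lambda\pm\pi$ (one sign, with values in $(-\pi,\pi)$), $c_1^2<1$, $\sigma_3$ depends only on $z$, and with $c_3=\sqrt{1-c_1^2}$ and $\iota_0(X)=X/\|X\|^2$ one has $f^*=-\sigma_3f=-\frac1{2c_3^2}\,\iota_0\circ f$. The maps $f$ and $f^*$ are conformally equivalent. 5. *Structure (c), $\mu_z\not\equiv0$.* $\lambda^*=\lambda$, $\mu^*_z\not\equiv\mu_z$, $\mu^*_z\not\equiv-\mu_z$, $K^*$ depends only on $z$ and has no zero, and $f^*=-A^*/K^*=-(\sigma_3f+\kappa_3N)$.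 In cases 2, 3 and 5, $f^*$ is not conformally equivalent to $f$ on $U$, nor on $U^*$ when $U^*\neq\emptyset$. -/

import Mathlib

open scoped ContDiff InnerProductSpace

namespace GuichardDual

noncomputable section

/-- The coordinate space of the triples `(x, y, z)`. -/
abbrev R3 : Type := ℝ × ℝ × ℝ

/-- Euclidean 4-space, the ambient space of the hypersurfaces. -/
abbrev E4 : Type := EuclideanSpace ℝ (Fin 4)

/-- The set of all `(x, y)` such that `(x, y, z) ∈ U` for some `z`. -/
def xyProj (U : Set R3) : Set (ℝ × ℝ) := (fun p : R3 => (p.1, p.2.1)) '' U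

/-- The set of all `z` such that `(x, y, z) ∈ U` for some `(x, y)`. -/
def zProj (U : Set R3) : Set ℝ := (fun p : R3 => p.2.2) '' U

/-- The partial derivative with respect to `x`. -/
def dX {F : Type*} [NormedAddCommGroup F] [NormedSpace ℝ F] (g : R3 → F) (p : R3) : F :=
  fderiv ℝ g p (1, 0, 0)

/-- The partial derivative with respect to `y`. -/
def dY {F : Type*} [NormedAddCommGroup F] [NormedSpace ℝ F] (g : R3 → F) (p : R3) : F :=
  fderiv ℝ g p (0, 1, 0)

/-- The partial derivative with respect to `z`. -/
def dZ {F : Type*} [NormedAddCommGroup F] [NormedSpace ℝ F] (g : R3 → F) (p : R3) : F :=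
  fderiv ℝ g p (0, 0, 1)

/-- The partial derivative with respect to `x` of a function of `(x, y)`. -/
def pX (g : ℝ × ℝ → ℝ) (q : ℝ × ℝ) : ℝ := fderiv ℝ g q (1, 0)

/-- The partial derivative with respect to `y` of a function of `(x, y)`. -/
def pY (g : ℝ × ℝ → ℝ) (q : ℝ × ℝ) : ℝ := fderiv ℝ g q (0, 1)

/-- The function `φ(x, y, z) = λ(x, y) + μ(z)`. -/
def angle (lam : ℝ × ℝ → ℝ) (mu : ℝ → ℝ) (p : R3) : ℝ := lam (p.1, p.2.1) + mu p.2.2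

/-- The equations for `φ = λ(x, y) + μ(z)`, where `λ` lives on `V` and `μ` on `J`:
`λ_xx - λ_yy = (c₁² / 2) sin (2 λ)`, and either `μ ≡ 0` (conformal product-type) or `μ` is not
constant and `μ_z² = c₂² - c₁² sin² μ` (cyclic). -/
structure GuichardEquations (V : Set (ℝ × ℝ)) (J : Set ℝ) (lam : ℝ × ℝ → ℝ) (mu : ℝ → ℝ)
    (c₁ c₂ : ℝ) : Prop where
  c₁_ne : c₁ ≠ 0
  c₂_ne : c₂ ≠ 0
  smooth_lam : ContDiffOn ℝ ∞ lam V
  smooth_mu : ContDiffOn ℝ ∞ mu J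
  lam_eq : ∀ q ∈ V, pX (pX lam) q - pY (pY lam) q = c₁ ^ 2 / 2 * Real.sin (2 * lam q)
  mu_eq : (∀ z ∈ J, mu z = 0) ∨
    ((∃ z ∈ J, deriv mu z ≠ 0) ∧
      ∀ z ∈ J, deriv mu z ^ 2 = c₂ ^ 2 - c₁ ^ 2 * Real.sin (mu z) ^ 2)

/-- `f : U → ℝ⁴` is a generic conformally flat hypersurface, written in the principal curvature
line coordinates `(x, y, z)` of its canonical Guichard net
`g = cos² φ dx² + sin² φ dy² + dz²`. Its first fundamental form is `P² g`, its unit normal field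
is `N`, its principal curvatures are `κ₁, κ₂, κ₃` (Weingarten equations `N_x = -κ₁ f_x`, ...), and
`κ₁ = P⁻¹ tan φ + κ₃`, `κ₂ = -P⁻¹ cot φ + κ₃`. The last two equations fix the sign of `N`
(`(κ₁ - κ₂) sin φ cos φ = P⁻¹ > 0`) and give that the three principal curvatures are distinct with
`κ₃` in the middle. They also say that the conformal fundamental forms
`√((κ₁ - κ₃)(κ₁ - κ₂)) P cos φ dx`, `√((κ₁ - κ₂)(κ₃ - κ₂)) P sin φ dy`,
`√((κ₃ - κ₂)(κ₁ - κ₃)) P dz` are, up to signs, `dx`, `dy`, `dz` (with absolute values under the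
roots): they are closed, which is conformal flatness, and the net is canonical. -/
structure IsGuichardHypersurface (U : Set R3) (φ P κ₁ κ₂ κ₃ : R3 → ℝ) (f N : R3 → E4) :
    Prop where
  smooth_f : ContDiffOn ℝ ∞ f U
  smooth_N : ContDiffOn ℝ ∞ N U
  P_pos : ∀ p ∈ U, 0 < P p
  sin_cos_ne : ∀ p ∈ U, Real.sin (φ p) * Real.cos (φ p) ≠ 0
  metric_xx : ∀ p ∈ U, ⟪dX f p, dX f p⟫_ℝ = P p ^ 2 * Real.cos (φ p) ^ 2
  metric_yy : ∀ p ∈ U, ⟪dY f p, dY f p⟫_ℝ = P p ^ 2 * Real.sin (φ p) ^ 2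
  metric_zz : ∀ p ∈ U, ⟪dZ f p, dZ f p⟫_ℝ = P p ^ 2
  metric_xy : ∀ p ∈ U, ⟪dX f p, dY f p⟫_ℝ = 0
  metric_xz : ∀ p ∈ U, ⟪dX f p, dZ f p⟫_ℝ = 0
  metric_yz : ∀ p ∈ U, ⟪dY f p, dZ f p⟫_ℝ = 0
  norm_N : ∀ p ∈ U, ‖N p‖ = 1
  N_x : ∀ p ∈ U, ⟪N p, dX f p⟫_ℝ = 0
  N_y : ∀ p ∈ U, ⟪N p, dY f p⟫_ℝ = 0
  N_z : ∀ p ∈ U, ⟪N p, dZ f p⟫_ℝ = 0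
  weingarten_x : ∀ p ∈ U, dX N p = -(κ₁ p • dX f p)
  weingarten_y : ∀ p ∈ U, dY N p = -(κ₂ p • dY f p)
  weingarten_z : ∀ p ∈ U, dZ N p = -(κ₃ p • dZ f p)
  κ₁_eq : ∀ p ∈ U, κ₁ p = (P p)⁻¹ * Real.tan (φ p) + κ₃ p
  κ₂_eq : ∀ p ∈ U, κ₂ p = -((P p)⁻¹ * Real.cot (φ p)) + κ₃ p

/-- The eigenvalue `σ₁` for `∂/∂x` of the Schouten (1,1)-tensor `S = Ric - (scal / 4) id`. -/
def sigma₁ (κ₁ κ₂ κ₃ : R3 → ℝ) (p : R3) : ℝ :=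
  (κ₁ p * κ₂ p - κ₂ p * κ₃ p + κ₃ p * κ₁ p) / 2

/-- The eigenvalue `σ₂` for `∂/∂y` of the Schouten (1,1)-tensor. -/
def sigma₂ (κ₁ κ₂ κ₃ : R3 → ℝ) (p : R3) : ℝ :=
  (κ₁ p * κ₂ p + κ₂ p * κ₃ p - κ₃ p * κ₁ p) / 2

/-- The eigenvalue `σ₃` for `∂/∂z` of the Schouten (1,1)-tensor. -/
def sigma₃ (κ₁ κ₂ κ₃ : R3 → ℝ) (p : R3) : ℝ :=
  (-(κ₁ p * κ₂ p) + κ₂ p * κ₃ p + κ₃ p * κ₁ p) / 2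

/-- The Schouten (1,1)-tensor of the hypersurface: the coordinate directions are its
eigenvectors, with eigenvalues `σ₁, σ₂, σ₃`. -/
def schouten (κ₁ κ₂ κ₃ : R3 → ℝ) (p : R3) : R3 →L[ℝ] R3 :=
  (sigma₁ κ₁ κ₂ κ₃ p • ContinuousLinearMap.id ℝ ℝ).prodMap
    ((sigma₂ κ₁ κ₂ κ₃ p • ContinuousLinearMap.id ℝ ℝ).prodMap
      (sigma₃ κ₁ κ₂ κ₃ p • ContinuousLinearMap.id ℝ ℝ))

/-- By the Gauss equation, a hypersurface of Euclidean 4-space has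
`Ric = (tr W) W - W²` for its shape operator `W`; the `σᵢ` are the eigenvalues of
`Ric - (scal / 4) id`. -/
theorem sigma_eq_ricci (κ₁ κ₂ κ₃ : R3 → ℝ) (p : R3) :
    let H : ℝ := κ₁ p + κ₂ p + κ₃ p
    let ric : ℝ → ℝ := fun k => H * k - k ^ 2
    let scal : ℝ := ric (κ₁ p) + ric (κ₂ p) + ric (κ₃ p)
    sigma₁ κ₁ κ₂ κ₃ p = ric (κ₁ p) - scal / 4 ∧
    sigma₂ κ₁ κ₂ κ₃ p = ric (κ₂ p) - scal / 4 ∧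
    sigma₃ κ₁ κ₂ κ₃ p = ric (κ₃ p) - scal / 4 := by
  refine ⟨?_, ?_, ?_⟩ <;> simp only [sigma₁, sigma₂, sigma₃] <;> ring

/-- `fs` is a dual of `f` on `U`: `d fs = df ∘ S` (so `fs` is determined up to a translation). -/
def IsDual (U : Set R3) (f : R3 → E4) (κ₁ κ₂ κ₃ : R3 → ℝ) (fs : R3 → E4) : Prop :=
  ∀ p ∈ U, HasFDerivAt fs ((fderiv ℝ f p).comp (schouten κ₁ κ₂ κ₃ p)) p

/-- The open set `U* = {det S ≠ 0}` on which the dual is regular. -/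
def regularSet (U : Set R3) (κ₁ κ₂ κ₃ : R3 → ℝ) : Set R3 :=
  {p ∈ U | sigma₁ κ₁ κ₂ κ₃ p * sigma₂ κ₁ κ₂ κ₃ p * sigma₃ κ₁ κ₂ κ₃ p ≠ 0}

/-- The conformal factor `P* = σ₃ P` of the dual. -/
def dualP (P κ₁ κ₂ κ₃ : R3 → ℝ) (p : R3) : ℝ := sigma₃ κ₁ κ₂ κ₃ p * P p

/-- The principal curvature `κ₁* = -κ₁ / σ₁` of the dual, for the normal `N* = -N`. -/
def dualκ₁ (κ₁ κ₂ κ₃ : R3 → ℝ) (p : R3) : ℝ := -κ₁ p / sigma₁ κ₁ κ₂ κ₃ p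

/-- The principal curvature `κ₂* = -κ₂ / σ₂` of the dual. -/
def dualκ₂ (κ₁ κ₂ κ₃ : R3 → ℝ) (p : R3) : ℝ := -κ₂ p / sigma₂ κ₁ κ₂ κ₃ p

/-- The principal curvature `κ₃* = -κ₃ / σ₃` of the dual. -/
def dualκ₃ (κ₁ κ₂ κ₃ : R3 → ℝ) (p : R3) : ℝ := -κ₃ p / sigma₃ κ₁ κ₂ κ₃ p

/-- The unit normal `N* = -N` of the dual. -/
def dualN (N : R3 → E4) (p : R3) : E4 := -N p

/-- `φs` determines the Guichard net of the dual:
`cos φ* = (σ₁ / σ₃) cos φ` and `sin φ* = (σ₂ / σ₃) sin φ`. -/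
def IsDualAngle (U : Set R3) (φ κ₁ κ₂ κ₃ φs : R3 → ℝ) : Prop :=
  ∀ p ∈ U,
    Real.cos (φs p) = sigma₁ κ₁ κ₂ κ₃ p / sigma₃ κ₁ κ₂ κ₃ p * Real.cos (φ p) ∧
    Real.sin (φs p) = sigma₂ κ₁ κ₂ κ₃ p / sigma₃ κ₁ κ₂ κ₃ p * Real.sin (φ p)

/-- The unit principal curvature vector `X_γ = P⁻¹ f_z`. -/
def Xγ (P : R3 → ℝ) (f : R3 → E4) (p : R3) : E4 := (P p)⁻¹ • dZ f p

/-- The vector `A = -X_γ + φ_z N`. -/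
def vecA (φ P : R3 → ℝ) (f N : R3 → E4) (p : R3) : E4 := -Xγ P f p + dZ φ p • N p

/-- The function `K = -(P⁻¹)_z + κ₃ φ_z`. -/
def funK (φ P κ₃ : R3 → ℝ) (p : R3) : ℝ := -dZ (fun r => (P r)⁻¹) p + κ₃ p * dZ φ p

/-- Structure (a): for every `z` the `(x, y)`-surface lies in a hyperplane `H(z)`, and all `H(z)`
have the same unit normal vector `B`. -/
def StructureA (U : Set R3) (B : E4) (f : R3 → E4) : Prop :=
  ‖B‖ = 1 ∧ ∃ h : ℝ → ℝ, ∀ p ∈ U, ⟪B, f p⟫_ℝ = h p.2.2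

/-- The vector `-sin θ e₁ + cos θ e₂`, a unit vector if `e₁, e₂` are orthonormal. -/
def circleVec (e₁ e₂ : E4) (t : ℝ) : E4 := -(Real.sin t • e₁) + Real.cos t • e₂

/-- Structure (b): for every `z` the `(x, y)`-surface lies in a linear hyperplane `H(z)` with
unit normal `B(z) = circleVec e₁ e₂ (θ z)`, which moves on the unit circle of the linear plane
`L` with orthonormal basis `e₁, e₂`. -/
structure StructureB (U : Set R3) (e₁ e₂ : E4) (θ : ℝ → ℝ) (f : R3 → E4) : Prop where
  norm_e₁ : ‖e₁‖ = 1
  norm_e₂ : ‖e₂‖ = 1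
  orth : ⟪e₁, e₂⟫_ℝ = 0
  smooth_θ : ContDiffOn ℝ ∞ θ (zProj U)
  moves : ∀ z ∈ zProj U, deriv θ z ≠ 0
  mem : ∀ p ∈ U, ⟪circleVec e₁ e₂ (θ p.2.2), f p⟫_ℝ = 0

/-- Structure (c): for every `z` the `(x, y)`-surface lies on a 3-sphere centered at the
origin. -/
def StructureC (U : Set R3) (f : R3 → E4) : Prop :=
  ∃ r : ℝ → ℝ, ∀ p ∈ U, 0 < r p.2.2 ∧ ‖f p‖ = r p.2.2

/-- `g = T ∘ f` on `U` for a conformal (Möbius) transformation `T` of `ℝ⁴ ∪ {∞}`, that is for a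
similarity or for a similarity after the inversion in a unit sphere, where `f` avoids
the center. -/
def ConformallyEquivalentOn (U : Set R3) (f g : R3 → E4) : Prop :=
  ∃ (T : E4 ≃ₗᵢ[ℝ] E4) (r : ℝ) (b : E4), 0 < r ∧
    ((∀ p ∈ U, g p = r • T (f p) + b) ∨
      ∃ q : E4, ∀ p ∈ U, f p ≠ q ∧ g p = r • T (EuclideanGeometry.inversion q 1 (f p)) + b)

/-- `fs` is not conformally equivalent to `f`, neither on `U` nor on the regular set `U*`
(when the latter is not empty). -/
def NotConformallyEquivalent (U : Set R3) (κ₁ κ₂ κ₃ : R3 → ℝ) (f fs : R3 → E4) : Prop :=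
  ¬ ConformallyEquivalentOn U f fs ∧
    ((regularSet U κ₁ κ₂ κ₃).Nonempty →
      ¬ ConformallyEquivalentOn (regularSet U κ₁ κ₂ κ₃) f fs)

end

end GuichardDual

/-! Put u = P⁻¹, k = κ₃ and w = u + ik. Inserting the formulas for κ₁, κ₂ into the Schouten
eigenvalues gives 2σ₃ = |w|² and 2(σ₁ cos φ + i σ₂ sin φ) = -e^{iφ} w². So the dual angle is φ* = φ
+ 2 arg w + π, and the theorem amounts to the study of w: why arg w splits into a function of (x, y)
and a function of z, and why the resulting λ*, μ* solve the same equations.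

The Codazzi equations become k_x cos φ = -u_x sin φ, k_y sin φ = u_y cos φ and k_z = -μ'u
(`codazzi_x`, `codazzi_y`, `codazzi_z`). The Gauss equations are second order equations for u. The
normal form enters through one observation, `field_normal_and_curvature`: a field F orthogonal to
f_x and f_y, with ⟨F_x, f_x⟩ and ⟨F_y, f_y⟩ the same multiple ε of the metric coefficients, must be
proportional to A = -u f_z + μ'N, and the factor involves K = μ'k - u_z. The constant normal in (a)
and the moving normal in (b) are such fields with ε = 0, so K = 0. In (c) the position vector is one
with ε = 1, so K has no zero.

If K = 0, then w_z = -iμ'w, so w e^{iμ} does not depend on z. In (a) u and k have vanishing (x,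
y)-derivatives as well, and the Gauss equation makes w e^{iμ} a real constant C
(`structureA_exists`). In (b) its argument is a function Ψ(x, y), so λ* = λ + 2Ψ + π and μ* = -μ.
The Gauss equations yield Ψ_xx - Ψ_yy = (c₁²/2) sin 2Ψ cos 2(λ + Ψ) (`laplace_curvatureAngle`),
which is exactly what turns the equation of λ into the equation of λ*. In (c) the Gauss equation and
the first integral for μ give K = cu with a constant c ≠ 0 (`structureC_exists`); then k/u is an
explicit function of z, and λ* = λ while μ* = μ + 2 arctan(k/u) + π.

The formulas for f* are checked by differentiating the difference of the two sides, using σ₁ + σ₃ =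
κ₃κ₁ and σ₂ + σ₃ = κ₃κ₂. In (b) the remainder f* - σ₃f has no z-derivative and its (x,
y)-derivatives are orthogonal to B(z) for all z, hence to L.

A Möbius transformation stretches all directions at a point equally, so conformal equivalence forces
|σ₁| = σ₃, that is cos² φ* = cos² φ. By connectedness φ* - φ or φ* + φ is then constant
(`notConformallyEquivalent`), and it remains to exclude equal and opposite gradients of λ*, μ* and
λ, μ. For this (b) uses condition (d) and the non-vanishing velocity of B. -/

namespace GuichardDual

noncomputable section

/-! ### Calculus of directional derivatives -/

section Partial

variable {E : Type*} [NormedAddCommGroup E] [NormedSpace ℝ E]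
  {F : Type*} [NormedAddCommGroup F] [NormedSpace ℝ F]

/-- `g` is differentiable at `p`, with derivative `g'` in the direction `v`. -/
def HasPartial (v : E) (g : E → F) (g' : F) (p : E) : Prop :=
  DifferentiableAt ℝ g p ∧ fderiv ℝ g p v = g'

/-- The derivative in the direction `v`. -/
def pd (v : E) (g : E → F) (p : E) : F := fderiv ℝ g p v

namespace HasPartial

variable {U : Set E} {v p : E}

theorem of_contDiffOn {g : E → F} (hU : IsOpen U) (hg : ContDiffOn ℝ ∞ g U) (hp : p ∈ U) (v : E) :
    HasPartial v g (pd v g p) p :=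
  ⟨(hg.contDiffAt (hU.mem_nhds hp)).differentiableAt (by simp), rfl⟩

theorem of_hasFDerivAt {g : E → F} {g' : E →L[ℝ] F} (hg : HasFDerivAt g g' p) (v : E) :
    HasPartial v g (g' v) p :=
  ⟨hg.differentiableAt, by rw [hg.fderiv]⟩

theorem pd_eq {g : E → F} {g' : F} (h : HasPartial v g g' p) : pd v g p = g' := h.2

theorem unique {g : E → F} {g' g'' : F} (h : HasPartial v g g' p) (h' : HasPartial v g g'' p) :
    g' = g'' := h.2.symm.trans h'.2

theorem eq {g : E → F} {g' g'' : F} (h : HasPartial v g g' p) (e : g' = g'') :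
    HasPartial v g g'' p := e ▸ h

theorem congr_on {g h : E → F} {g' : F} (hg : HasPartial v g g' p) (hU : IsOpen U) (hp : p ∈ U)
    (e : ∀ q ∈ U, g q = h q) : HasPartial v h g' p := by
  have ev : h =ᶠ[nhds p] g := by
    filter_upwards [hU.mem_nhds hp] with q hq using (e q hq).symm
  exact ⟨hg.1.congr_of_eventuallyEq ev, by rw [ev.fderiv_eq]; exact hg.2⟩

/-- The standard way to differentiate an identity: both sides are differentiated by the rules below,
and the two values agree because the identity holds on an open set. -/
theorem eq_of_eqOn {g h : E → F} {g' h' : F} (hg : HasPartial v g g' p)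
    (hh : HasPartial v h h' p) (hU : IsOpen U) (hp : p ∈ U) (e : ∀ q ∈ U, g q = h q) : g' = h' :=
  (hg.congr_on hU hp e).unique hh

theorem const (c : F) : HasPartial v (fun _ : E => c) 0 p :=
  ⟨differentiableAt_const _, by simp⟩

theorem add {g h : E → F} {g' h' : F} (hg : HasPartial v g g' p) (hh : HasPartial v h h' p) :
    HasPartial v (fun q => g q + h q) (g' + h') p :=
  ⟨hg.1.add hh.1, by rw [fderiv_fun_add hg.1 hh.1, ← hg.2, ← hh.2]; rfl⟩

theorem sub {g h : E → F} {g' h' : F} (hg : HasPartial v g g' p) (hh : HasPartial v h h' p) :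
    HasPartial v (fun q => g q - h q) (g' - h') p :=
  ⟨hg.1.sub hh.1, by rw [fderiv_fun_sub hg.1 hh.1, ← hg.2, ← hh.2]; rfl⟩

theorem neg {g : E → F} {g' : F} (hg : HasPartial v g g' p) :
    HasPartial v (fun q => -g q) (-g') p :=
  ⟨hg.1.neg, by rw [fderiv_fun_neg, ← hg.2]; rfl⟩

theorem smul {g : E → ℝ} {h : E → F} {g' : ℝ} {h' : F} (hg : HasPartial v g g' p)
    (hh : HasPartial v h h' p) : HasPartial v (fun q => g q • h q) (g' • h p + g p • h') p :=
  ⟨hg.1.smul hh.1, by rw [fderiv_fun_smul hg.1 hh.1, ← hg.2, ← hh.2]; simp [add_comm]⟩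

theorem mul {g h : E → ℝ} {g' h' : ℝ} (hg : HasPartial v g g' p) (hh : HasPartial v h h' p) :
    HasPartial v (fun q => g q * h q) (g' * h p + g p * h') p :=
  hg.smul hh

theorem sq {g : E → ℝ} {g' : ℝ} (hg : HasPartial v g g' p) :
    HasPartial v (fun q => g q ^ 2) (2 * g p * g') p := by
  simp only [pow_two]
  exact (hg.mul hg).eq (by ring)

theorem inner {G : Type*} [NormedAddCommGroup G] [InnerProductSpace ℝ G] {g h : E → G} {g' h' : G}
    (hg : HasPartial v g g' p) (hh : HasPartial v h h' p) :
    HasPartial v (fun q => ⟪g q, h q⟫_ℝ) (⟪g', h p⟫_ℝ + ⟪g p, h'⟫_ℝ) p :=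
  ⟨hg.1.inner ℝ hh.1, by rw [fderiv_inner_apply ℝ hg.1 hh.1, hg.2, hh.2, add_comm]⟩

theorem comp_hasDerivAt {g : E → ℝ} {g' : ℝ} (hg : HasPartial v g g' p) {φ : ℝ → F} {φ' : F}
    (hφ : HasDerivAt φ φ' (g p)) : HasPartial v (fun q => φ (g q)) (g' • φ') p := by
  have := hφ.hasFDerivAt.comp p hg.1.hasFDerivAt
  exact (of_hasFDerivAt this v).eq (by simp [← hg.2])

theorem sin {g : E → ℝ} {g' : ℝ} (hg : HasPartial v g g' p) :
    HasPartial v (fun q => Real.sin (g q)) (Real.cos (g p) * g') p :=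
  (hg.comp_hasDerivAt (Real.hasDerivAt_sin _)).eq (mul_comm _ _)

theorem cos {g : E → ℝ} {g' : ℝ} (hg : HasPartial v g g' p) :
    HasPartial v (fun q => Real.cos (g q)) (-Real.sin (g p) * g') p :=
  (hg.comp_hasDerivAt (Real.hasDerivAt_cos _)).eq (mul_comm _ _)

theorem arctan {g : E → ℝ} {g' : ℝ} (hg : HasPartial v g g' p) :
    HasPartial v (fun q => Real.arctan (g q)) (g' / (1 + g p ^ 2)) p :=
  (hg.comp_hasDerivAt (Real.hasDerivAt_arctan _)).eq (by simp [div_eq_mul_inv])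

theorem inv {g : E → ℝ} {g' : ℝ} (hg : HasPartial v g g' p) (h0 : g p ≠ 0) :
    HasPartial v (fun q => (g q)⁻¹) (-g' / g p ^ 2) p :=
  (hg.comp_hasDerivAt (hasDerivAt_inv h0)).eq (by simp [div_eq_mul_inv])

theorem div {g h : E → ℝ} {g' h' : ℝ} (hg : HasPartial v g g' p) (hh : HasPartial v h h' p)
    (h0 : h p ≠ 0) :
    HasPartial v (fun q => g q / h q) ((g' * h p - g p * h') / h p ^ 2) p := by
  simp only [div_eq_mul_inv]
  exact (hg.mul (hh.inv h0)).eq (by field_simp; ring)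

end HasPartial

variable {U : Set E}

theorem contDiffOn_pd {g : E → F} (hU : IsOpen U) (hg : ContDiffOn ℝ ∞ g U) (v : E) :
    ContDiffOn ℝ ∞ (pd v g) U :=
  (((contDiffOn_infty_iff_fderiv_of_isOpen hU).1 hg).2).clm_apply contDiffOn_const

theorem pd_comm {g : E → F} (hU : IsOpen U) (hg : ContDiffOn ℝ ∞ g U) {p : E} (hp : p ∈ U)
    (v w : E) : pd v (pd w g) p = pd w (pd v g) p := by
  have hA : ContDiffAt ℝ ∞ g p := hg.contDiffAt (hU.mem_nhds hp)
  have hs : IsSymmSndFDerivAt ℝ g p := hA.isSymmSndFDerivAt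
    (by rw [minSmoothness_of_isRCLikeNormedField]; exact WithTop.coe_le_coe.2 (le_top : (2 : ℕ∞) ≤ ⊤))
  have hd : DifferentiableAt ℝ (fderiv ℝ g) p :=
    ((((contDiffOn_infty_iff_fderiv_of_isOpen hU).1 hg).2).contDiffAt
      (hU.mem_nhds hp)).differentiableAt (by simp)
  have key : ∀ a b : E, pd a (pd b g) p = fderiv ℝ (fderiv ℝ g) p a b := fun a b => by
    have := (hd.hasFDerivAt.clm_apply (hasFDerivAt_const b p)).fderiv
    simp only [pd]
    change fderiv ℝ (fun q => fderiv ℝ g q b) p a = _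
    rw [this]; simp
  rw [key, key]; exact hs v w

theorem pd_congr {g h : E → F} (hU : IsOpen U) {p : E} (hp : p ∈ U) (e : ∀ q ∈ U, g q = h q)
    (v : E) : pd v g p = pd v h p := by
  have ev : g =ᶠ[nhds p] h := by
    filter_upwards [hU.mem_nhds hp] with q hq using e q hq
  simp only [pd, ev.fderiv_eq]

end Partial

/-! ### Hypersurfaces in principal coordinates: Codazzi and Gauss equations -/

/-- Expansion of an inner product along four orthogonal non-zero vectors of `ℝ⁴`. -/
theorem inner_eq_sum_of_orthogonal {a : Fin 4 → E4} (h0 : ∀ i, 0 < ⟪a i, a i⟫_ℝ)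
    (ho : ∀ i j, i ≠ j → ⟪a i, a j⟫_ℝ = 0) (v w : E4) :
    ⟪v, w⟫_ℝ = ∑ i, ⟪v, a i⟫_ℝ * ⟪w, a i⟫_ℝ / ⟪a i, a i⟫_ℝ := by
  have hn : ∀ i, ‖a i‖ ≠ 0 := fun i h => by
    have := h0 i; rw [real_inner_self_eq_norm_sq, h] at this; simp at this
  have hon : Orthonormal ℝ (fun i => (‖a i‖)⁻¹ • a i) := by
    refine ⟨fun i => ?_, fun i j hij => ?_⟩
    · rw [norm_smul, norm_inv, norm_norm, inv_mul_cancel₀ (hn i)]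
    · simp [inner_smul_left, inner_smul_right, ho i j hij]
  let b : OrthonormalBasis (Fin 4) ℝ E4 :=
    (basisOfOrthonormalOfCardEqFinrank hon (by simp)).toOrthonormalBasis (by simpa using hon)
  have hb : ∀ i, b i = (‖a i‖)⁻¹ • a i := fun i => by simp [b]
  rw [← b.sum_inner_mul_inner v w]
  refine Finset.sum_congr rfl fun i _ => ?_
  rw [hb, inner_smul_left, inner_smul_right, real_inner_self_eq_norm_sq, real_inner_comm w]
  have := hn i
  simp; field_simp

/-- A hypersurface `f` of `ℝ⁴` with unit normal `N`, for which the directions `e i` are orthogonal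
principal directions, with squared lengths `g i` and principal curvatures `κ i`. -/
structure PrincipalCoords (U : Set R3) (e : Fin 3 → R3) (g κ : Fin 3 → R3 → ℝ) (f N : R3 → E4) :
    Prop where
  isOpen : IsOpen U
  smooth_f : ContDiffOn ℝ ∞ f U
  smooth_N : ContDiffOn ℝ ∞ N U
  g_pos : ∀ i, ∀ p ∈ U, 0 < g i p
  metric : ∀ i, ∀ p ∈ U, ⟪pd (e i) f p, pd (e i) f p⟫_ℝ = g i p
  orth : ∀ i j, i ≠ j → ∀ p ∈ U, ⟪pd (e i) f p, pd (e j) f p⟫_ℝ = 0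
  norm_N : ∀ p ∈ U, ‖N p‖ = 1
  normal : ∀ i, ∀ p ∈ U, ⟪N p, pd (e i) f p⟫_ℝ = 0
  weingarten : ∀ i, ∀ p ∈ U, pd (e i) N p = -(κ i p • pd (e i) f p)

namespace PrincipalCoords

variable {U : Set R3} {e : Fin 3 → R3} {g κ : Fin 3 → R3 → ℝ} {f N : R3 → E4}
  (H : PrincipalCoords U e g κ f N)

include H

theorem smooth_pd (i : Fin 3) : ContDiffOn ℝ ∞ (pd (e i) f) U :=
  contDiffOn_pd H.isOpen H.smooth_f _

/-- Only f and N are assumed smooth. The metric coefficients, and then the principal curvatures,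
inherit smoothness as inner products of derivatives of f and N. -/
theorem smooth_g (i : Fin 3) : ContDiffOn ℝ ∞ (g i) U :=
  ((H.smooth_pd i).inner ℝ (H.smooth_pd i)).congr fun p hp => (H.metric i p hp).symm

theorem smooth_κ (i : Fin 3) : ContDiffOn ℝ ∞ (κ i) U := by
  have h : ContDiffOn ℝ ∞ (fun p => -⟪pd (e i) N p, pd (e i) f p⟫_ℝ / g i p) U :=
    ((contDiffOn_pd H.isOpen H.smooth_N (e i)).inner ℝ (H.smooth_pd i)).neg.div (H.smooth_g i)
      fun p hp => (H.g_pos i p hp).ne'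
  refine h.congr fun p hp => ?_
  have := (H.g_pos i p hp).ne'
  rw [H.weingarten i p hp, inner_neg_left, inner_smul_left, H.metric i p hp]
  simp; field_simp

theorem hasPartial_pd {p : R3} (hp : p ∈ U) (i : Fin 3) (v : R3) :
    HasPartial v (pd (e i) f) (pd v (pd (e i) f) p) p :=
  .of_contDiffOn H.isOpen (H.smooth_pd i) hp v

theorem hasPartial_N {p : R3} (hp : p ∈ U) (v : R3) : HasPartial v N (pd v N p) p :=
  .of_contDiffOn H.isOpen H.smooth_N hp v

theorem hasPartial_g {p : R3} (hp : p ∈ U) (i : Fin 3) (v : R3) :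
    HasPartial v (g i) (pd v (g i) p) p :=
  .of_contDiffOn H.isOpen (H.smooth_g i) hp v

theorem hasPartial_κ {p : R3} (hp : p ∈ U) (i : Fin 3) (v : R3) :
    HasPartial v (κ i) (pd v (κ i) p) p :=
  .of_contDiffOn H.isOpen (H.smooth_κ i) hp v

theorem snd_comm {p : R3} (hp : p ∈ U) (i j : Fin 3) :
    pd (e i) (pd (e j) f) p = pd (e j) (pd (e i) f) p := pd_comm H.isOpen H.smooth_f hp _ _

/-- `⟪f_ij, f_i⟫ = (g_i)_j / 2`. -/
theorem inner_snd_left {p : R3} (hp : p ∈ U) (i j : Fin 3) :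
    ⟪pd (e j) (pd (e i) f) p, pd (e i) f p⟫_ℝ = pd (e j) (g i) p / 2 := by
  have := ((H.hasPartial_pd hp i (e j)).inner (H.hasPartial_pd hp i (e j))).eq_of_eqOn
    (H.hasPartial_g hp i (e j)) H.isOpen hp (H.metric i)
  rw [real_inner_comm (pd (e j) (pd (e i) f) p)] at this
  linarith

/-- `⟪f_ij, f_k⟫ + ⟪f_i, f_kj⟫ = 0` for `i ≠ k`. -/
theorem inner_snd_add {p : R3} (hp : p ∈ U) (j : Fin 3) {i k : Fin 3} (hik : i ≠ k) :
    ⟪pd (e j) (pd (e i) f) p, pd (e k) f p⟫_ℝ + ⟪pd (e i) f p, pd (e j) (pd (e k) f) p⟫_ℝ = 0 :=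
  ((H.hasPartial_pd hp i (e j)).inner (H.hasPartial_pd hp k (e j))).eq_of_eqOn
    (.const 0) H.isOpen hp (H.orth i k hik)

/-- `⟪f_ii, f_j⟫ = -(g_i)_j / 2` for `i ≠ j`. -/
theorem inner_snd_diag {p : R3} (hp : p ∈ U) {i j : Fin 3} (hij : i ≠ j) :
    ⟪pd (e i) (pd (e i) f) p, pd (e j) f p⟫_ℝ = -(pd (e j) (g i) p / 2) := by
  have h1 := H.inner_snd_add hp i hij
  have h2 := H.inner_snd_left hp i j
  rw [H.snd_comm hp i j] at h1
  linarith [real_inner_comm (pd (e i) f p) (pd (e j) (pd (e i) f) p)]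

/-- Differentiating the three orthogonality relations shows that ⟨f_ij, f_k⟩, ⟨f_ik, f_j⟩, ⟨f_jk,
f_i⟩ have pairwise sums zero, so all three vanish. -/
theorem inner_snd_distinct {p : R3} (hp : p ∈ U) {i j k : Fin 3} (hij : i ≠ j) (hjk : j ≠ k)
    (hik : i ≠ k) : ⟪pd (e i) (pd (e j) f) p, pd (e k) f p⟫_ℝ = 0 := by
  have h1 := H.inner_snd_add hp i hjk
  have h2 := H.inner_snd_add hp j hik
  have h3 := H.inner_snd_add hp k hij
  rw [H.snd_comm hp j i] at h2
  rw [H.snd_comm hp k i, H.snd_comm hp k j] at h3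
  linarith [real_inner_comm (pd (e j) f p) (pd (e i) (pd (e k) f) p),
    real_inner_comm (pd (e i) f p) (pd (e j) (pd (e k) f) p)]

theorem inner_snd_normal {p : R3} (hp : p ∈ U) (i j : Fin 3) :
    ⟪pd (e j) (pd (e i) f) p, N p⟫_ℝ = if i = j then κ i p * g i p else 0 := by
  have h1 := ((H.hasPartial_N hp (e j)).inner (H.hasPartial_pd hp i (e j))).eq_of_eqOn
    (.const 0) H.isOpen hp (H.normal i)
  rw [H.weingarten j p hp, inner_neg_left, inner_smul_left, real_inner_comm _ (N p)] at h1
  split_ifs with h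
  · subst h
    rw [H.metric i p hp] at h1
    simp at h1; linarith
  · rw [H.orth j i (Ne.symm h) p hp] at h1
    simpa using h1

/-- The Codazzi equations. -/
theorem codazzi {p : R3} (hp : p ∈ U) {i j : Fin 3} (hij : i ≠ j) :
    pd (e j) (κ i) p * g i p = (κ j p - κ i p) * (pd (e j) (g i) p / 2) := by
  have h1 := (((H.hasPartial_κ hp i (e j)).smul (H.hasPartial_pd hp i (e j))).neg.congr_on
    H.isOpen hp fun q hq => (H.weingarten i q hq).symm).pd_eq
  have h2 := (((H.hasPartial_κ hp j (e i)).smul (H.hasPartial_pd hp j (e i))).neg.congr_on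
    H.isOpen hp fun q hq => (H.weingarten j q hq).symm).pd_eq
  have h3 := pd_comm H.isOpen H.smooth_N hp (e i) (e j)
  rw [h1, h2, H.snd_comm hp i j] at h3
  -- The Codazzi equation is the f_i-component of N_ij = N_ji.
  have h4 := congrArg (fun w => ⟪w, pd (e i) f p⟫_ℝ) h3
  simp only [inner_neg_left, inner_add_left, inner_smul_left, H.inner_snd_left hp i j,
    H.metric i p hp, H.orth j i hij.symm p hp] at h4
  simp at h4
  linarith

/-- Expansion of an inner product in the orthogonal frame `e i f, e j f, e k f, N`. -/
theorem inner_eq {p : R3} (hp : p ∈ U) (v w : E4) :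
    ⟪v, w⟫_ℝ = ⟪v, pd (e 0) f p⟫_ℝ * ⟪w, pd (e 0) f p⟫_ℝ / g 0 p +
      ⟪v, pd (e 1) f p⟫_ℝ * ⟪w, pd (e 1) f p⟫_ℝ / g 1 p +
      ⟪v, pd (e 2) f p⟫_ℝ * ⟪w, pd (e 2) f p⟫_ℝ / g 2 p + ⟪v, N p⟫_ℝ * ⟪w, N p⟫_ℝ := by
  have hN : ⟪N p, N p⟫_ℝ = 1 := by rw [real_inner_self_eq_norm_sq, H.norm_N p hp]; norm_num
  have h := inner_eq_sum_of_orthogonal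
    (a := ![pd (e 0) f p, pd (e 1) f p, pd (e 2) f p, N p]) (fun i => ?_) (fun i j hij => ?_) v w
  · simpa only [Fin.sum_univ_four, Matrix.cons_val, H.metric _ p hp, hN, div_one] using h
  · fin_cases i
    · simpa only [Matrix.cons_val, Fin.zero_eta, Fin.mk_one, Fin.reduceFinMk, H.metric _ p hp] using H.g_pos 0 p hp
    · simpa only [Matrix.cons_val, Fin.zero_eta, Fin.mk_one, Fin.reduceFinMk, H.metric _ p hp] using H.g_pos 1 p hp
    · simpa only [Matrix.cons_val, Fin.zero_eta, Fin.mk_one, Fin.reduceFinMk, H.metric _ p hp] using H.g_pos 2 p hp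
    · simpa only [Matrix.cons_val, Fin.reduceFinMk, hN] using one_pos
  · have hn : ∀ i, ⟪pd (e i) f p, N p⟫_ℝ = 0 := fun i => by
      rw [real_inner_comm]; exact H.normal i p hp
    fin_cases i <;> fin_cases j <;>
      first
      | exact absurd rfl hij
      | simpa using H.orth _ _ (by decide) p hp
      | simpa using H.normal _ p hp
      | simpa using hn _

/-- `⟪f_ii, f_jj⟫ - ⟪f_ij, f_ij⟫` in terms of second derivatives of the metric. -/
theorem inner_snd_snd {p : R3} (hp : p ∈ U) {i j : Fin 3} (hij : i ≠ j) :
    ⟪pd (e i) (pd (e i) f) p, pd (e j) (pd (e j) f) p⟫_ℝ -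
      ⟪pd (e j) (pd (e i) f) p, pd (e j) (pd (e i) f) p⟫_ℝ =
      -((pd (e j) (pd (e j) (g i)) p + pd (e i) (pd (e i) (g j)) p) / 2) := by
  have sm : ∀ a b, ContDiffOn ℝ ∞ (pd (e a) (pd (e b) f)) U := fun a b =>
    contDiffOn_pd H.isOpen (H.smooth_pd b) _
  have hs : ∀ a b c, HasPartial (e c) (pd (e a) (pd (e b) f))
    (pd (e c) (pd (e a) (pd (e b) f)) p) p := fun a b c =>
    .of_contDiffOn H.isOpen (sm a b) hp _
  have hg : ∀ a b, HasPartial (e b) (pd (e b) (g a)) (pd (e b) (pd (e b) (g a)) p) p :=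
    fun a b => .of_contDiffOn H.isOpen (contDiffOn_pd H.isOpen (H.smooth_g a) _) hp _
  -- the first derivatives `⟪f_ii, f_j⟫ = -(g_i)_j / 2` and `⟪f_ij, f_j⟫ = (g_j)_i / 2`
  have h1 := ((hs i i j).inner (H.hasPartial_pd hp j (e j))).eq_of_eqOn
    ((hg i j).mul (.const (-1 / 2))) H.isOpen hp
    fun q hq => by rw [H.inner_snd_diag hq hij]; ring
  have h2 := ((hs j i i).inner (H.hasPartial_pd hp j (e i))).eq_of_eqOn
    ((hg j i).mul (.const (1 / 2))) H.isOpen hp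
    fun q hq => by rw [← H.snd_comm hq i j, H.inner_snd_left hq j i]; ring
  have h3 : pd (e i) (pd (e j) (pd (e i) f)) p = pd (e j) (pd (e i) (pd (e i) f)) p :=
    pd_comm H.isOpen (H.smooth_pd i) hp _ _
  rw [h3, H.snd_comm hp i j] at h2
  linarith

/-- The Gauss equations. -/
theorem gauss {p : R3} (hp : p ∈ U) {i j k : Fin 3} (hij : i ≠ j) (hik : i ≠ k) (hjk : j ≠ k) :
    -(pd (e i) (g i) p * pd (e i) (g j) p / (4 * g i p)) -
      pd (e j) (g i) p * pd (e j) (g j) p / (4 * g j p) +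
      pd (e k) (g i) p * pd (e k) (g j) p / (4 * g k p) + κ i p * g i p * (κ j p * g j p) -
      pd (e j) (g i) p ^ 2 / (4 * g i p) - pd (e i) (g j) p ^ 2 / (4 * g j p) =
      -((pd (e j) (pd (e j) (g i)) p + pd (e i) (pd (e i) (g j)) p) / 2) := by
  have expand : ∀ v w : E4, ⟪v, w⟫_ℝ =
      ⟪v, pd (e i) f p⟫_ℝ * ⟪w, pd (e i) f p⟫_ℝ / g i p +
      ⟪v, pd (e j) f p⟫_ℝ * ⟪w, pd (e j) f p⟫_ℝ / g j p +
      ⟪v, pd (e k) f p⟫_ℝ * ⟪w, pd (e k) f p⟫_ℝ / g k p + ⟪v, N p⟫_ℝ * ⟪w, N p⟫_ℝ := by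
    intro v w
    have h := H.inner_eq hp v w
    fin_cases i <;> fin_cases j <;> fin_cases k <;> simp at hij hik hjk <;>
      simp only [Fin.zero_eta, Fin.mk_one, Fin.reduceFinMk] <;> linarith
  have gi := (H.g_pos i p hp).ne'
  have gj := (H.g_pos j p hp).ne'
  have gk := (H.g_pos k p hp).ne'
  -- ⟨f_ii, f_jj⟩ - ⟨f_ij, f_ij⟩ is intrinsic; its expansion in the frame brings in the Christoffel
  -- terms and, through N, the product of the curvatures.
  rw [← H.inner_snd_snd hp hij, expand, expand (pd (e j) (pd (e i) f) p)]
  have hjj : ⟪pd (e j) (pd (e i) f) p, pd (e j) f p⟫_ℝ = pd (e i) (g j) p / 2 := by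
    rw [← H.snd_comm hp i j, H.inner_snd_left hp j i]
  rw [H.inner_snd_left hp i i, H.inner_snd_left hp j j, H.inner_snd_left hp i j, hjj,
    H.inner_snd_diag hp hij, H.inner_snd_diag hp hik, H.inner_snd_diag hp hij.symm,
    H.inner_snd_diag hp hjk, H.inner_snd_distinct hp hij.symm hik hjk,
    H.inner_snd_normal hp, H.inner_snd_normal hp, H.inner_snd_normal hp, if_pos rfl, if_pos rfl,
    if_neg hij]
  field_simp
  ring

end PrincipalCoords

/-! ### Functions of (x, y) and of z, pulled back to U -/

section Projections

variable {U : Set R3} {F : Type*} [NormedAddCommGroup F] [NormedSpace ℝ F]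

theorem isOpen_xyProj (hU : IsOpen U) : IsOpen (xyProj U) := by
  have h : IsOpenMap (fun p : R3 => (p.1, p.2.1)) := by
    have : IsOpenMap (Prod.map (id : ℝ → ℝ) (Prod.fst : ℝ × ℝ → ℝ)) :=
      IsOpenMap.id.prodMap isOpenMap_fst
    exact this
  exact h U hU

theorem isOpen_zProj (hU : IsOpen U) : IsOpen (zProj U) :=
  (isOpenMap_snd.comp isOpenMap_snd) U hU

theorem isPreconnected_xyProj (hU : IsPreconnected U) : IsPreconnected (xyProj U) :=
  hU.image _ (by fun_prop)

theorem isPreconnected_zProj (hU : IsPreconnected U) : IsPreconnected (zProj U) :=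
  hU.image _ (by fun_prop)

theorem mem_xyProj {p : R3} (hp : p ∈ U) : (p.1, p.2.1) ∈ xyProj U := ⟨p, hp, rfl⟩

theorem mem_zProj {p : R3} (hp : p ∈ U) : p.2.2 ∈ zProj U := ⟨p, hp, rfl⟩

theorem HasPartial.comp_xy {g : ℝ × ℝ → F} {p : R3} (hg : DifferentiableAt ℝ g (p.1, p.2.1))
    (v : R3) : HasPartial v (fun r : R3 => g (r.1, r.2.1)) (pd (v.1, v.2.1) g (p.1, p.2.1)) p := by
  have h1 : HasFDerivAt (fun r : R3 => (r.1, r.2.1))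
      ((ContinuousLinearMap.fst ℝ ℝ (ℝ × ℝ)).prod
        ((ContinuousLinearMap.fst ℝ ℝ ℝ).comp (ContinuousLinearMap.snd ℝ ℝ (ℝ × ℝ)))) p :=
    ((ContinuousLinearMap.fst ℝ ℝ (ℝ × ℝ)).prod
        ((ContinuousLinearMap.fst ℝ ℝ ℝ).comp (ContinuousLinearMap.snd ℝ ℝ (ℝ × ℝ)))).hasFDerivAt
  exact HasPartial.of_hasFDerivAt
    (HasFDerivAt.comp (f := fun r : R3 => (r.1, r.2.1)) p hg.hasFDerivAt h1) v

theorem HasPartial.comp_z {g : ℝ → F} {g' : F} {p : R3} (hg : HasDerivAt g g' p.2.2)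
    (v : R3) : HasPartial v (fun r : R3 => g r.2.2) (v.2.2 • g') p := by
  have h1 : HasFDerivAt (fun r : R3 => r.2.2)
      ((ContinuousLinearMap.snd ℝ ℝ ℝ).comp (ContinuousLinearMap.snd ℝ ℝ (ℝ × ℝ))) p :=
    ((ContinuousLinearMap.snd ℝ ℝ ℝ).comp (ContinuousLinearMap.snd ℝ ℝ (ℝ × ℝ))).hasFDerivAt
  exact (HasPartial.of_hasFDerivAt
    (HasFDerivAt.comp (f := fun r : R3 => r.2.2) p hg.hasFDerivAt h1) v).eq (by simp)

theorem contDiffOn_comp_xy {g : ℝ × ℝ → F} (hg : ContDiffOn ℝ ∞ g (xyProj U)) :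
    ContDiffOn ℝ ∞ (fun r : R3 => g (r.1, r.2.1)) U :=
  hg.comp (by fun_prop) fun _ hp => mem_xyProj hp

theorem contDiffOn_comp_z {g : ℝ → F} (hg : ContDiffOn ℝ ∞ g (zProj U)) :
    ContDiffOn ℝ ∞ (fun r : R3 => g r.2.2) U :=
  hg.comp (by fun_prop) fun _ hp => mem_zProj hp

theorem contDiffOn_deriv {g : ℝ → F} {J : Set ℝ} (hJ : IsOpen J) (hg : ContDiffOn ℝ ∞ g J) :
    ContDiffOn ℝ ∞ (deriv g) J :=
  ((contDiffOn_infty_iff_deriv_of_isOpen hJ).1 hg).2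

theorem hasDerivAt_of_contDiffOn {g : ℝ → F} {J : Set ℝ} (hJ : IsOpen J)
    (hg : ContDiffOn ℝ ∞ g J) {z : ℝ} (hz : z ∈ J) : HasDerivAt g (deriv g z) z :=
  ((hg.contDiffAt (hJ.mem_nhds hz)).differentiableAt (by simp)).hasDerivAt

end Projections

/-! ### The Guichard metric and the Codazzi equations in terms of u = P⁻¹ and κ₃ -/

/-- The standing assumptions on a generic conformally flat hypersurface with Guichard net given by
`φ = λ(x, y) + μ(z)`, with the first order equation for `μ` replaced by its derivative. -/
structure Setting (U : Set R3) (lam : ℝ × ℝ → ℝ) (mu : ℝ → ℝ) (c₁ : ℝ) (P κ₁ κ₂ κ₃ : R3 → ℝ)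
    (f N : R3 → E4) : Prop where
  isOpen : IsOpen U
  conn : IsPreconnected U
  fib : ∀ x y : ℝ, {z : ℝ | ((x, y, z) : R3) ∈ U}.OrdConnected
  smooth_lam : ContDiffOn ℝ ∞ lam (xyProj U)
  smooth_mu : ContDiffOn ℝ ∞ mu (zProj U)
  lam_eq : ∀ q ∈ xyProj U,
    pX (pX lam) q - pY (pY lam) q = c₁ ^ 2 / 2 * Real.sin (2 * lam q)
  mu_snd : ∀ z ∈ zProj U, deriv (deriv mu) z = -(c₁ ^ 2 * (Real.sin (mu z) * Real.cos (mu z)))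
  hyp : IsGuichardHypersurface U (angle lam mu) P κ₁ κ₂ κ₃ f N

/-- The function `P⁻¹`. -/
def invFactor (P : R3 → ℝ) (p : R3) : ℝ := (P p)⁻¹

/-- The coordinate directions. -/
def coordDir : Fin 3 → R3 := ![(1, 0, 0), (0, 1, 0), (0, 0, 1)]

namespace Setting

variable {U : Set R3} {lam : ℝ × ℝ → ℝ} {mu : ℝ → ℝ} {c₁ : ℝ} {P κ₁ κ₂ κ₃ : R3 → ℝ}
  {f N : R3 → E4} (H : Setting U lam mu c₁ P κ₁ κ₂ κ₃ f N) {p : R3} (hp : p ∈ U)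

include H

theorem isOpen_V : IsOpen (xyProj U) := isOpen_xyProj H.isOpen

theorem isOpen_J : IsOpen (zProj U) := isOpen_zProj H.isOpen

theorem principalCoords : PrincipalCoords U coordDir
    ![fun p => P p ^ 2 * Real.cos (angle lam mu p) ^ 2,
      fun p => P p ^ 2 * Real.sin (angle lam mu p) ^ 2, fun p => P p ^ 2]
    ![κ₁, κ₂, κ₃] f N where
  isOpen := H.isOpen
  smooth_f := H.hyp.smooth_f
  smooth_N := H.hyp.smooth_N
  g_pos i p hp := by
    have h1 := H.hyp.P_pos p hp
    have h2 := H.hyp.sin_cos_ne p hp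
    have h3 : 0 < Real.sin (angle lam mu p) ^ 2 := by
      have := left_ne_zero_of_mul h2; positivity
    have h4 : 0 < Real.cos (angle lam mu p) ^ 2 := by
      have := right_ne_zero_of_mul h2; positivity
    fin_cases i
    · exact mul_pos (pow_pos h1 2) h4
    · exact mul_pos (pow_pos h1 2) h3
    · exact pow_pos h1 2
  metric i p hp := by
    fin_cases i
    · exact H.hyp.metric_xx p hp
    · exact H.hyp.metric_yy p hp
    · exact H.hyp.metric_zz p hp
  orth i j hij p hp := by
    have h1 := H.hyp.metric_xy p hp
    have h2 := H.hyp.metric_xz p hp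
    have h3 := H.hyp.metric_yz p hp
    fin_cases i <;> fin_cases j
    · exact absurd rfl hij
    · exact h1
    · exact h2
    · exact (real_inner_comm _ _).trans h1
    · exact absurd rfl hij
    · exact h3
    · exact (real_inner_comm _ _).trans h2
    · exact (real_inner_comm _ _).trans h3
    · exact absurd rfl hij
  norm_N := H.hyp.norm_N
  normal i p hp := by
    fin_cases i
    · exact H.hyp.N_x p hp
    · exact H.hyp.N_y p hp
    · exact H.hyp.N_z p hp
  weingarten i p hp := by
    fin_cases i
    · exact H.hyp.weingarten_x p hp
    · exact H.hyp.weingarten_y p hp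
    · exact H.hyp.weingarten_z p hp

theorem smooth_u : ContDiffOn ℝ ∞ (invFactor P) U := by
  have h1 : ContDiffOn ℝ ∞ (fun p => P p ^ 2) U := H.principalCoords.smooth_g 2
  have h2 : ContDiffOn ℝ ∞ P U := by
    -- P is the positive root of the smooth metric coefficient in the z-direction.
    refine (h1.sqrt fun p hp => (pow_pos (H.hyp.P_pos p hp) 2).ne').congr fun p hp => ?_
    rw [Real.sqrt_sq (H.hyp.P_pos p hp).le]
  exact h2.inv fun p hp => (H.hyp.P_pos p hp).ne'

theorem smooth_k : ContDiffOn ℝ ∞ κ₃ U := H.principalCoords.smooth_κ 2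

include hp

theorem u_pos : 0 < invFactor P p := inv_pos.2 (H.hyp.P_pos p hp)

theorem hasPartial_u (v : R3) : HasPartial v (invFactor P) (pd v (invFactor P) p) p :=
  .of_contDiffOn H.isOpen H.smooth_u hp v

theorem hasPartial_k (v : R3) : HasPartial v κ₃ (pd v κ₃ p) p :=
  .of_contDiffOn H.isOpen H.smooth_k hp v

theorem hasPartial_pd_u (v w : R3) :
    HasPartial v (pd w (invFactor P)) (pd v (pd w (invFactor P)) p) p :=
  .of_contDiffOn H.isOpen (contDiffOn_pd H.isOpen H.smooth_u w) hp v

theorem hasDerivAt_mu : HasDerivAt mu (deriv mu p.2.2) p.2.2 :=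
  hasDerivAt_of_contDiffOn H.isOpen_J H.smooth_mu (mem_zProj hp)

theorem hasDerivAt_deriv_mu : HasDerivAt (deriv mu) (deriv (deriv mu) p.2.2) p.2.2 :=
  hasDerivAt_of_contDiffOn H.isOpen_J (contDiffOn_deriv H.isOpen_J H.smooth_mu) (mem_zProj hp)

theorem hasPartial_lam (v : R3) :
    HasPartial v (fun r : R3 => lam (r.1, r.2.1)) (pd (v.1, v.2.1) lam (p.1, p.2.1)) p :=
  .comp_xy (H.smooth_lam.contDiffAt (H.isOpen_V.mem_nhds (mem_xyProj hp)) |>.differentiableAt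
    (by simp)) v

theorem hasPartial_pd_lam (v : R3) (w : ℝ × ℝ) :
    HasPartial v (fun r : R3 => pd w lam (r.1, r.2.1))
      (pd (v.1, v.2.1) (pd w lam) (p.1, p.2.1)) p :=
  .comp_xy ((contDiffOn_pd H.isOpen_V H.smooth_lam w).contDiffAt
    (H.isOpen_V.mem_nhds (mem_xyProj hp)) |>.differentiableAt (by simp)) v

theorem hasPartial_mu (v : R3) :
    HasPartial v (fun r : R3 => mu r.2.2) (v.2.2 * deriv mu p.2.2) p :=
  .comp_z (H.hasDerivAt_mu hp) v

theorem hasPartial_deriv_mu (v : R3) :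
    HasPartial v (fun r : R3 => deriv mu r.2.2) (v.2.2 * deriv (deriv mu) p.2.2) p :=
  .comp_z (H.hasDerivAt_deriv_mu hp) v

theorem hasPartial_angle (v : R3) : HasPartial v (angle lam mu)
    (pd (v.1, v.2.1) lam (p.1, p.2.1) + v.2.2 * deriv mu p.2.2) p :=
  (H.hasPartial_lam hp v).add (H.hasPartial_mu hp v)

theorem hasPartial_angle_x :
    HasPartial (1, 0, 0) (angle lam mu) (pX lam (p.1, p.2.1)) p :=
  (H.hasPartial_angle hp _).eq (by simp [pd, pX])

theorem hasPartial_angle_y :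
    HasPartial (0, 1, 0) (angle lam mu) (pY lam (p.1, p.2.1)) p :=
  (H.hasPartial_angle hp _).eq (by simp [pd, pY])

theorem hasPartial_angle_z :
    HasPartial (0, 0, 1) (angle lam mu) (deriv mu p.2.2) p :=
  (H.hasPartial_angle hp _).eq (by
    have : (((0, 0, 1) : R3).1, ((0, 0, 1) : R3).2.1) = (0 : ℝ × ℝ) := rfl
    rw [this]; simp [pd])

theorem hasPartial_pX_lam : HasPartial (1, 0, 0) (fun r : R3 => pX lam (r.1, r.2.1))
    (pX (pX lam) (p.1, p.2.1)) p := H.hasPartial_pd_lam hp (1, 0, 0) (1, 0)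

theorem hasPartial_pY_lam : HasPartial (0, 1, 0) (fun r : R3 => pY lam (r.1, r.2.1))
    (pY (pY lam) (p.1, p.2.1)) p := H.hasPartial_pd_lam hp (0, 1, 0) (0, 1)

theorem hasPartial_deriv_mu_z : HasPartial (0, 0, 1) (fun r : R3 => deriv mu r.2.2)
    (deriv (deriv mu) p.2.2) p := (H.hasPartial_deriv_mu hp _).eq (by simp)

end Setting

/-- Derivatives of a metric coefficient `g` with `g u² = h`. -/
theorem HasPartial.metric {U : Set R3} (hU : IsOpen U) {g u h : R3 → ℝ}
    (he : ∀ q ∈ U, g q * u q ^ 2 = h q) {v p : R3} (hp : p ∈ U) {g' u' h' : ℝ}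
    (hg : HasPartial v g g' p) (hu : HasPartial v u u' p) (hh : HasPartial v h h' p) :
    g' * u p ^ 2 + 2 * g p * u p * u' = h' :=
  ((hg.mul hu.sq).eq_of_eqOn hh hU hp he) ▸ by ring

/-- Implicit differentiation of g u² = h. The metric coefficients are cos² φ, sin² φ and 1 divided
by u², and in this form no quotient has to be differentiated twice. -/
theorem metric_snd {U : Set R3} (hU : IsOpen U) {g u h : R3 → ℝ} (hg : ContDiffOn ℝ ∞ g U)
    (hu : ContDiffOn ℝ ∞ u U) (he : ∀ q ∈ U, g q * u q ^ 2 = h q) {v p : R3} (hp : p ∈ U)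
    {h' : R3 → ℝ} {h'' : ℝ} (hh : ∀ q ∈ U, HasPartial v h (h' q) q)
    (hh' : HasPartial v h' h'' p) :
    pd v (pd v g) p * u p ^ 2 + 4 * pd v g p * u p * pd v u p +
      2 * g p * (pd v u p ^ 2 + u p * pd v (pd v u) p) = h'' := by
  have a : ∀ q ∈ U, pd v g q * u q ^ 2 + 2 * (g q * u q * pd v u q) = h' q := fun q hq => by
    have := HasPartial.metric hU he hq (.of_contDiffOn hU hg hq v) (.of_contDiffOn hU hu hq v)
      (hh q hq)
    linarith
  have h1 : HasPartial v g (pd v g p) p := .of_contDiffOn hU hg hp v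
  have h2 : HasPartial v u (pd v u p) p := .of_contDiffOn hU hu hp v
  have h3 : HasPartial v (pd v g) (pd v (pd v g) p) p :=
    .of_contDiffOn hU (contDiffOn_pd hU hg v) hp v
  have h4 : HasPartial v (pd v u) (pd v (pd v u) p) p :=
    .of_contDiffOn hU (contDiffOn_pd hU hu v) hp v
  have := ((h3.mul h2.sq).add ((HasPartial.const 2).mul ((h1.mul h2).mul h4))).eq_of_eqOn
    hh' hU hp a
  linarith

namespace Setting

variable {U : Set R3} {lam : ℝ × ℝ → ℝ} {mu : ℝ → ℝ} {c₁ : ℝ} {P κ₁ κ₂ κ₃ : R3 → ℝ}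
  {f N : R3 → E4} (H : Setting U lam mu c₁ P κ₁ κ₂ κ₃ f N) {p : R3} (hp : p ∈ U)

include H hp

theorem sin_ne : Real.sin (angle lam mu p) ≠ 0 := left_ne_zero_of_mul (H.hyp.sin_cos_ne p hp)

theorem cos_ne : Real.cos (angle lam mu p) ≠ 0 := right_ne_zero_of_mul (H.hyp.sin_cos_ne p hp)

theorem κ₁_mul_cos : κ₁ p * Real.cos (angle lam mu p) =
    invFactor P p * Real.sin (angle lam mu p) + κ₃ p * Real.cos (angle lam mu p) := by
  have := H.cos_ne hp
  rw [H.hyp.κ₁_eq p hp, Real.tan_eq_sin_div_cos, invFactor]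
  field_simp

theorem κ₂_mul_sin : κ₂ p * Real.sin (angle lam mu p) =
    -(invFactor P p * Real.cos (angle lam mu p)) + κ₃ p * Real.sin (angle lam mu p) := by
  have := H.sin_ne hp
  rw [H.hyp.κ₂_eq p hp, Real.cot_eq_cos_div_sin, invFactor]
  field_simp

omit hp in
theorem smooth_κ₁ : ContDiffOn ℝ ∞ κ₁ U := H.principalCoords.smooth_κ 0

omit hp in
theorem metric_zero : ∀ q ∈ U, (P q ^ 2 * Real.cos (angle lam mu q) ^ 2) * invFactor P q ^ 2 =
    Real.cos (angle lam mu q) ^ 2 := fun q hq => by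
  have := (H.hyp.P_pos q hq).ne'
  rw [invFactor]; field_simp

omit hp in
theorem metric_one : ∀ q ∈ U, (P q ^ 2 * Real.sin (angle lam mu q) ^ 2) * invFactor P q ^ 2 =
    Real.sin (angle lam mu q) ^ 2 := fun q hq => by
  have := (H.hyp.P_pos q hq).ne'
  rw [invFactor]; field_simp

omit hp in
theorem metric_two : ∀ q ∈ U, P q ^ 2 * invFactor P q ^ 2 = 1 := fun q hq => by
  have := (H.hyp.P_pos q hq).ne'
  rw [invFactor]; field_simp

theorem metric_zero_fst {v : R3} {φ' : ℝ} (hφ : HasPartial v (angle lam mu) φ' p) :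
    pd v (fun p => P p ^ 2 * Real.cos (angle lam mu p) ^ 2) p = 
    (-2 * Real.cos (angle lam mu p) * Real.sin (angle lam mu p) * φ') / invFactor P p ^ 2 -
      2 * Real.cos (angle lam mu p) ^ 2 * pd v (invFactor P) p / invFactor P p ^ 3 := by
  have h1 := HasPartial.metric H.isOpen H.metric_zero hp
    (H.principalCoords.hasPartial_g hp 0 v) (H.hasPartial_u hp v) hφ.cos.sq
  have h2 := H.metric_zero p hp
  have h3 := (H.u_pos hp).ne'
  simp only [Matrix.cons_val_zero] at h1
  field_simp
  linear_combination invFactor P p * h1 - 2 * pd v (invFactor P) p * h2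

theorem metric_one_fst {v : R3} {φ' : ℝ} (hφ : HasPartial v (angle lam mu) φ' p) :
    pd v (fun p => P p ^ 2 * Real.sin (angle lam mu p) ^ 2) p = 
    (2 * Real.cos (angle lam mu p) * Real.sin (angle lam mu p) * φ') / invFactor P p ^ 2 -
      2 * Real.sin (angle lam mu p) ^ 2 * pd v (invFactor P) p / invFactor P p ^ 3 := by
  have h1 := HasPartial.metric H.isOpen H.metric_one hp
    (H.principalCoords.hasPartial_g hp 1 v) (H.hasPartial_u hp v) hφ.sin.sq
  have h2 := H.metric_one p hp
  have h3 := (H.u_pos hp).ne'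
  simp only [Matrix.cons_val] at h1
  field_simp
  linear_combination invFactor P p * h1 - 2 * pd v (invFactor P) p * h2

theorem metric_two_fst (v : R3) :
    pd v (fun p => P p ^ 2) p = -2 * pd v (invFactor P) p / invFactor P p ^ 3 := by
  have h1 := HasPartial.metric H.isOpen H.metric_two hp
    (H.principalCoords.hasPartial_g hp 2 v) (H.hasPartial_u hp v) (.const 1)
  have h2 := H.metric_two p hp
  have h3 := (H.u_pos hp).ne'
  simp only [Matrix.cons_val] at h1
  field_simp
  linear_combination invFactor P p * h1 - 2 * pd v (invFactor P) p * h2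

theorem metric_zero_snd {v : R3} {φ' : R3 → ℝ} {φ'' : ℝ}
    (hφ : ∀ q ∈ U, HasPartial v (angle lam mu) (φ' q) q) (hφ' : HasPartial v φ' φ'' p) :
    pd v (pd v (fun p => P p ^ 2 * Real.cos (angle lam mu p) ^ 2)) p =
    (-2 * (Real.cos (angle lam mu p) ^ 2 - Real.sin (angle lam mu p) ^ 2) * φ' p ^ 2 -
      2 * Real.cos (angle lam mu p) * Real.sin (angle lam mu p) * φ'') / invFactor P p ^ 2 +
    8 * Real.cos (angle lam mu p) * Real.sin (angle lam mu p) * φ' p * pd v (invFactor P) p /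
      invFactor P p ^ 3 + 6 * Real.cos (angle lam mu p) ^ 2 * pd v (invFactor P) p ^ 2 /
      invFactor P p ^ 4 - 2 * Real.cos (angle lam mu p) ^ 2 * pd v (pd v (invFactor P)) p /
      invFactor P p ^ 3 := by
  have h1 := metric_snd H.isOpen (H.principalCoords.smooth_g 0) H.smooth_u H.metric_zero hp
    (fun q hq => (hφ q hq).cos.sq)
    (((HasPartial.const 2).mul (hφ p hp).cos).mul ((hφ p hp).sin.neg.mul hφ'))
  have h0 := H.metric_zero_fst hp (hφ p hp)
  have h2 := H.metric_zero p hp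
  have h3 := (H.u_pos hp).ne'
  simp only [Matrix.cons_val_zero] at h1
  rw [h0] at h1
  have h4 : P p ^ 2 * Real.cos (angle lam mu p) ^ 2 =
      Real.cos (angle lam mu p) ^ 2 / invFactor P p ^ 2 := by field_simp; exact h2
  rw [h4] at h1
  field_simp at h1 ⊢
  linear_combination h1

theorem metric_one_snd {v : R3} {φ' : R3 → ℝ} {φ'' : ℝ}
    (hφ : ∀ q ∈ U, HasPartial v (angle lam mu) (φ' q) q) (hφ' : HasPartial v φ' φ'' p) :
    pd v (pd v (fun p => P p ^ 2 * Real.sin (angle lam mu p) ^ 2)) p =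
    (2 * (Real.cos (angle lam mu p) ^ 2 - Real.sin (angle lam mu p) ^ 2) * φ' p ^ 2 +
      2 * Real.cos (angle lam mu p) * Real.sin (angle lam mu p) * φ'') / invFactor P p ^ 2 -
    8 * Real.cos (angle lam mu p) * Real.sin (angle lam mu p) * φ' p * pd v (invFactor P) p /
      invFactor P p ^ 3 + 6 * Real.sin (angle lam mu p) ^ 2 * pd v (invFactor P) p ^ 2 /
      invFactor P p ^ 4 - 2 * Real.sin (angle lam mu p) ^ 2 * pd v (pd v (invFactor P)) p /
      invFactor P p ^ 3 := by
  have h1 := metric_snd H.isOpen (H.principalCoords.smooth_g 1) H.smooth_u H.metric_one hp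
    (fun q hq => (hφ q hq).sin.sq)
    (((HasPartial.const 2).mul (hφ p hp).sin).mul ((hφ p hp).cos.mul hφ'))
  have h0 := H.metric_one_fst hp (hφ p hp)
  have h2 := H.metric_one p hp
  have h3 := (H.u_pos hp).ne'
  simp only [Matrix.cons_val] at h1
  rw [h0] at h1
  have h4 : P p ^ 2 * Real.sin (angle lam mu p) ^ 2 =
      Real.sin (angle lam mu p) ^ 2 / invFactor P p ^ 2 := by field_simp; exact h2
  rw [h4] at h1
  field_simp at h1 ⊢
  linear_combination h1

theorem metric_two_snd (v : R3) :
    pd v (pd v (fun p => P p ^ 2)) p =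
    6 * pd v (invFactor P) p ^ 2 / invFactor P p ^ 4 -
      2 * pd v (pd v (invFactor P)) p / invFactor P p ^ 3 := by
  have h1 := metric_snd H.isOpen (H.principalCoords.smooth_g 2) H.smooth_u H.metric_two hp
    (v := v) (fun q _ => .const (1 : ℝ)) (.const (0 : ℝ))
  have h0 := H.metric_two_fst hp v
  have h2 := H.metric_two p hp
  have h3 := (H.u_pos hp).ne'
  simp only [Matrix.cons_val] at h1
  rw [h0] at h1
  have h4 : P p ^ 2 = 1 / invFactor P p ^ 2 := by field_simp; exact h2
  rw [h4] at h1
  field_simp at h1 ⊢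
  linear_combination h1

/-- Since κ₁ - κ₃ = u tan φ, the Codazzi equation for κ₃ says that (u_x, k_x) is a multiple m of
(cos φ, -sin φ). In the y-direction, (u_y, k_y) is likewise a multiple l of (sin φ, cos φ). -/
theorem codazzi_x : dX κ₃ p * Real.cos (angle lam mu p) =
    -(Real.sin (angle lam mu p) * dX (invFactor P) p) := by
  have h1 : dX κ₃ p * P p ^ 2 = (κ₁ p - κ₃ p) * (dX (fun p => P p ^ 2) p / 2) :=
    H.principalCoords.codazzi hp (i := 2) (j := 0) (by decide)
  have h2 : dX (fun p => P p ^ 2) p = _ := H.metric_two_fst hp (1, 0, 0)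
  have h3 := H.metric_two p hp
  have h4 := (H.u_pos hp).ne'
  have h5 : P p ^ 2 = 1 / invFactor P p ^ 2 := by field_simp; exact h3
  rw [h2, h5] at h1
  change _ = (κ₁ p - κ₃ p) * (-2 * dX (invFactor P) p / invFactor P p ^ 3 / 2) at h1
  have h6 := H.κ₁_mul_cos hp
  have h7 : dX κ₃ p * invFactor P p = -((κ₁ p - κ₃ p) * dX (invFactor P) p) := by
    field_simp at h1
    linear_combination h1
  refine mul_right_cancel₀ h4 ?_
  linear_combination Real.cos (angle lam mu p) * h7 - dX (invFactor P) p * h6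

theorem codazzi_y : dY κ₃ p * Real.sin (angle lam mu p) =
    Real.cos (angle lam mu p) * dY (invFactor P) p := by
  have h1 : dY κ₃ p * P p ^ 2 = (κ₂ p - κ₃ p) * (dY (fun p => P p ^ 2) p / 2) :=
    H.principalCoords.codazzi hp (i := 2) (j := 1) (by decide)
  have h2 : dY (fun p => P p ^ 2) p = _ := H.metric_two_fst hp (0, 1, 0)
  have h3 := H.metric_two p hp
  have h4 := (H.u_pos hp).ne'
  have h5 : P p ^ 2 = 1 / invFactor P p ^ 2 := by field_simp; exact h3
  rw [h2, h5] at h1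
  change _ = (κ₂ p - κ₃ p) * (-2 * dY (invFactor P) p / invFactor P p ^ 3 / 2) at h1
  have h6 := H.κ₂_mul_sin hp
  have h7 : dY κ₃ p * invFactor P p = -((κ₂ p - κ₃ p) * dY (invFactor P) p) := by
    field_simp at h1
    linear_combination h1
  refine mul_right_cancel₀ h4 ?_
  linear_combination Real.sin (angle lam mu p) * h7 - dY (invFactor P) p * h6

/-- This comes from the equation for κ₁ along z, with κ₁ = u tan φ + k: the terms with u_z cancel,
and sin² + cos² = 1 leaves k_z = -μ'u. -/
theorem codazzi_z : dZ κ₃ p = -(invFactor P p * deriv mu p.2.2) := by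
  have h1 : dZ κ₁ p * (P p ^ 2 * Real.cos (angle lam mu p) ^ 2) = (κ₃ p - κ₁ p) *
      (dZ (fun p => P p ^ 2 * Real.cos (angle lam mu p) ^ 2) p / 2) :=
    H.principalCoords.codazzi hp (i := 0) (j := 2) (by decide)
  have h2 : dZ (fun p => P p ^ 2 * Real.cos (angle lam mu p) ^ 2) p = _ :=
    H.metric_zero_fst hp (H.hasPartial_angle_z hp)
  have h3 := H.metric_zero p hp
  have h4 := (H.u_pos hp).ne'
  have h5 : P p ^ 2 * Real.cos (angle lam mu p) ^ 2 =
      Real.cos (angle lam mu p) ^ 2 / invFactor P p ^ 2 := by field_simp; exact h3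
  rw [h2, h5] at h1
  change _ = (κ₃ p - κ₁ p) * ((_ - 2 * Real.cos (angle lam mu p) ^ 2 * dZ (invFactor P) p / _) / 2)
    at h1
  have hc := H.cos_ne hp
  have h6 := H.κ₁_mul_cos hp
  have hφ := H.hasPartial_angle_z hp
  have h7 := ((H.principalCoords.hasPartial_κ hp 0 (0, 0, 1)).mul hφ.cos).eq_of_eqOn
    (((H.hasPartial_u hp (0, 0, 1)).mul hφ.sin).add ((H.hasPartial_k hp (0, 0, 1)).mul hφ.cos))
    H.isOpen hp (fun q hq => H.κ₁_mul_cos hq)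
  change dZ κ₁ p * _ + κ₁ p * _ = dZ (invFactor P) p * _ + _ + (dZ κ₃ p * _ + _) at h7
  set S := Real.sin (angle lam mu p)
  set C := Real.cos (angle lam mu p)
  set u := invFactor P p
  field_simp at h1
  have h9 : κ₁ p = u * S / C + κ₃ p := by field_simp; linear_combination h6
  have h10 : dZ κ₁ p = (dZ (invFactor P) p * S + u * (C * deriv mu p.2.2) +
    (dZ κ₃ p * C + κ₃ p * (-S * deriv mu p.2.2)) + κ₁ p * S * deriv mu p.2.2) / C := by
    field_simp; linear_combination h7
  rw [h10, h9] at h1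
  field_simp at h1
  refine mul_left_cancel₀ (mul_ne_zero h4 (pow_ne_zero 2 hc)) ?_
  linear_combination h1

end Setting

/-! ### The three Gauss equations of the Guichard metric -/

namespace Setting

variable {U : Set R3} {lam : ℝ × ℝ → ℝ} {mu : ℝ → ℝ} {c₁ : ℝ} {P κ₁ κ₂ κ₃ : R3 → ℝ}
  {f N : R3 → E4} (H : Setting U lam mu c₁ P κ₁ κ₂ κ₃ f N) {p : R3} (hp : p ∈ U)

include H hp

/-- The Gauss equation for the `(x, y)`-plane. -/
theorem gauss_xy :
    let S := Real.sin (angle lam mu p)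
    let C := Real.cos (angle lam mu p)
    let u := invFactor P
    let a₁ := pX lam (p.1, p.2.1)
    let a₂ := pY lam (p.1, p.2.1)
    let a₃ := deriv mu p.2.2
    pX (pX lam) (p.1, p.2.1) - pY (pY lam) (p.1, p.2.1) - dY (dY u) p * C / (S * u p) +
      dY u p * a₂ / (S ^ 2 * u p) + dY u p ^ 2 * C / (S * u p ^ 2) - dX (dX u) p * S / (C * u p) -
      dX u p * a₁ / (C ^ 2 * u p) + dX u p ^ 2 * S / (C * u p ^ 2) =
    S * C * (1 + a₃ ^ 2 - dZ u p ^ 2 / u p ^ 2 - κ₃ p ^ 2 / u p ^ 2) +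
      (C ^ 2 - S ^ 2) * (a₃ * dZ u p + κ₃ p) / u p := by
  intro S C u a₁ a₂ a₃
  have G := H.principalCoords.gauss hp (i := 0) (j := 1) (k := 2) (by decide) (by decide)
    (by decide)
  simp only [coordDir, Matrix.cons_val] at G
  rw [H.metric_zero_fst hp (H.hasPartial_angle_x hp), H.metric_zero_fst hp (H.hasPartial_angle_y hp),
    H.metric_zero_fst hp (H.hasPartial_angle_z hp),
    H.metric_one_fst hp (H.hasPartial_angle_x hp), H.metric_one_fst hp (H.hasPartial_angle_y hp),
    H.metric_one_fst hp (H.hasPartial_angle_z hp),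
    H.metric_zero_snd hp (fun q hq => H.hasPartial_angle_y hq) (H.hasPartial_pY_lam hp),
    H.metric_one_snd hp (fun q hq => H.hasPartial_angle_x hq) (H.hasPartial_pX_lam hp)] at G
  have hP : P p = 1 / u p := by simp [u, invFactor]
  have hS : S ≠ 0 := H.sin_ne hp
  have hC : C ≠ 0 := H.cos_ne hp
  have hu : u p ≠ 0 := (H.u_pos hp).ne'
  have h1 : κ₁ p = u p * S / C + κ₃ p := by
    field_simp; linear_combination H.κ₁_mul_cos hp
  have h2 : κ₂ p = -(u p * C / S) + κ₃ p := by
    field_simp; linear_combination H.κ₂_mul_sin hp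
  have h3 : S ^ 2 + C ^ 2 = 1 := Real.sin_sq_add_cos_sq _
  rw [hP, h1, h2] at G
  change _ = -((_ - 2 * _ * dY (dY u) p / _ + (_ - 2 * _ * dX (dX u) p / _)) / 2) at G
  simp only [show pd (1, 0, 0) (invFactor P) p = dX u p from rfl,
    show pd (0, 1, 0) (invFactor P) p = dY u p from rfl,
    show pd (0, 0, 1) (invFactor P) p = dZ u p from rfl] at G
  linear_combination (norm := skip) (u p ^ 2 / (S * C)) * G -
    (dY u p * a₂ / (S ^ 2 * u p) - dX u p * a₁ / (C ^ 2 * u p)) * h3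
  simp only [S, C, u, a₁, a₂, a₃] at hS hC hu ⊢
  field_simp
  ring

/-- The Gauss equation for the `(x, z)`-plane. -/
theorem gauss_xz :
    let S := Real.sin (angle lam mu p)
    let C := Real.cos (angle lam mu p)
    let u := invFactor P
    let a₁ := pX lam (p.1, p.2.1)
    let a₂ := pY lam (p.1, p.2.1)
    let a₃ := deriv mu p.2.2
    let b₃ := deriv (deriv mu) p.2.2
    κ₃ p ^ 2 - u p ^ 2 * a₃ ^ 2 - u p ^ 2 * (S / C) * b₃ + S / C * a₃ * u p * dZ u p - u p * dZ (dZ u) p +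
      dZ u p ^ 2 - u p * dX (dX u) p / C ^ 2 + dX u p ^ 2 / C ^ 2 -
      u p * dX u p * (S / C) * a₁ / C ^ 2 + a₂ * u p * dY u p / (S * C) + dY u p ^ 2 / S ^ 2 +
      κ₃ p * u p * (S / C) = 0 := by
  intro S C u a₁ a₂ a₃ b₃
  have G := H.principalCoords.gauss hp (i := 0) (j := 2) (k := 1) (by decide) (by decide)
    (by decide)
  simp only [coordDir, Matrix.cons_val] at G
  rw [H.metric_zero_fst hp (H.hasPartial_angle_x hp), H.metric_zero_fst hp (H.hasPartial_angle_y hp),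
    H.metric_zero_fst hp (H.hasPartial_angle_z hp), H.metric_two_fst hp, H.metric_two_fst hp,
    H.metric_two_fst hp,
    H.metric_zero_snd hp (fun q hq => H.hasPartial_angle_z hq) (H.hasPartial_deriv_mu_z hp),
    H.metric_two_snd hp] at G
  have hP : P p = 1 / u p := by simp [u, invFactor]
  have hS : S ≠ 0 := H.sin_ne hp
  have hC : C ≠ 0 := H.cos_ne hp
  have hu : u p ≠ 0 := (H.u_pos hp).ne'
  have h1 : κ₁ p = u p * S / C + κ₃ p := by
    field_simp; linear_combination H.κ₁_mul_cos hp
  rw [hP, h1] at G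
  change _ = -((_ - 2 * _ * dZ (dZ u) p / _ + (_ - 2 * dX (dX u) p / _)) / 2) at G
  simp only [show pd (1, 0, 0) (invFactor P) p = dX u p from rfl,
    show pd (0, 1, 0) (invFactor P) p = dY u p from rfl,
    show pd (0, 0, 1) (invFactor P) p = dZ u p from rfl] at G
  linear_combination (norm := skip) (u p ^ 4 / C ^ 2) * G
  simp only [S, C, u, a₁, a₂, a₃, b₃] at hS hC hu ⊢
  field_simp
  ring

/-- The Gauss equation for the `(y, z)`-plane. -/
theorem gauss_yz :
    let S := Real.sin (angle lam mu p)
    let C := Real.cos (angle lam mu p)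
    let u := invFactor P
    let a₁ := pX lam (p.1, p.2.1)
    let a₂ := pY lam (p.1, p.2.1)
    let a₃ := deriv mu p.2.2
    let b₃ := deriv (deriv mu) p.2.2
    κ₃ p ^ 2 - u p ^ 2 * a₃ ^ 2 + u p ^ 2 * (C / S) * b₃ - C / S * a₃ * u p * dZ u p - u p * dZ (dZ u) p +
      dZ u p ^ 2 - u p * dY (dY u) p / S ^ 2 + dY u p ^ 2 / S ^ 2 +
      u p * dY u p * (C / S) * a₂ / S ^ 2 - a₁ * u p * dX u p / (S * C) + dX u p ^ 2 / C ^ 2 -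
      κ₃ p * u p * (C / S) = 0 := by
  intro S C u a₁ a₂ a₃ b₃
  have G := H.principalCoords.gauss hp (i := 1) (j := 2) (k := 0) (by decide) (by decide)
    (by decide)
  simp only [coordDir, Matrix.cons_val] at G
  rw [H.metric_one_fst hp (H.hasPartial_angle_x hp), H.metric_one_fst hp (H.hasPartial_angle_y hp),
    H.metric_one_fst hp (H.hasPartial_angle_z hp), H.metric_two_fst hp, H.metric_two_fst hp,
    H.metric_two_fst hp,
    H.metric_one_snd hp (fun q hq => H.hasPartial_angle_z hq) (H.hasPartial_deriv_mu_z hp),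
    H.metric_two_snd hp] at G
  have hP : P p = 1 / u p := by simp [u, invFactor]
  have hS : S ≠ 0 := H.sin_ne hp
  have hC : C ≠ 0 := H.cos_ne hp
  have hu : u p ≠ 0 := (H.u_pos hp).ne'
  have h2 : κ₂ p = -(u p * C / S) + κ₃ p := by
    field_simp; linear_combination H.κ₂_mul_sin hp
  rw [hP, h2] at G
  change _ = -((_ - 2 * _ * dZ (dZ u) p / _ + (_ - 2 * dY (dY u) p / _)) / 2) at G
  simp only [show pd (1, 0, 0) (invFactor P) p = dX u p from rfl,
    show pd (0, 1, 0) (invFactor P) p = dY u p from rfl,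
    show pd (0, 0, 1) (invFactor P) p = dZ u p from rfl] at G
  linear_combination (norm := skip) (u p ^ 4 / S ^ 2) * G
  simp only [S, C, u, a₁, a₂, a₃, b₃] at hS hC hu ⊢
  field_simp
  ring

end Setting

/-! ### Functions with vanishing partial derivatives, and the second order equation for μ -/

section Gluing

variable {U : Set R3} {F : Type*} [NormedAddCommGroup F] [NormedSpace ℝ F]

theorem fderiv_eq_zero_of_partials {g : R3 → F} {p : R3} (hx : dX g p = 0) (hy : dY g p = 0)
    (hz : dZ g p = 0) : fderiv ℝ g p = 0 := by
  ext
  · exact hx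
  · exact hy
  · exact hz

theorem eq_of_partials_eq_zero (hU : IsOpen U) (hc : IsPreconnected U) {g : R3 → F}
    (hd : ∀ p ∈ U, DifferentiableAt ℝ g p) (hx : ∀ p ∈ U, dX g p = 0) (hy : ∀ p ∈ U, dY g p = 0)
    (hz : ∀ p ∈ U, dZ g p = 0) {p q : R3} (hp : p ∈ U) (hq : q ∈ U) : g p = g q :=
  hU.is_const_of_fderiv_eq_zero hc (fun r hr => (hd r hr).differentiableWithinAt)
    (fun r hr => fderiv_eq_zero_of_partials (hx r hr) (hy r hr) (hz r hr)) hp hq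

theorem eq_of_pX_pY_eq_zero {V : Set (ℝ × ℝ)} (hV : IsOpen V) (hc : IsPreconnected V)
    {g : ℝ × ℝ → ℝ} (hd : ∀ q ∈ V, DifferentiableAt ℝ g q) (hx : ∀ q ∈ V, pX g q = 0)
    (hy : ∀ q ∈ V, pY g q = 0) {p q : ℝ × ℝ} (hp : p ∈ V) (hq : q ∈ V) : g p = g q :=
  hV.is_const_of_fderiv_eq_zero hc (fun r hr => (hd r hr).differentiableWithinAt)
    (fun r hr => by
      ext
      · simpa [pX] using hx r hr
      · simpa [pY] using hy r hr) hp hq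

/-- A function with vanishing `z`-derivative is a function of `(x, y)` if the lines parallel to the
`z`-axis meet the domain in intervals. -/
theorem exists_eq_comp_xy (hU : IsOpen U)
    (hfib : ∀ x y : ℝ, {z : ℝ | ((x, y, z) : R3) ∈ U}.OrdConnected) {g : R3 → F}
    (hg : ContDiffOn ℝ ∞ g U) (hz : ∀ p ∈ U, dZ g p = 0) :
    ∃ h : ℝ × ℝ → F, ContDiffOn ℝ ∞ h (xyProj U) ∧ ∀ p ∈ U, g p = h (p.1, p.2.1) := by
  classical
  have hsec : ∀ q ∈ xyProj U, ∃ z : ℝ, ((q.1, q.2, z) : R3) ∈ U := by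
    rintro _ ⟨p, hp, rfl⟩; exact ⟨p.2.2, hp⟩
  choose! s hs using hsec
  have key : ∀ p ∈ U, g p = g (p.1, p.2.1, s (p.1, p.2.1)) := by
    rintro ⟨x, y, z⟩ hp
    have hopen : IsOpen {z : ℝ | ((x, y, z) : R3) ∈ U} :=
      hU.preimage (by fun_prop : Continuous fun z : ℝ => ((x, y, z) : R3))
    have hd : ∀ t ∈ {z : ℝ | ((x, y, z) : R3) ∈ U}, HasDerivAt (fun t => g (x, y, t)) 0 t := by
      intro t ht
      have h1 : HasFDerivAt g (fderiv ℝ g (x, y, t)) (x, y, t) :=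
        ((hg.contDiffAt (hU.mem_nhds ht)).differentiableAt (by simp)).hasFDerivAt
      have h2 : HasDerivAt (fun t : ℝ => ((x, y, t) : R3)) (0, 0, 1) t :=
        (hasDerivAt_const t x).prodMk ((hasDerivAt_const t y).prodMk (hasDerivAt_id t))
      have := h1.comp_hasDerivAt t h2
      rwa [show fderiv ℝ g (x, y, t) (0, 0, 1) = 0 from hz _ ht] at this
    exact hopen.is_const_of_deriv_eq_zero (hfib x y).isPreconnected
      (fun t ht => (hd t ht).differentiableAt.differentiableWithinAt)
      (fun t ht => (hd t ht).deriv) hp (hs (x, y) (mem_xyProj hp))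
  -- The choice s need not be continuous. Near a given q, however, the fixed height s q stays in U,
  -- and there the function equals the slice r ↦ g (r, s q), which is smooth.
  refine ⟨fun q => g (q.1, q.2, s q), ?_, key⟩
  intro q hq
  have hmem := hs q hq
  have hcont : Continuous fun r : ℝ × ℝ => ((r.1, r.2, s q) : R3) := by fun_prop
  have h1 : ContDiffAt ℝ ∞ (fun r : ℝ × ℝ => g (r.1, r.2, s q)) q := by
    have h2 : ContDiffAt ℝ ∞ (fun r : ℝ × ℝ => ((r.1, r.2, s q) : R3)) q := by fun_prop
    exact ContDiffAt.comp (f := fun r : ℝ × ℝ => ((r.1, r.2, s q) : R3)) q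
      (hg.contDiffAt (hU.mem_nhds hmem)) h2
  refine (h1.congr_of_eventuallyEq ?_).contDiffWithinAt
  have : ∀ᶠ r in nhds q, ((r.1, r.2, s q) : R3) ∈ U := hcont.continuousAt (hU.mem_nhds hmem)
  filter_upwards [this] with r hr
  exact (key _ hr).symm

/-- Antiderivatives on open intervals. -/
theorem exists_hasDerivAt {J : Set ℝ} (hJ : IsOpen J) (hJc : IsPreconnected J) {v : ℝ → ℝ}
    (hv : ContinuousOn v J) : ∃ q : ℝ → ℝ, ∀ z ∈ J, HasDerivAt q (v z) z := by
  rcases J.eq_empty_or_nonempty with rfl | ⟨a, ha⟩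
  · exact ⟨0, fun z hz => hz.elim⟩
  refine ⟨fun z => ∫ t in a..z, v t, fun z hz => ?_⟩
  have hsub : Set.uIcc a z ⊆ J := hJc.ordConnected.uIcc_subset ha hz
  exact intervalIntegral.integral_hasDerivAt_right (hv.mono hsub).intervalIntegrable
    (hv.stronglyMeasurableAtFilter hJ z hz) (hv.continuousAt (hJ.mem_nhds hz))

/-- The second order equation for `μ`. -/
theorem deriv_deriv_mu_eq {J : Set ℝ} (hJ : IsOpen J) (hJc : IsPreconnected J) {mu : ℝ → ℝ}
    {c₁ c₂ : ℝ} (hmu : ContDiffOn ℝ ∞ mu J) (h0 : ∃ z ∈ J, deriv mu z ≠ 0)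
    (he : ∀ z ∈ J, deriv mu z ^ 2 = c₂ ^ 2 - c₁ ^ 2 * Real.sin (mu z) ^ 2) {z : ℝ} (hz : z ∈ J) :
    deriv (deriv mu) z = -(c₁ ^ 2 * (Real.sin (mu z) * Real.cos (mu z))) := by
  have hmu' := contDiffOn_deriv hJ hmu
  have hmu'' := contDiffOn_deriv hJ hmu'
  -- D is the defect of the second order equation. Differentiating the first order equation only
  -- gives μ'D = 0, and μ' may have zeros.
  set D : ℝ → ℝ := fun z => deriv (deriv mu) z + c₁ ^ 2 * (Real.sin (mu z) * Real.cos (mu z))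
    with hD
  have hDc : ContinuousOn D J := hmu''.continuousOn.add (continuousOn_const.mul
    ((Real.continuous_sin.comp_continuousOn hmu.continuousOn).mul
      (Real.continuous_cos.comp_continuousOn hmu.continuousOn)))
  have hprod : ∀ z ∈ J, deriv mu z * D z = 0 := by
    intro z hz
    have h1 := (hasDerivAt_of_contDiffOn hJ hmu' hz).pow 2
    have h2 := (((hasDerivAt_of_contDiffOn hJ hmu hz).sin.pow 2).const_mul (c₁ ^ 2)).const_sub
      (c₂ ^ 2)
    have h3 := (h1.congr_of_eventuallyEq (by
      filter_upwards [hJ.mem_nhds hz] with t ht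
      exact (he t ht).symm)).unique h2
    simp only [hD]
    norm_num at h3
    linear_combination h3 / 2
  -- Where D ≠ 0, μ' vanishes on a neighbourhood, so μ'' = 0; the first order equation then fixes
  -- c₁² sin² μ = c₂² and with it the value of D².
  have hdich : ∀ z ∈ J, D z ≠ 0 → deriv mu z = 0 ∧ D z ^ 2 = c₂ ^ 2 * (c₁ ^ 2 - c₂ ^ 2) := by
    intro z hz hDz
    have h1 : deriv mu z = 0 := (mul_eq_zero.1 (hprod z hz)).resolve_right hDz
    have h2 : ∀ᶠ t in nhds z, deriv mu t = 0 := by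
      have := (hDc.continuousAt (hJ.mem_nhds hz)).eventually_ne hDz
      filter_upwards [this, hJ.mem_nhds hz] with t ht htJ
      exact (mul_eq_zero.1 (hprod t htJ)).resolve_right ht
    have h3 : deriv (deriv mu) z = 0 := by
      rw [Filter.EventuallyEq.deriv_eq (h2 : deriv mu =ᶠ[nhds z] fun _ => 0)]; simp
    refine ⟨h1, ?_⟩
    have h4 := he z hz
    rw [h1] at h4
    have h5 := Real.sin_sq_add_cos_sq (mu z)
    simp only [hD, h3]
    linear_combination c₁ ^ 4 * Real.sin (mu z) ^ 2 * h5 +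
      (c₁ ^ 2 - c₂ ^ 2 - c₁ ^ 2 * Real.sin (mu z) ^ 2) * h4
  suffices h : D z = 0 by simp only [hD] at h; linarith
  by_contra hDz
  have hd := (hdich z hz hDz).2
  have hd0 : c₂ ^ 2 * (c₁ ^ 2 - c₂ ^ 2) ≠ 0 := hd ▸ pow_ne_zero 2 hDz
  -- D² takes at most the values 0 and d, so by the intermediate value theorem one non-zero value of
  -- D excludes all zeros. Then μ' ≡ 0, against the hypothesis.
  have hall : ∀ t ∈ J, D t ≠ 0 := by
    by_contra! hcon
    obtain ⟨t, ht, hDt⟩ := hcon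
    set d := c₂ ^ 2 * (c₁ ^ 2 - c₂ ^ 2)
    have hdpos : 0 < d := hd ▸ (sq_nonneg _).lt_of_ne' (pow_ne_zero 2 hDz)
    obtain ⟨s, hs, hDs⟩ := hJc.intermediate_value ht hz (hDc.pow 2)
      (show d / 2 ∈ Set.Icc (D t ^ 2) (D z ^ 2) by
        rw [hDt, hd]; constructor <;> norm_num <;> linarith)
    have hDs' : D s ^ 2 = d / 2 := hDs
    have : D s ≠ 0 := fun h => by rw [h] at hDs'; norm_num at hDs'; linarith
    have := (hdich s hs this).2
    linarith
  obtain ⟨t, ht, htne⟩ := h0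
  exact htne (hdich t ht (hall t ht)).1

end Gluing

/-! ### Vector fields orthogonal to the (x, y)-surfaces -/

namespace Setting

variable {U : Set R3} {lam : ℝ × ℝ → ℝ} {mu : ℝ → ℝ} {c₁ : ℝ} {P κ₁ κ₂ κ₃ : R3 → ℝ}
  {f N : R3 → E4} (H : Setting U lam mu c₁ P κ₁ κ₂ κ₃ f N)

include H

/-- Expansion of an inner product with a vector orthogonal to `f_x` and `f_y`. -/
theorem inner_eq_of_orthogonal {p : R3} (hp : p ∈ U) {v : E4} (hx : ⟪v, dX f p⟫_ℝ = 0)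
    (hy : ⟪v, dY f p⟫_ℝ = 0) (w : E4) :
    ⟪v, w⟫_ℝ = ⟪v, dZ f p⟫_ℝ * ⟪w, dZ f p⟫_ℝ * invFactor P p ^ 2 + ⟪v, N p⟫_ℝ * ⟪w, N p⟫_ℝ := by
  have h := H.principalCoords.inner_eq hp v w
  have h1 : ⟪v, pd (coordDir 0) f p⟫_ℝ = 0 := hx
  have h2 : ⟪v, pd (coordDir 1) f p⟫_ℝ = 0 := hy
  rw [h1, h2] at h
  simp only [Matrix.cons_val] at h
  change _ = _ + _ + ⟪v, dZ f p⟫_ℝ * ⟪w, dZ f p⟫_ℝ / _ + _ at h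
  rw [h, invFactor]
  simp [div_eq_mul_inv]

section SphereField

variable {F : R3 → E4} (hF : ContDiffOn ℝ ∞ F U) (hx : ∀ p ∈ U, ⟪F p, dX f p⟫_ℝ = 0)
  (hy : ∀ p ∈ U, ⟪F p, dY f p⟫_ℝ = 0) {ε : ℝ}
  (hxx : ∀ p ∈ U, ⟪dX F p, dX f p⟫_ℝ = ε * (P p ^ 2 * Real.cos (angle lam mu p) ^ 2))
  (hyy : ∀ p ∈ U, ⟪dY F p, dY f p⟫_ℝ = ε * (P p ^ 2 * Real.sin (angle lam mu p) ^ 2))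

include hF hx hy hxx hyy

/-- Differentiating ⟨F, f_x⟩ = 0 along x and ⟨F, f_y⟩ = 0 along y gives two linear equations for the
components of F along f_z and N. They force F to be proportional to u f_z - μ'N and give u ⟨F, f_z⟩
K = ε with K = μ'k - u_z. This is the common entry point for the structures: F is the fixed normal
(ε = 0), the moving normal (ε = 0) or f itself (ε = 1). -/
theorem field_normal_and_curvature {p : R3} (hp : p ∈ U) :
    ⟪F p, N p⟫_ℝ = -(deriv mu p.2.2 * invFactor P p * ⟪F p, dZ f p⟫_ℝ) ∧
    invFactor P p * ⟪F p, dZ f p⟫_ℝ * (dZ (invFactor P) p - deriv mu p.2.2 * κ₃ p) = -ε := by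
  have PC := H.principalCoords
  have hFx : HasPartial (1, 0, 0) F (dX F p) p := .of_contDiffOn H.isOpen hF hp _
  have hFy : HasPartial (0, 1, 0) F (dY F p) p := .of_contDiffOn H.isOpen hF hp _
  have ex := (hFx.inner (PC.hasPartial_pd hp 0 (1, 0, 0))).eq_of_eqOn (.const 0) H.isOpen hp hx
  have ey := (hFy.inner (PC.hasPartial_pd hp 1 (0, 1, 0))).eq_of_eqOn (.const 0) H.isOpen hp hy
  rw [show pd (coordDir 0) f p = dX f p from rfl, hxx p hp,
    H.inner_eq_of_orthogonal hp (hx p hp) (hy p hp)] at ex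
  rw [show pd (coordDir 1) f p = dY f p from rfl, hyy p hp,
    H.inner_eq_of_orthogonal hp (hx p hp) (hy p hp)] at ey
  have e1 : ⟪pd (1, 0, 0) (pd (coordDir 0) f) p, dZ f p⟫_ℝ = _ :=
    PC.inner_snd_diag hp (i := 0) (j := 2) (by decide)
  have e2 : ⟪pd (1, 0, 0) (pd (coordDir 0) f) p, N p⟫_ℝ = _ := PC.inner_snd_normal hp 0 0
  have e3 : ⟪pd (0, 1, 0) (pd (coordDir 1) f) p, dZ f p⟫_ℝ = _ :=
    PC.inner_snd_diag hp (i := 1) (j := 2) (by decide)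
  have e4 : ⟪pd (0, 1, 0) (pd (coordDir 1) f) p, N p⟫_ℝ = _ := PC.inner_snd_normal hp 1 1
  simp only [coordDir, Matrix.cons_val, if_true] at e1 e2 e3 e4 ex ey
  rw [H.metric_zero_fst hp (H.hasPartial_angle_z hp)] at e1
  rw [H.metric_one_fst hp (H.hasPartial_angle_z hp)] at e3
  rw [e1, e2] at ex
  rw [e3, e4] at ey
  have hP : P p = 1 / invFactor P p := by simp [invFactor]
  rw [hP] at ex ey
  have hS := H.sin_ne hp
  have hC := H.cos_ne hp
  have hu := (H.u_pos hp).ne'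
  have hSC := Real.sin_sq_add_cos_sq (angle lam mu p)
  have k1 := H.κ₁_mul_cos hp
  have k2 := H.κ₂_mul_sin hp
  simp only [show pd (0, 0, 1) (invFactor P) p = dZ (invFactor P) p from rfl] at ex ey
  set S := Real.sin (angle lam mu p)
  set C := Real.cos (angle lam mu p)
  set u := invFactor P p
  set X := ⟪F p, dZ f p⟫_ℝ
  set Y := ⟪F p, N p⟫_ℝ
  have ex' : ε * C + X * u * (u * S * deriv mu p.2.2 + C * dZ (invFactor P) p) +
      Y * (u * S + κ₃ p * C) = 0 := by
    rw [← k1]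
    field_simp at ex
    refine mul_left_cancel₀ hC ?_
    linear_combination ex
  have ey' : ε * S + X * u * (-(u * C * deriv mu p.2.2) + S * dZ (invFactor P) p) +
      Y * (-(u * C) + κ₃ p * S) = 0 := by
    rw [← k2]
    field_simp at ey
    refine mul_left_cancel₀ hS ?_
    linear_combination ey
  -- Rotating the pair `ex'`, `ey'` by the angle φ separates the unknowns: one combination gives Y,
  -- the other the equation with ε.
  have hY : Y = -(deriv mu p.2.2 * u * X) := by
    refine mul_left_cancel₀ hu ?_
    linear_combination S * ex' - C * ey' - u * (Y + u * deriv mu p.2.2 * X) * hSC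
  refine ⟨hY, ?_⟩
  linear_combination C * ex' + S * ey' - κ₃ p * hY -
    (ε + X * u * dZ (invFactor P) p + Y * κ₃ p) * hSC

/-- These are the z-derivatives of the two orthogonality relations and of the relation between ⟨F,
N⟩ and ⟨F, f_z⟩ found before. With F_z known, they control u_x, u_y and μ''. -/
theorem field_deriv_z {p : R3} (hp : p ∈ U) :
    ⟪dZ F p, dX f p⟫_ℝ = ⟪F p, dZ f p⟫_ℝ * dX (invFactor P) p / invFactor P p ∧
    ⟪dZ F p, dY f p⟫_ℝ = ⟪F p, dZ f p⟫_ℝ * dY (invFactor P) p / invFactor P p ∧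
    ⟪dZ F p, N p⟫_ℝ + deriv mu p.2.2 * invFactor P p * ⟪dZ F p, dZ f p⟫_ℝ +
      ⟪F p, dZ f p⟫_ℝ * (deriv (deriv mu) p.2.2 * invFactor P p - κ₃ p -
        deriv mu p.2.2 ^ 2 * κ₃ p) = 0 := by
  have PC := H.principalCoords
  have hFz : HasPartial (0, 0, 1) F (dZ F p) p := .of_contDiffOn H.isOpen hF hp _
  have ex := (hFz.inner (PC.hasPartial_pd hp 0 (0, 0, 1))).eq_of_eqOn (.const 0) H.isOpen hp hx
  have ey := (hFz.inner (PC.hasPartial_pd hp 1 (0, 0, 1))).eq_of_eqOn (.const 0) H.isOpen hp hy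
  have hfz := PC.hasPartial_pd hp 2 (0, 0, 1)
  have ez := (hFz.inner (PC.hasPartial_N hp (0, 0, 1))).eq_of_eqOn
    (((H.hasPartial_deriv_mu_z hp).mul (H.hasPartial_u hp _)).mul (hFz.inner hfz)).neg
    H.isOpen hp fun q hq => (H.field_normal_and_curvature hF hx hy hxx hyy hq).1
  rw [show pd (coordDir 0) f p = dX f p from rfl,
    H.inner_eq_of_orthogonal hp (hx p hp) (hy p hp)] at ex
  rw [show pd (coordDir 1) f p = dY f p from rfl,
    H.inner_eq_of_orthogonal hp (hx p hp) (hy p hp)] at ey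
  have e1 := PC.inner_snd_left hp 2 0
  rw [PC.snd_comm hp 0 2] at e1
  change ⟪pd (0, 0, 1) (pd (coordDir 0) f) p, dZ f p⟫_ℝ = _ at e1
  have e2 : ⟪pd (0, 0, 1) (pd (coordDir 0) f) p, N p⟫_ℝ = 0 := PC.inner_snd_normal hp 0 2
  have e3 := PC.inner_snd_left hp 2 1
  rw [PC.snd_comm hp 1 2] at e3
  change ⟪pd (0, 0, 1) (pd (coordDir 1) f) p, dZ f p⟫_ℝ = _ at e3
  have e4 : ⟪pd (0, 0, 1) (pd (coordDir 1) f) p, N p⟫_ℝ = 0 := PC.inner_snd_normal hp 1 2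
  have e5 : ⟪pd (0, 0, 1) (pd (coordDir 2) f) p, dZ f p⟫_ℝ = _ := PC.inner_snd_left hp 2 2
  have e6 : ⟪pd (0, 0, 1) (pd (coordDir 2) f) p, N p⟫_ℝ = _ := PC.inner_snd_normal hp 2 2
  have e7 : pd (0, 0, 1) N p = -(κ₃ p • dZ f p) := H.hyp.weingarten_z p hp
  rw [show pd (coordDir 2) f p = dZ f p from rfl, e7,
    H.inner_eq_of_orthogonal hp (hx p hp) (hy p hp) (pd (0, 0, 1) (pd (coordDir 2) f) p),
    inner_neg_right, inner_smul_right] at ez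
  rw [e1, e2] at ex
  rw [e3, e4] at ey
  rw [e5, e6] at ez
  have hY := (H.field_normal_and_curvature hF hx hy hxx hyy hp).1
  have hu := (H.u_pos hp).ne'
  have hP : P p = 1 / invFactor P p := by simp [invFactor]
  simp only [coordDir, Matrix.cons_val, if_true] at ex ey ez
  rw [H.metric_two_fst hp] at ex ey ez
  rw [hP, hY] at ez
  rw [hY] at ex ey
  refine ⟨?_, ?_, ?_⟩
  · change _ + (_ * (-2 * dX (invFactor P) p / _ / _) * _ + _) = _ at ex
    field_simp at ex ⊢
    linear_combination ex
  · change _ + (_ * (-2 * dY (invFactor P) p / _ / _) * _ + _) = _ at ey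
    field_simp at ey ⊢
    linear_combination ey
  · simp only [show pd (0, 0, 1) (invFactor P) p = dZ (invFactor P) p from rfl] at ez
    field_simp at ez ⊢
    linear_combination ez

end SphereField

end Setting

/-! ### Alternatives on connected sets -/

/-- A continuous real function with at most two values on a preconnected set is constant. -/
theorem eq_or_eq_of_isPreconnected {X : Type*} [TopologicalSpace X] {U : Set X}
    (hU : IsPreconnected U) {g : X → ℝ} (hg : ContinuousOn g U) {a b : ℝ}
    (h : ∀ p ∈ U, g p = a ∨ g p = b) : (∀ p ∈ U, g p = a) ∨ ∀ p ∈ U, g p = b := by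
  by_contra! hcon
  obtain ⟨⟨p, hp, hpa⟩, q, hq, hqb⟩ := hcon
  have hpb := (h p hp).resolve_left hpa
  have hqa := (h q hq).resolve_right hqb
  have hab : a ≠ b := fun e => hpa (hpb.trans e.symm)
  obtain ⟨s, hs, hgs⟩ := (hU.image g hg).ordConnected.uIcc_subset ⟨p, hp, hpb⟩ ⟨q, hq, hqa⟩
    (show (a + b) / 2 ∈ Set.uIcc b a by
      rw [Set.mem_uIcc]
      rcases le_total a b with h | h
      · right; constructor <;> linarith
      · left; constructor <;> linarith)
  rcases h s hs with h | h <;> exact hab (by linarith)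

/-- If `g h = 0` on a preconnected set for continuous functions without a common zero, then one of
them vanishes identically. -/
theorem eq_zero_or_eq_zero_of_isPreconnected {X : Type*} [TopologicalSpace X] {U : Set X}
    (hU : IsPreconnected U) {g h : X → ℝ} (hg : ContinuousOn g U) (hh : ContinuousOn h U)
    (hgh : ∀ p ∈ U, g p = 0 ∨ h p = 0) (hne : ∀ p ∈ U, g p ≠ 0 ∨ h p ≠ 0) :
    (∀ p ∈ U, g p = 0) ∨ ∀ p ∈ U, h p = 0 := by
  have hpos : ∀ p ∈ U, g p ^ 2 + h p ^ 2 ≠ 0 := fun p hp h0 => by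
    have h1 : g p = 0 := by nlinarith [sq_nonneg (g p), sq_nonneg (h p)]
    have h2 : h p = 0 := by nlinarith [sq_nonneg (g p), sq_nonneg (h p)]
    rcases hne p hp with h' | h'
    exacts [h' h1, h' h2]
  -- This quotient is 0 where g = 0 and 1 where h = 0, so it is constant by the preceding two-value
  -- principle.
  have hcont : ContinuousOn (fun p => g p ^ 2 / (g p ^ 2 + h p ^ 2)) U :=
    (hg.pow 2).div ((hg.pow 2).add (hh.pow 2)) hpos
  rcases eq_or_eq_of_isPreconnected hU hcont (a := 0) (b := 1) fun p hp => by
    rcases hgh p hp with h' | h'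
    · left; simp [h']
    · right
      have e : g p ^ 2 + h p ^ 2 = g p ^ 2 := by rw [h']; ring
      have := hpos p hp
      rw [e] at this
      simp only [e, div_self this]
    with h0 | h1
  · left
    intro p hp
    have := (div_eq_zero_iff.1 (h0 p hp)).resolve_right (hpos p hp)
    exact pow_eq_zero_iff (two_ne_zero) |>.1 this
  · right
    intro p hp
    have := (div_eq_one_iff_eq (hpos p hp)).1 (h1 p hp)
    exact pow_eq_zero_iff (two_ne_zero) |>.1 (by linarith)

/-! ### The dual: Schouten eigenvalues, regular set and conformal inequivalence -/

namespace Setting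

variable {U : Set R3} {lam : ℝ × ℝ → ℝ} {mu : ℝ → ℝ} {c₁ : ℝ} {P κ₁ κ₂ κ₃ : R3 → ℝ}
  {f N : R3 → E4} (H : Setting U lam mu c₁ P κ₁ κ₂ κ₃ f N) {p : R3} (hp : p ∈ U)

include H hp

theorem κ₁_eq_div : κ₁ p = invFactor P p * Real.sin (angle lam mu p) / Real.cos (angle lam mu p) +
    κ₃ p := by
  have := H.cos_ne hp
  field_simp; linear_combination H.κ₁_mul_cos hp

theorem κ₂_eq_div : κ₂ p =
    -(invFactor P p * Real.cos (angle lam mu p) / Real.sin (angle lam mu p)) + κ₃ p := by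
  have := H.sin_ne hp
  field_simp; linear_combination H.κ₂_mul_sin hp

/-- With w = u + ik, this formula and the next two together say 2σ₃ = |w|² and 2(σ₁ cos φ + i σ₂ sin
φ) = -e^{iφ} w². -/
theorem sigma₃_eq : sigma₃ κ₁ κ₂ κ₃ p = (invFactor P p ^ 2 + κ₃ p ^ 2) / 2 := by
  have h1 := H.cos_ne hp
  have h2 := H.sin_ne hp
  rw [sigma₃, H.κ₁_eq_div hp, H.κ₂_eq_div hp]
  field_simp; ring

theorem sigma₁_eq : sigma₁ κ₁ κ₂ κ₃ p = (κ₃ p ^ 2 - invFactor P p ^ 2 +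
    2 * invFactor P p * κ₃ p * (Real.sin (angle lam mu p) / Real.cos (angle lam mu p))) / 2 := by
  have h1 := H.cos_ne hp
  have h2 := H.sin_ne hp
  rw [sigma₁, H.κ₁_eq_div hp, H.κ₂_eq_div hp]
  field_simp; ring

theorem sigma₂_eq : sigma₂ κ₁ κ₂ κ₃ p = (κ₃ p ^ 2 - invFactor P p ^ 2 -
    2 * invFactor P p * κ₃ p * (Real.cos (angle lam mu p) / Real.sin (angle lam mu p))) / 2 := by
  have h1 := H.cos_ne hp
  have h2 := H.sin_ne hp
  rw [sigma₂, H.κ₁_eq_div hp, H.κ₂_eq_div hp]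
  field_simp; ring

theorem sigma₃_pos : 0 < sigma₃ κ₁ κ₂ κ₃ p := by
  rw [H.sigma₃_eq hp]
  have := H.u_pos hp
  positivity

omit hp

theorem smooth_κ₂ : ContDiffOn ℝ ∞ κ₂ U := H.principalCoords.smooth_κ 1

theorem smooth_sigma : ContDiffOn ℝ ∞ (sigma₁ κ₁ κ₂ κ₃) U ∧ ContDiffOn ℝ ∞ (sigma₂ κ₁ κ₂ κ₃) U ∧
    ContDiffOn ℝ ∞ (sigma₃ κ₁ κ₂ κ₃) U := by
  have h1 := H.smooth_κ₁
  have h2 := H.smooth_κ₂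
  have h3 := H.smooth_k
  unfold sigma₁ sigma₂ sigma₃
  refine ⟨?_, ?_, ?_⟩ <;> fun_prop

theorem smooth_angle : ContDiffOn ℝ ∞ (angle lam mu) U :=
  (contDiffOn_comp_xy H.smooth_lam).add (contDiffOn_comp_z H.smooth_mu)

theorem isOpen_regularSet : IsOpen (regularSet U κ₁ κ₂ κ₃) := by
  obtain ⟨h1, h2, h3⟩ := H.smooth_sigma
  exact ((h1.continuousOn.mul h2.continuousOn).mul h3.continuousOn).isOpen_inter_preimage H.isOpen
    isOpen_compl_singleton

section Dual

variable {fs : R3 → E4} (hfs : IsDual U f κ₁ κ₂ κ₃ fs)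

include hfs

omit H in
theorem dual_partials (hp : p ∈ U) : dX fs p = sigma₁ κ₁ κ₂ κ₃ p • dX f p ∧
    dY fs p = sigma₂ κ₁ κ₂ κ₃ p • dY f p ∧ dZ fs p = sigma₃ κ₁ κ₂ κ₃ p • dZ f p := by
  have h := (hfs p hp).fderiv
  simp only [dX, dY, dZ, h, ← map_smul]
  refine ⟨?_, ?_, ?_⟩ <;> simp [schouten]

theorem smooth_dual : ContDiffOn ℝ ∞ fs U := by
  obtain ⟨h1, h2, h3⟩ := H.smooth_sigma
  refine (contDiffOn_infty_iff_fderiv_of_isOpen H.isOpen).2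
    ⟨fun p hp => (hfs p hp).differentiableAt.differentiableWithinAt, ?_⟩
  have hf' := ((contDiffOn_infty_iff_fderiv_of_isOpen H.isOpen).1 H.hyp.smooth_f).2
  refine ContDiffOn.congr (f := fun p => (fderiv ℝ f p).comp (schouten κ₁ κ₂ κ₃ p)) ?_
    fun p hp => (hfs p hp).fderiv
  refine hf'.clm_comp (contDiffOn_clm_apply.2 fun y => ?_)
  exact (h1.smul contDiffOn_const).prodMk
    ((h2.smul contDiffOn_const).prodMk (h3.smul contDiffOn_const))

/-- The dual is a generic conformally flat hypersurface on the regular set. -/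
theorem isGuichardHypersurface_dual {φs : R3 → ℝ}
    (hφs : IsDualAngle U (angle lam mu) κ₁ κ₂ κ₃ φs) :
    IsGuichardHypersurface (regularSet U κ₁ κ₂ κ₃) φs (dualP P κ₁ κ₂ κ₃)
      (dualκ₁ κ₁ κ₂ κ₃) (dualκ₂ κ₁ κ₂ κ₃) (dualκ₃ κ₁ κ₂ κ₃) fs (dualN N) := by
  have hO := H.isOpen_regularSet
  have hne : ∀ p ∈ regularSet U κ₁ κ₂ κ₃, sigma₁ κ₁ κ₂ κ₃ p ≠ 0 ∧ sigma₂ κ₁ κ₂ κ₃ p ≠ 0 ∧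
      sigma₃ κ₁ κ₂ κ₃ p ≠ 0 := fun p hp =>
    ⟨left_ne_zero_of_mul (left_ne_zero_of_mul hp.2), right_ne_zero_of_mul (left_ne_zero_of_mul hp.2),
      right_ne_zero_of_mul hp.2⟩
  have hN : ∀ p ∈ regularSet U κ₁ κ₂ κ₃, ∀ v, pd v (dualN N) p = -pd v N p := fun p hp v =>
    (H.principalCoords.hasPartial_N hp.1 v).neg.pd_eq
  refine
  { smooth_f := (H.smooth_dual hfs).mono fun p hp => hp.1
    smooth_N := (H.hyp.smooth_N.mono fun p hp => hp.1).neg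
    P_pos := fun p hp => mul_pos (H.sigma₃_pos hp.1) (H.hyp.P_pos p hp.1)
    sin_cos_ne := fun p hp => ?_
    metric_xx := fun p hp => ?_
    metric_yy := fun p hp => ?_
    metric_zz := fun p hp => ?_
    metric_xy := fun p hp => ?_
    metric_xz := fun p hp => ?_
    metric_yz := fun p hp => ?_
    norm_N := fun p hp => (norm_neg _).trans (H.hyp.norm_N p hp.1)
    N_x := fun p hp => ?_
    N_y := fun p hp => ?_
    N_z := fun p hp => ?_
    weingarten_x := fun p hp => ?_
    weingarten_y := fun p hp => ?_
    weingarten_z := fun p hp => ?_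
    κ₁_eq := fun p hp => ?_
    κ₂_eq := fun p hp => ?_ } <;>
  obtain ⟨n1, n2, n3⟩ := hne p hp <;> obtain ⟨ex, ey, ez⟩ := dual_partials hfs hp.1 <;>
  obtain ⟨hc, hs⟩ := hφs p hp.1 <;> have S0 := H.sin_ne hp.1 <;> have C0 := H.cos_ne hp.1
  · rw [hc, hs]
    exact mul_ne_zero (mul_ne_zero (div_ne_zero n2 n3) S0) (mul_ne_zero (div_ne_zero n1 n3) C0)
  · rw [ex, inner_smul_left, inner_smul_right, H.hyp.metric_xx p hp.1, hc, dualP]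
    simp; field_simp
  · rw [ey, inner_smul_left, inner_smul_right, H.hyp.metric_yy p hp.1, hs, dualP]
    simp; field_simp
  · rw [ez, inner_smul_left, inner_smul_right, H.hyp.metric_zz p hp.1, dualP]
    simp; ring
  · rw [ex, ey, inner_smul_left, inner_smul_right, H.hyp.metric_xy p hp.1]; simp
  · rw [ex, ez, inner_smul_left, inner_smul_right, H.hyp.metric_xz p hp.1]; simp
  · rw [ey, ez, inner_smul_left, inner_smul_right, H.hyp.metric_yz p hp.1]; simp
  · rw [ex, dualN, inner_neg_left, inner_smul_right, H.hyp.N_x p hp.1]; simp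
  · rw [ey, dualN, inner_neg_left, inner_smul_right, H.hyp.N_y p hp.1]; simp
  · rw [ez, dualN, inner_neg_left, inner_smul_right, H.hyp.N_z p hp.1]; simp
  · rw [ex, smul_smul, dualκ₁, div_mul_cancel₀ _ n1]
    exact (hN p hp (1, 0, 0)).trans (by
      rw [show pd (1, 0, 0) N p = _ from H.hyp.weingarten_x p hp.1, neg_smul])
  · rw [ey, smul_smul, dualκ₂, div_mul_cancel₀ _ n2]
    exact (hN p hp (0, 1, 0)).trans (by
      rw [show pd (0, 1, 0) N p = _ from H.hyp.weingarten_y p hp.1, neg_smul])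
  · rw [ez, smul_smul, dualκ₃, div_mul_cancel₀ _ n3]
    exact (hN p hp (0, 0, 1)).trans (by
      rw [show pd (0, 0, 1) N p = _ from H.hyp.weingarten_z p hp.1, neg_smul])
  -- Once κ₁ and κ₂ are expressed by P, κ₃ and φ, the required relation is a rational identity; the
  -- same holds for κ₂*.
  · have hP := (H.hyp.P_pos p hp.1).ne'
    have e1 := H.κ₁_eq_div hp.1
    have e2 := H.κ₂_eq_div hp.1
    rw [invFactor] at e1 e2
    rw [Real.tan_eq_sin_div_cos, hs, hc, dualP, dualκ₁, dualκ₃]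
    field_simp
    simp only [sigma₁, sigma₂, sigma₃, e1, e2]
    field_simp
    ring
  · have hP := (H.hyp.P_pos p hp.1).ne'
    have e1 := H.κ₁_eq_div hp.1
    have e2 := H.κ₂_eq_div hp.1
    rw [invFactor] at e1 e2
    rw [Real.cot_eq_cos_div_sin, hs, hc, dualP, dualκ₂, dualκ₃]
    field_simp
    simp only [sigma₁, sigma₂, sigma₃, e1, e2]
    field_simp
    ring

omit H hfs in
-- A similarity stretches every tangent vector by r, and the inversion at q by the inverse square of
-- the distance to q: in both cases one factor serves all directions.
theorem exists_norm_pd_eq {O : Set R3} (hO : IsOpen O) {g h : R3 → E4}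
    (hg : ∀ p ∈ O, DifferentiableAt ℝ g p) (hc : ConformallyEquivalentOn O g h) (hp : p ∈ O) :
    ∃ t : ℝ, ∀ v, ‖pd v h p‖ = t * ‖pd v g p‖ := by
  obtain ⟨T, r, b, hr, hT | ⟨q, hT⟩⟩ := hc
  · refine ⟨r, fun v => ?_⟩
    have h1 : HasFDerivAt (fun x => r • T (g x) + b)
        (r • ((T : E4 →L[ℝ] E4).comp (fderiv ℝ g p))) p :=
      (((T : E4 →L[ℝ] E4).hasFDerivAt.comp p (hg p hp).hasFDerivAt).const_smul r).add_const b
    have h2 : pd v h p = r • T (pd v g p) := by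
      rw [pd_congr hO hp hT v]; exact (HasPartial.of_hasFDerivAt h1 v).pd_eq
    rw [h2, norm_smul, T.norm_map, Real.norm_of_nonneg hr.le]
  · have hne := (hT p hp).1
    refine ⟨r * (1 / dist (g p) q) ^ 2, fun v => ?_⟩
    have h0 := (EuclideanGeometry.hasFDerivAt_inversion (R := 1) hne).comp p (hg p hp).hasFDerivAt
    have h1 := (((T : E4 →L[ℝ] E4).hasFDerivAt.comp p h0).const_smul r).add_const b
    rw [pd_congr hO hp (fun x hx => (hT x hx).2) v]
    refine (congrArg norm (HasPartial.of_hasFDerivAt h1 v).pd_eq).trans ?_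
    simp [norm_smul, pd, abs_of_pos hr]
    ring

/-- Passing to the dual stretches the x-direction by |σ₁| and the z-direction by σ₃. Equal
stretching means σ₁² = σ₃², and the definition of the dual angle turns this into the claim. -/
theorem cos_sq_eq_of_conformallyEquivalentOn {O : Set R3} (hO : IsOpen O) (hOU : O ⊆ U)
    {φs : R3 → ℝ} (hφs : IsDualAngle U (angle lam mu) κ₁ κ₂ κ₃ φs)
    (hc : ConformallyEquivalentOn O f fs) (hp : p ∈ O) :
    Real.cos (φs p) ^ 2 = Real.cos (angle lam mu p) ^ 2 := by
  have hpU := hOU hp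
  obtain ⟨t, ht⟩ := exists_norm_pd_eq hO (fun q hq =>
    (H.hyp.smooth_f.contDiffAt (H.isOpen.mem_nhds (hOU hq))).differentiableAt (by simp)) hc hp
  obtain ⟨ex, -, ez⟩ := dual_partials hfs hpU
  have h1 : ‖dX fs p‖ = t * ‖dX f p‖ := ht _
  have h2 : ‖dZ fs p‖ = t * ‖dZ f p‖ := ht _
  have hP := H.hyp.P_pos p hpU
  have nx : ‖dX f p‖ ≠ 0 := fun h => by
    have := H.hyp.metric_xx p hpU
    rw [real_inner_self_eq_norm_sq, h] at this
    have h3 := H.cos_ne hpU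
    have : 0 < P p ^ 2 * Real.cos (angle lam mu p) ^ 2 := by positivity
    linarith
  have nz : ‖dZ f p‖ ≠ 0 := fun h => by
    have := H.hyp.metric_zz p hpU
    rw [real_inner_self_eq_norm_sq, h] at this
    have : 0 < P p ^ 2 := by positivity
    linarith
  rw [ex, norm_smul] at h1
  rw [ez, norm_smul] at h2
  have h3 := mul_right_cancel₀ nx h1
  have h4 := mul_right_cancel₀ nz h2
  have h5 : sigma₁ κ₁ κ₂ κ₃ p ^ 2 = sigma₃ κ₁ κ₂ κ₃ p ^ 2 := by
    rw [← sq_abs, ← Real.norm_eq_abs, h3, ← h4, Real.norm_eq_abs, sq_abs]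
  have := (H.sigma₃_pos hpU).ne'
  rw [(hφs p hpU).1, mul_pow, div_pow, h5, div_self (pow_ne_zero 2 this), one_mul]

/-- If the dual is conformally equivalent to `f`, then `φ*` equals `φ` or `-φ` up to constants. -/
theorem notConformallyEquivalent {lams : ℝ × ℝ → ℝ} {mus : ℝ → ℝ}
    (hls : ContDiffOn ℝ ∞ lams (xyProj U)) (hms : ContDiffOn ℝ ∞ mus (zProj U))
    (hφs : IsDualAngle U (angle lam mu) κ₁ κ₂ κ₃ (angle lams mus))
    (h₁ : ¬ ((∀ q ∈ xyProj U, pX lams q = pX lam q ∧ pY lams q = pY lam q) ∧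
      ∀ z ∈ zProj U, deriv mus z = deriv mu z))
    (h₂ : ¬ ((∀ q ∈ xyProj U, pX lams q = -pX lam q ∧ pY lams q = -pY lam q) ∧
      ∀ z ∈ zProj U, deriv mus z = -deriv mu z)) :
    NotConformallyEquivalent U κ₁ κ₂ κ₃ f fs := by
  have hφc : ContinuousOn (angle lam mu) U := H.smooth_angle.continuousOn
  have hφsc : ContinuousOn (angle lams mus) U :=
    ((contDiffOn_comp_xy hls).add (contDiffOn_comp_z hms)).continuousOn
  have main : ¬ ∀ p ∈ U, Real.cos (angle lams mus p) ^ 2 = Real.cos (angle lam mu p) ^ 2 := by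
    intro hcos
    -- the partial derivatives of `φ*`
    have hasx : ∀ p ∈ U, HasPartial (1, 0, 0) (angle lams mus) (pX lams (p.1, p.2.1)) p :=
      fun p hp => ((HasPartial.comp_xy (hls.contDiffAt (H.isOpen_V.mem_nhds (mem_xyProj hp)) |>.differentiableAt (by simp)) _).add
        (HasPartial.comp_z (hasDerivAt_of_contDiffOn H.isOpen_J hms (mem_zProj hp)) _)).eq
        (by simp [pd, pX])
    have hasy : ∀ p ∈ U, HasPartial (0, 1, 0) (angle lams mus) (pY lams (p.1, p.2.1)) p :=
      fun p hp => ((HasPartial.comp_xy (hls.contDiffAt (H.isOpen_V.mem_nhds (mem_xyProj hp)) |>.differentiableAt (by simp)) _).add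
        (HasPartial.comp_z (hasDerivAt_of_contDiffOn H.isOpen_J hms (mem_zProj hp)) _)).eq
        (by simp [pd, pY])
    have hasz : ∀ p ∈ U, HasPartial (0, 0, 1) (angle lams mus) (deriv mus p.2.2) p :=
      fun p hp => ((HasPartial.comp_xy (hls.contDiffAt (H.isOpen_V.mem_nhds (mem_xyProj hp)) |>.differentiableAt (by simp)) _).add
        (HasPartial.comp_z (hasDerivAt_of_contDiffOn H.isOpen_J hms (mem_zProj hp)) _)).eq (by
          have : (((0, 0, 1) : R3).1, ((0, 0, 1) : R3).2.1) = (0 : ℝ × ℝ) := rfl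
          rw [this]; simp [pd])
    have zero_of_sin : ∀ {ψ : R3 → ℝ} {v p : R3} {ψ' : ℝ}, p ∈ U → HasPartial v ψ ψ' p →
        (∀ q ∈ U, Real.sin (ψ q) = 0) → ψ' = 0 := by
      intro ψ v p ψ' hp hψ h0
      have := hψ.sin.eq_of_eqOn (.const 0) H.isOpen hp h0
      refine (mul_eq_zero.1 this).resolve_left fun hc => ?_
      have h3 := Real.sin_sq_add_cos_sq (ψ p)
      rw [hc, h0 p hp] at h3
      norm_num at h3
    -- cos² φ* = cos² φ means sin(φ* - φ) sin(φ* + φ) = 0. A common zero of the factors is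
    -- impossible because sin φ cos φ ≠ 0, so one factor vanishes identically and the corresponding
    -- angle has zero derivatives.
    rcases eq_zero_or_eq_zero_of_isPreconnected H.conn
      (Real.continuous_sin.comp_continuousOn (hφsc.sub hφc))
      (Real.continuous_sin.comp_continuousOn (hφsc.add hφc)) (fun p hp => by
        have h3 := Real.sin_sq_add_cos_sq (angle lams mus p)
        have h4 := Real.sin_sq_add_cos_sq (angle lam mu p)
        refine mul_eq_zero.1 ?_
        simp only [Function.comp, Real.sin_sub, Real.sin_add, Pi.sub_apply, Pi.add_apply]
        linear_combination h3 * Real.cos (angle lam mu p) ^ 2 -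
          h4 * Real.cos (angle lams mus p) ^ 2 - hcos p hp) (fun p hp => by
        by_contra! hcon
        obtain ⟨h3, h4⟩ := hcon
        simp only [Function.comp, Real.sin_sub, Real.sin_add, Pi.sub_apply, Pi.add_apply] at h3 h4
        have hS := H.sin_ne hp
        have hC := H.cos_ne hp
        have h5 : Real.cos (angle lams mus p) * Real.sin (angle lam mu p) = 0 := by linarith
        have h6 : Real.sin (angle lams mus p) * Real.cos (angle lam mu p) = 0 := by linarith
        have h7 := Real.sin_sq_add_cos_sq (angle lams mus p)
        rw [(mul_eq_zero.1 h5).resolve_right hS, (mul_eq_zero.1 h6).resolve_right hC] at h7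
        norm_num at h7) with h | h
    · refine h₁ ⟨?_, ?_⟩
      · rintro _ ⟨p, hp, rfl⟩
        exact ⟨sub_eq_zero.1 (zero_of_sin hp ((hasx p hp).sub (H.hasPartial_angle_x hp)) h),
          sub_eq_zero.1 (zero_of_sin hp ((hasy p hp).sub (H.hasPartial_angle_y hp)) h)⟩
      · rintro _ ⟨p, hp, rfl⟩
        exact sub_eq_zero.1 (zero_of_sin hp ((hasz p hp).sub (H.hasPartial_angle_z hp)) h)
    · refine h₂ ⟨?_, ?_⟩
      · rintro _ ⟨p, hp, rfl⟩
        exact ⟨eq_neg_of_add_eq_zero_left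
            (zero_of_sin hp ((hasx p hp).add (H.hasPartial_angle_x hp)) h),
          eq_neg_of_add_eq_zero_left
            (zero_of_sin hp ((hasy p hp).add (H.hasPartial_angle_y hp)) h)⟩
      · rintro _ ⟨p, hp, rfl⟩
        exact eq_neg_of_add_eq_zero_left
          (zero_of_sin hp ((hasz p hp).add (H.hasPartial_angle_z hp)) h)
  refine ⟨fun hc => main fun p hp =>
    H.cos_sq_eq_of_conformallyEquivalentOn hfs H.isOpen subset_rfl hφs hc hp, ?_⟩
  rintro ⟨p₀, hp₀⟩ hc
  have hcos : ∀ p ∈ regularSet U κ₁ κ₂ κ₃,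
      Real.cos (angle lams mus p) ^ 2 = Real.cos (angle lam mu p) ^ 2 := fun p hp =>
    H.cos_sq_eq_of_conformallyEquivalentOn hfs H.isOpen_regularSet (fun q hq => hq.1) hφs hc hp
  have hmem : ∀ p ∈ U, p ∈ regularSet U κ₁ κ₂ κ₃ ↔
      Real.sin (angle lams mus p) * Real.cos (angle lams mus p) ≠ 0 := by
    intro p hp
    obtain ⟨hc', hs'⟩ := hφs p hp
    have h3 := (H.sigma₃_pos hp).ne'
    have := H.sin_ne hp
    have := H.cos_ne hp
    rw [hc', hs']
    simp [regularSet, hp]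
    tauto
  refine main fun p hp => hcos p ?_
  have hsc : ∀ p ∈ U, (Real.sin (angle lam mu p) * Real.cos (angle lam mu p)) ^ 2 ≠ 0 :=
    fun p hp => pow_ne_zero 2 (H.hyp.sin_cos_ne p hp)
  -- The quotient is 1 on U* and 0 on U \ U*. As U is connected, a non-empty U* is all of U, and the
  -- equality of the cosines extends to U.
  rcases eq_or_eq_of_isPreconnected H.conn (a := 0) (b := 1)
    (g := fun p => (Real.sin (angle lams mus p) * Real.cos (angle lams mus p)) ^ 2 /
      (Real.sin (angle lam mu p) * Real.cos (angle lam mu p)) ^ 2)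
    ((((Real.continuous_sin.comp_continuousOn hφsc).mul
      (Real.continuous_cos.comp_continuousOn hφsc)).pow 2).div
      (((Real.continuous_sin.comp_continuousOn hφc).mul
      (Real.continuous_cos.comp_continuousOn hφc)).pow 2) hsc) (fun p hp => by
      by_cases hpr : p ∈ regularSet U κ₁ κ₂ κ₃
      · right
        rw [div_eq_one_iff_eq (hsc p hp), mul_pow, mul_pow, Real.sin_sq, Real.sin_sq, hcos p hpr]
      · left
        rw [not_iff_not.2 (hmem p hp), not_not] at hpr
        rw [hpr]; simp) with h | h
  · exact absurd (h p₀ hp₀.1) (div_ne_zero (pow_ne_zero 2 ((hmem p₀ hp₀.1).1 hp₀)) (hsc p₀ hp₀.1))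
  · rw [hmem p hp]
    intro h0
    have := h p hp
    simp only [h0] at this
    norm_num at this

end Dual

end Setting

/-! ### Functions of z without regularity, and the equations for λ + const and -μ -/

theorem pd_eq_zero_of_eq_comp_z {F : Type*} [NormedAddCommGroup F] [NormedSpace ℝ F] {U : Set R3}
    (hU : IsOpen U) {g : R3 → F} {h : ℝ → F} (e : ∀ q ∈ U, g q = h q.2.2) {p : R3} (hp : p ∈ U)
    (hg : DifferentiableAt ℝ g p) {v : R3} (hv : v.2.2 = 0) : pd v g p = 0 := by
  -- Nothing is known about the regularity of h, so the chain rule is not available; instead g is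
  -- constant along the horizontal line p + tv near t = 0.
  have h1 : HasDerivAt (fun t : ℝ => p + t • v) v 0 := by
    simpa using ((hasDerivAt_id (0 : ℝ)).smul_const v).const_add p
  have h0 : p + (0 : ℝ) • v = p := by simp
  have h2 : HasDerivAt (fun t : ℝ => g (p + t • v)) (fderiv ℝ g p v) 0 :=
    (h0.symm ▸ hg.hasFDerivAt : HasFDerivAt g (fderiv ℝ g p) (p + (0 : ℝ) • v)).comp_hasDerivAt
      (0 : ℝ) h1
  have h3 : (fun t : ℝ => g (p + t • v)) =ᶠ[nhds 0] fun _ => g p := by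
    have : ∀ᶠ t : ℝ in nhds 0, p + t • v ∈ U :=
      h1.continuousAt.eventually_mem (by simpa using hU.mem_nhds hp)
    filter_upwards [this] with t ht
    rw [e _ ht, e p hp]
    simp [hv]
  exact h2.unique ((hasDerivAt_const (0 : ℝ) (g p)).congr_of_eventuallyEq h3)

/-- The slices of U at constant z may be disconnected, so vanishing x- and y-derivatives would not
suffice; equality at any two points of the same height is required. -/
theorem exists_eq_comp_z {α : Type*} [Inhabited α] {U : Set R3} {g : R3 → α}
    (h : ∀ p ∈ U, ∀ q ∈ U, p.2.2 = q.2.2 → g p = g q) : ∃ s : ℝ → α, ∀ p ∈ U, g p = s p.2.2 := by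
  classical
  refine ⟨fun z => if hz : ∃ q ∈ U, q.2.2 = z then g hz.choose else default, fun p hp => ?_⟩
  have hz : ∃ q ∈ U, q.2.2 = p.2.2 := ⟨p, hp, rfl⟩
  change g p = dite (∃ q ∈ U, q.2.2 = p.2.2) (fun hz => g hz.choose) (fun _ => default)
  rw [dif_pos hz]
  exact h p hp _ hz.choose_spec.1 hz.choose_spec.2.symm

/-- The net of the dual satisfies the same equations if `λ* = λ + const` and `μ* = -μ`. -/
theorem GuichardEquations.add_const_neg {V : Set (ℝ × ℝ)} {J : Set ℝ} {lam : ℝ × ℝ → ℝ}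
    {mu : ℝ → ℝ} {c₁ c₂ : ℝ} (h : GuichardEquations V J lam mu c₁ c₂) {ε : ℝ}
    (hε : ε = 1 ∨ ε = -1) :
    GuichardEquations V J (fun q => lam q + ε * Real.pi) (fun z => -mu z) c₁ c₂ where
  c₁_ne := h.c₁_ne
  c₂_ne := h.c₂_ne
  smooth_lam := h.smooth_lam.add contDiffOn_const
  smooth_mu := h.smooth_mu.neg
  lam_eq q hq := by
    have e1 : pX (fun q => lam q + ε * Real.pi) = pX lam := by
      funext q; simp [pX]
    have e2 : pY (fun q => lam q + ε * Real.pi) = pY lam := by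
      funext q; simp [pY]
    have e3 : Real.sin (2 * (lam q + ε * Real.pi)) = Real.sin (2 * lam q) := by
      rcases hε with rfl | rfl
      · rw [show 2 * (lam q + 1 * Real.pi) = 2 * lam q + 2 * Real.pi by ring, Real.sin_add_two_pi]
      · rw [show 2 * (lam q + -1 * Real.pi) = 2 * lam q - 2 * Real.pi by ring, Real.sin_sub_two_pi]
    rw [e1, e2, e3]
    exact h.lam_eq q hq
  mu_eq := by
    have e : deriv (fun z => -mu z) = fun z => -deriv mu z := by
      funext z; exact deriv.fun_neg
    rcases h.mu_eq with h0 | ⟨⟨z, hz, hne⟩, h1⟩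
    · left; intro z hz; rw [h0 z hz, neg_zero]
    · right
      rw [e]
      refine ⟨⟨z, hz, by simpa using hne⟩, fun z hz => ?_⟩
      rw [Real.sin_neg, neg_sq, neg_sq, h1 z hz]

theorem GuichardEquations.mu_snd {V : Set (ℝ × ℝ)} {J : Set ℝ} (hJ : IsOpen J)
    (hJc : IsPreconnected J) {lam : ℝ × ℝ → ℝ}
    {mu : ℝ → ℝ} {c₁ c₂ : ℝ} (h : GuichardEquations V J lam mu c₁ c₂) {z : ℝ} (hz : z ∈ J) :
    deriv (deriv mu) z = -(c₁ ^ 2 * (Real.sin (mu z) * Real.cos (mu z))) := by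
  rcases h.mu_eq with h0 | ⟨h1, h2⟩
  · have e1 : ∀ t ∈ J, deriv mu t = 0 := fun t ht => by
      rw [Filter.EventuallyEq.deriv_eq (f := fun _ => (0 : ℝ)) (by
        filter_upwards [hJ.mem_nhds ht] with s hs using h0 s hs)]
      simp
    rw [Filter.EventuallyEq.deriv_eq (f := fun _ => (0 : ℝ)) (by
        filter_upwards [hJ.mem_nhds hz] with s hs using e1 s hs), h0 z hz]
    simp
  · exact deriv_deriv_mu_eq hJ hJc h.smooth_mu h1 h2 hz

theorem deriv_eq_zero_of_eq_zero {J : Set ℝ} (hJ : IsOpen J) {mu : ℝ → ℝ}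
    (h0 : ∀ z ∈ J, mu z = 0) {z : ℝ} (hz : z ∈ J) : deriv mu z = 0 := by
  rw [Filter.EventuallyEq.deriv_eq (f := fun _ => (0 : ℝ)) (by
    filter_upwards [hJ.mem_nhds hz] with s hs using h0 s hs)]
  simp

/-! ### Criteria for the dual angle, and the Gauss equation when P has no (x, y)-derivatives -/

namespace Setting

variable {U : Set R3} {lam : ℝ × ℝ → ℝ} {mu : ℝ → ℝ} {c₁ : ℝ} {P κ₁ κ₂ κ₃ : R3 → ℝ}
  {f N : R3 → E4} (H : Setting U lam mu c₁ P κ₁ κ₂ κ₃ f N)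

include H

/-- `φ` has a fixed sign, so that it can be shifted by `π` or by `-π`. -/
theorem exists_shift (hr : ∀ p ∈ U, angle lam mu p ∈ Set.Ioo (-Real.pi) Real.pi) :
    ∃ ε : ℝ, (ε = 1 ∨ ε = -1) ∧
      ∀ p ∈ U, angle lam mu p + ε * Real.pi ∈ Set.Ioo (-Real.pi) Real.pi := by
  have hne : ∀ p ∈ U, angle lam mu p ≠ 0 := fun p hp h => H.sin_ne hp (by rw [h, Real.sin_zero])
  have hc := H.smooth_angle.continuousOn
  rcases eq_or_eq_of_isPreconnected H.conn (a := 1) (b := -1)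
    (g := fun p => angle lam mu p / |angle lam mu p|)
    (hc.div hc.abs fun p hp => abs_ne_zero.2 (hne p hp)) (fun p hp => by
      rcases (hne p hp).lt_or_gt with h | h
      · right; rw [abs_of_neg h, div_neg, div_self h.ne]
      · left; rw [abs_of_pos h, div_self h.ne']) with h | h
  · refine ⟨-1, Or.inr rfl, fun p hp => ?_⟩
    have h1 := (div_eq_one_iff_eq (abs_ne_zero.2 (hne p hp))).1 (h p hp)
    have h2 : 0 < angle lam mu p := h1 ▸ abs_pos.2 (hne p hp)
    have h3 := hr p hp
    constructor <;> linarith [h3.1, h3.2, Real.pi_pos]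
  · refine ⟨1, Or.inl rfl, fun p hp => ?_⟩
    have h1 := (div_eq_iff (abs_ne_zero.2 (hne p hp))).1 (h p hp)
    have h2 : angle lam mu p < 0 := by
      have := abs_pos.2 (hne p hp); linarith
    have h3 := hr p hp
    constructor <;> linarith [h3.1, h3.2, Real.pi_pos]

/-- The hypotheses are the real and imaginary parts of e^{iφ*} |w|² = -e^{iφ} w² with w = u + ik, a
form without divisions by sin φ and cos φ. -/
theorem isDualAngle_of {φs : R3 → ℝ}
    (hc : ∀ p ∈ U, Real.cos (φs p) * (invFactor P p ^ 2 + κ₃ p ^ 2) =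
      (κ₃ p ^ 2 - invFactor P p ^ 2) * Real.cos (angle lam mu p) +
        2 * invFactor P p * κ₃ p * Real.sin (angle lam mu p))
    (hs : ∀ p ∈ U, Real.sin (φs p) * (invFactor P p ^ 2 + κ₃ p ^ 2) =
      (κ₃ p ^ 2 - invFactor P p ^ 2) * Real.sin (angle lam mu p) -
        2 * invFactor P p * κ₃ p * Real.cos (angle lam mu p)) :
    IsDualAngle U (angle lam mu) κ₁ κ₂ κ₃ φs := by
  intro p hp
  have h3 : invFactor P p ^ 2 + κ₃ p ^ 2 ≠ 0 := by
    have := H.u_pos hp; positivity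
  have hS := H.sin_ne hp
  have hC := H.cos_ne hp
  rw [H.sigma₁_eq hp, H.sigma₂_eq hp, H.sigma₃_eq hp]
  constructor
  · field_simp
    linear_combination hc p hp
  · field_simp
    linear_combination hs p hp

/-- A vector orthogonal to `f_x` and `f_y` is a combination of `f_z` and `N`. -/
theorem eq_of_orthogonal {p : R3} (hp : p ∈ U) {v : E4} (hx : ⟪v, dX f p⟫_ℝ = 0)
    (hy : ⟪v, dY f p⟫_ℝ = 0) :
    v = (invFactor P p ^ 2 * ⟪v, dZ f p⟫_ℝ) • dZ f p + ⟪v, N p⟫_ℝ • N p := by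
  refine ext_inner_right ℝ fun w => ?_
  rw [H.inner_eq_of_orthogonal hp hx hy w, inner_add_left, inner_smul_left, inner_smul_left,
    real_inner_comm w (dZ f p), real_inner_comm w (N p)]
  simp; ring

/-- The Gauss equation in the `(x, y)`-plane if `P` does not depend on `(x, y)`. -/
theorem gauss_xy_of_const (hx : ∀ p ∈ U, dX (invFactor P) p = 0)
    (hy : ∀ p ∈ U, dY (invFactor P) p = 0) {p : R3} (hp : p ∈ U)
    (hE : deriv (deriv mu) p.2.2 * invFactor P p =
      κ₃ p + deriv mu p.2.2 * dZ (invFactor P) p) :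
    invFactor P p ^ 2 * (1 + deriv mu p.2.2 ^ 2) - dZ (invFactor P) p ^ 2 - κ₃ p ^ 2 =
      c₁ ^ 2 * invFactor P p ^ 2 * (Real.cos (mu p.2.2) ^ 2 - Real.sin (mu p.2.2) ^ 2) := by
  have G := H.gauss_xy hp
  have hxx : dX (dX (invFactor P)) p = 0 := by
    have := pd_congr H.isOpen hp hx (1, 0, 0)
    exact this.trans (HasPartial.const (0 : ℝ)).pd_eq
  have hyy : dY (dY (invFactor P)) p = 0 := by
    have := pd_congr H.isOpen hp hy (0, 1, 0)
    exact this.trans (HasPartial.const (0 : ℝ)).pd_eq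
  have hu := (H.u_pos hp).ne'
  have hS := H.sin_ne hp
  have hC := H.cos_ne hp
  have hl := H.lam_eq _ (mem_xyProj hp)
  have hm := H.mu_snd _ (mem_zProj hp)
  have e1 : lam (p.1, p.2.1) = angle lam mu p - mu p.2.2 := by simp [angle]
  rw [e1, Real.sin_two_mul, Real.sin_sub, Real.cos_sub] at hl
  dsimp only at G
  rw [hl, hx p hp, hy p hp, hxx, hyy] at G
  norm_num at G
  rw [hm] at hE
  refine mul_left_cancel₀ (mul_ne_zero hS hC) ?_
  field_simp at G
  linear_combination -G + (Real.cos (angle lam mu p) ^ 2 - Real.sin (angle lam mu p) ^ 2) *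
    invFactor P p * hE

theorem partials_k_of_const {p : R3} (hp : p ∈ U) (hx : dX (invFactor P) p = 0)
    (hy : dY (invFactor P) p = 0) : dX κ₃ p = 0 ∧ dY κ₃ p = 0 := by
  have h1 := H.codazzi_x hp
  have h2 := H.codazzi_y hp
  rw [hx, mul_zero, neg_zero] at h1
  rw [hy, mul_zero] at h2
  exact ⟨(mul_eq_zero.1 h1).resolve_right (H.cos_ne hp),
    (mul_eq_zero.1 h2).resolve_right (H.sin_ne hp)⟩

end Setting

/-! ### Structure (a): rigidity and dual angle -/

namespace Setting

variable {U : Set R3} {lam : ℝ × ℝ → ℝ} {mu : ℝ → ℝ} {c₁ : ℝ} {P κ₁ κ₂ κ₃ : R3 → ℝ}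
  {f N : R3 → E4} (H : Setting U lam mu c₁ P κ₁ κ₂ κ₃ f N)

include H

theorem hasPartial_f {p : R3} (hp : p ∈ U) (v : R3) : HasPartial v f (pd v f p) p :=
  .of_contDiffOn H.isOpen H.hyp.smooth_f hp v

theorem hasPartial_N {p : R3} (hp : p ∈ U) (v : R3) : HasPartial v N (pd v N p) p :=
  .of_contDiffOn H.isOpen H.hyp.smooth_N hp v

omit H in
theorem sigma₁_add_sigma₃ (p : R3) :
    sigma₁ κ₁ κ₂ κ₃ p + sigma₃ κ₁ κ₂ κ₃ p = κ₃ p * κ₁ p := by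
  simp only [sigma₁, sigma₃]; ring

omit H in
theorem sigma₂_add_sigma₃ (p : R3) :
    sigma₂ κ₁ κ₂ κ₃ p + sigma₃ κ₁ κ₂ κ₃ p = κ₃ p * κ₂ p := by
  simp only [sigma₂, sigma₃]; ring

theorem norm_sq_of_orthogonal {p : R3} (hp : p ∈ U) {v : E4} (hx : ⟪v, dX f p⟫_ℝ = 0)
    (hy : ⟪v, dY f p⟫_ℝ = 0) :
    ‖v‖ ^ 2 = ⟪v, dZ f p⟫_ℝ ^ 2 * invFactor P p ^ 2 + ⟪v, N p⟫_ℝ ^ 2 := by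
  rw [← real_inner_self_eq_norm_sq, H.inner_eq_of_orthogonal hp hx hy v]; ring

section StructureA

variable {B₀ : E4} (hA : StructureA U B₀ f)

include hA

theorem structureA_orth {p : R3} (hp : p ∈ U) : ⟪B₀, dX f p⟫_ℝ = 0 ∧ ⟪B₀, dY f p⟫_ℝ = 0 := by
  obtain ⟨-, h, hh⟩ := hA
  have key : ∀ v : R3, v.2.2 = 0 → ⟪B₀, pd v f p⟫_ℝ = 0 := fun v hv => by
    have h1 := (HasPartial.const B₀).inner (H.hasPartial_f hp v)
    have h2 := pd_eq_zero_of_eq_comp_z H.isOpen hh hp h1.1 hv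
    have := h1.pd_eq
    rw [h2] at this
    simpa using this.symm
  exact ⟨key _ rfl, key _ rfl⟩

/-- The constant field B₀ has ε = 0 and zero derivatives, so the general relations for normal fields
lose all terms but those with the factor ⟨B₀, f_z⟩. That factor is not zero, since B₀ would
otherwise vanish. -/
theorem structureA_rigid {p : R3} (hp : p ∈ U) :
    ⟪B₀, dZ f p⟫_ℝ ≠ 0 ∧ ⟪B₀, N p⟫_ℝ = -(deriv mu p.2.2 * invFactor P p * ⟪B₀, dZ f p⟫_ℝ) ∧
    dX (invFactor P) p = 0 ∧ dY (invFactor P) p = 0 ∧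
    dZ (invFactor P) p = deriv mu p.2.2 * κ₃ p ∧
    deriv (deriv mu) p.2.2 * invFactor P p = κ₃ p * (1 + deriv mu p.2.2 ^ 2) := by
  have hF : ContDiffOn ℝ ∞ (fun _ : R3 => B₀) U := contDiffOn_const
  have h0 : ∀ (v p : R3), pd v (fun _ : R3 => B₀) p = 0 := fun v p => (HasPartial.const B₀).pd_eq
  have hx : ∀ p ∈ U, ⟪(fun _ : R3 => B₀) p, dX f p⟫_ℝ = 0 := fun p hp => (H.structureA_orth hA hp).1
  have hy : ∀ p ∈ U, ⟪(fun _ : R3 => B₀) p, dY f p⟫_ℝ = 0 := fun p hp => (H.structureA_orth hA hp).2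
  have hxx : ∀ p ∈ U, ⟪dX (fun _ : R3 => B₀) p, dX f p⟫_ℝ =
      0 * (P p ^ 2 * Real.cos (angle lam mu p) ^ 2) := fun p _ => by
    rw [show dX (fun _ : R3 => B₀) p = 0 from h0 _ p, inner_zero_left, zero_mul]
  have hyy : ∀ p ∈ U, ⟪dY (fun _ : R3 => B₀) p, dY f p⟫_ℝ =
      0 * (P p ^ 2 * Real.sin (angle lam mu p) ^ 2) := fun p _ => by
    rw [show dY (fun _ : R3 => B₀) p = 0 from h0 _ p, inner_zero_left, zero_mul]
  obtain ⟨e1, e2⟩ := H.field_normal_and_curvature hF hx hy hxx hyy hp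
  obtain ⟨e3, e4, e5⟩ := H.field_deriv_z hF hx hy hxx hyy hp
  rw [show dZ (fun _ : R3 => B₀) p = 0 from h0 _ p] at e3 e4 e5
  simp only [inner_zero_left] at e3 e4 e5
  have hu := (H.u_pos hp).ne'
  have hX : ⟪B₀, dZ f p⟫_ℝ ≠ 0 := fun h => by
    have := H.norm_sq_of_orthogonal hp (hx p hp) (hy p hp)
    simp only [e1, h, hA.1] at this
    norm_num at this
  refine ⟨hX, e1, ?_, ?_, ?_, ?_⟩
  · have := div_eq_zero_iff.1 e3.symm
    simpa [hu, hX] using this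
  · have := div_eq_zero_iff.1 e4.symm
    simpa [hu, hX] using this
  · have : dZ (invFactor P) p - deriv mu p.2.2 * κ₃ p = 0 := by
      simpa [hu, hX] using e2
    linarith
  · have : deriv (deriv mu) p.2.2 * invFactor P p - κ₃ p - deriv mu p.2.2 ^ 2 * κ₃ p = 0 := by
      simpa [hX] using e5
    linarith

/-- In structure (a), `P⁻¹ + i κ₃ = C e^{-i μ}` with a real constant `C`. -/
theorem structureA_exists (h1 : c₁ ≠ 0) (hne : U.Nonempty) : ∃ C : ℝ, C ≠ 0 ∧ ∀ p ∈ U,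
    invFactor P p = C * Real.cos (mu p.2.2) ∧ κ₃ p = -(C * Real.sin (mu p.2.2)) ∧
    1 + deriv mu p.2.2 ^ 2 = c₁ ^ 2 * Real.cos (mu p.2.2) ^ 2 := by
  obtain ⟨p₀, hp₀⟩ := hne
  have key : ∀ p ∈ U,
      κ₃ p * Real.cos (mu p.2.2) + invFactor P p * Real.sin (mu p.2.2) = 0 ∧
      (1 + deriv mu p.2.2 ^ 2) * (invFactor P p * Real.cos (mu p.2.2) -
        κ₃ p * Real.sin (mu p.2.2)) ^ 2 = c₁ ^ 2 * invFactor P p ^ 2 := by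
    intro p hp
    obtain ⟨-, -, -, -, e3, e4⟩ := H.structureA_rigid hA hp
    have D := H.gauss_xy_of_const (fun q hq => (H.structureA_rigid hA hq).2.2.1)
      (fun q hq => (H.structureA_rigid hA hq).2.2.2.1) hp (by rw [e4, e3]; ring)
    have hu := H.u_pos hp
    have hm := H.mu_snd _ (mem_zProj hp)
    rw [hm] at e4
    rw [e3] at D
    have hsc := Real.sin_sq_add_cos_sq (mu p.2.2)
    set s := Real.sin (mu p.2.2)
    set c := Real.cos (mu p.2.2)
    set u := invFactor P p
    set a := deriv mu p.2.2
    -- R + iI = w e^{iμ}. The Gauss equation and the formula for μ'' combine to (1 + μ'²)(R + iI)² =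
    -- c₁²u², which is real and positive; hence I = 0.
    set R := u * c - κ₃ p * s with hR
    set I := κ₃ p * c + u * s with hI
    have hRI : R * I = 0 := by
      have : (1 + a ^ 2) * (R * I) = 0 := by
        rw [hR, hI]
        linear_combination (c * s) * D - (u * (c ^ 2 - s ^ 2)) * e4
      exact (mul_eq_zero.1 this).resolve_left (by positivity)
    have hsq : (1 + a ^ 2) * (R ^ 2 - I ^ 2) = c₁ ^ 2 * u ^ 2 := by
      rw [hR, hI]
      linear_combination (c ^ 2 - s ^ 2) * D + 4 * u * s * c * e4 +
        c₁ ^ 2 * u ^ 2 * (s ^ 2 + c ^ 2 + 1) * hsc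
    have hpos : 0 < c₁ ^ 2 * u ^ 2 := by positivity
    have hI0 : I = 0 := by
      refine (mul_eq_zero.1 hRI).resolve_left fun h => ?_
      rw [h] at hsq
      nlinarith [sq_nonneg I, sq_nonneg a, mul_nonneg (sq_nonneg a) (sq_nonneg I)]
    refine ⟨hI0, ?_⟩
    rw [hI0] at hsq
    linarith
  -- The equations u_z = μ'k and k_z = -μ'u say w_z = -iμ'w, so w e^{iμ} does not change with z; its
  -- (x, y)-derivatives vanish with those of u and k.
  have hconst : ∀ p ∈ U, invFactor P p * Real.cos (mu p.2.2) - κ₃ p * Real.sin (mu p.2.2) =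
      invFactor P p₀ * Real.cos (mu p₀.2.2) - κ₃ p₀ * Real.sin (mu p₀.2.2) := by
    intro p hp
    have hpart : ∀ q ∈ U, ∀ v, HasPartial v
        (fun q => invFactor P q * Real.cos (mu q.2.2) - κ₃ q * Real.sin (mu q.2.2)) _ q :=
      fun q hq v => ((H.hasPartial_u hq v).mul (H.hasPartial_mu hq v).cos).sub
        ((H.hasPartial_k hq v).mul (H.hasPartial_mu hq v).sin)
    refine eq_of_partials_eq_zero H.isOpen H.conn (fun q hq => (hpart q hq 0).1)
      (fun q hq => ?_) (fun q hq => ?_) (fun q hq => ?_) hp hp₀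
    · refine (hpart q hq _).pd_eq.trans ?_
      obtain ⟨-, -, e1, e2, -, -⟩ := H.structureA_rigid hA hq
      obtain ⟨k1, k2⟩ := H.partials_k_of_const hq e1 e2
      change dX (invFactor P) q * _ + _ - (dX κ₃ q * _ + _) = 0
      rw [e1, k1]; simp
    · refine (hpart q hq _).pd_eq.trans ?_
      obtain ⟨-, -, e1, e2, -, -⟩ := H.structureA_rigid hA hq
      obtain ⟨k1, k2⟩ := H.partials_k_of_const hq e1 e2
      change dY (invFactor P) q * _ + _ - (dY κ₃ q * _ + _) = 0
      rw [e2, k2]; simp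
    · refine (hpart q hq _).pd_eq.trans ?_
      obtain ⟨-, -, -, -, e3, -⟩ := H.structureA_rigid hA hq
      change dZ (invFactor P) q * _ + _ - (dZ κ₃ q * _ + _) = 0
      rw [e3, H.codazzi_z hq]; ring
  refine ⟨invFactor P p₀ * Real.cos (mu p₀.2.2) - κ₃ p₀ * Real.sin (mu p₀.2.2), ?_,
    fun p hp => ?_⟩
  rotate_left
  · obtain ⟨e1, e2⟩ := key p hp
    have hc := hconst p hp
    have hsc := Real.sin_sq_add_cos_sq (mu p.2.2)
    have hu := (H.u_pos hp).ne'
    have e3 : invFactor P p = (invFactor P p * Real.cos (mu p.2.2) - κ₃ p * Real.sin (mu p.2.2)) *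
        Real.cos (mu p.2.2) := by
      linear_combination Real.sin (mu p.2.2) * e1 - invFactor P p * hsc
    refine ⟨hc ▸ e3, ?_, ?_⟩
    · rw [← hc]
      linear_combination Real.cos (mu p.2.2) * e1 - κ₃ p * hsc
    · have hR : invFactor P p * Real.cos (mu p.2.2) - κ₃ p * Real.sin (mu p.2.2) ≠ 0 :=
        fun h => hu (by rw [e3, h, zero_mul])
      refine mul_right_cancel₀ (pow_ne_zero 2 hR) ?_
      rw [e2]
      nth_rw 1 [e3]
      ring
  · intro h
    obtain ⟨e1, -⟩ := key p₀ hp₀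
    have hsc := Real.sin_sq_add_cos_sq (mu p₀.2.2)
    have hu := (H.u_pos hp₀).ne'
    apply hu
    linear_combination Real.sin (mu p₀.2.2) * e1 - invFactor P p₀ * hsc +
      Real.cos (mu p₀.2.2) * h

/-- From w = C e^{-iμ} one gets -e^{iφ} w²/|w|² = -e^{i(λ - μ)}, and a shift of λ by either of ±π
produces the sign. -/
theorem structureA_isDualAngle (h1 : c₁ ≠ 0) (hne : U.Nonempty) {ε : ℝ} (hε : ε = 1 ∨ ε = -1) :
    IsDualAngle U (angle lam mu) κ₁ κ₂ κ₃
      (angle (fun q => lam q + ε * Real.pi) (fun z => -mu z)) := by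
  obtain ⟨C, -, hC⟩ := H.structureA_exists hA h1 hne
  have hcos : ∀ x, Real.cos (x + ε * Real.pi) = -Real.cos x := fun x => by
    rcases hε with rfl | rfl
    · rw [one_mul, Real.cos_add_pi]
    · rw [neg_one_mul, ← sub_eq_add_neg, Real.cos_sub_pi]
  have hsin : ∀ x, Real.sin (x + ε * Real.pi) = -Real.sin x := fun x => by
    rcases hε with rfl | rfl
    · rw [one_mul, Real.sin_add_pi]
    · rw [neg_one_mul, ← sub_eq_add_neg, Real.sin_sub_pi]
  have ha : ∀ p, angle (fun q => lam q + ε * Real.pi) (fun z => -mu z) p =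
      angle lam mu p - 2 * mu p.2.2 + ε * Real.pi := fun p => by simp [angle]; ring
  refine H.isDualAngle_of (fun p hp => ?_) fun p hp => ?_
  · obtain ⟨e1, e2, -⟩ := hC p hp
    rw [ha, hcos, Real.cos_sub, Real.sin_two_mul, Real.cos_two_mul', e1, e2]
    have hsc := Real.sin_sq_add_cos_sq (mu p.2.2)
    linear_combination (-C ^ 2) * (Real.cos (angle lam mu p) *
      (Real.cos (mu p.2.2) ^ 2 - Real.sin (mu p.2.2) ^ 2) + Real.sin (angle lam mu p) *
      (2 * Real.sin (mu p.2.2) * Real.cos (mu p.2.2))) * hsc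
  · obtain ⟨e1, e2, -⟩ := hC p hp
    rw [ha, hsin, Real.sin_sub, Real.sin_two_mul, Real.cos_two_mul', e1, e2]
    have hsc := Real.sin_sq_add_cos_sq (mu p.2.2)
    linear_combination (-C ^ 2) * (Real.sin (angle lam mu p) *
      (Real.cos (mu p.2.2) ^ 2 - Real.sin (mu p.2.2) ^ 2) - Real.cos (angle lam mu p) *
      (2 * Real.sin (mu p.2.2) * Real.cos (mu p.2.2))) * hsc

end StructureA

end Setting

theorem exists_eq_const_of_partials {U : Set R3} {F : Type*} [NormedAddCommGroup F]
    [NormedSpace ℝ F] (hU : IsOpen U) (hc : IsPreconnected U)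
    {g gx gy gz : R3 → F} (hx : ∀ p ∈ U, HasPartial (1, 0, 0) g (gx p) p)
    (hy : ∀ p ∈ U, HasPartial (0, 1, 0) g (gy p) p)
    (hz : ∀ p ∈ U, HasPartial (0, 0, 1) g (gz p) p)
    (ex : ∀ p ∈ U, gx p = 0) (ey : ∀ p ∈ U, gy p = 0) (ez : ∀ p ∈ U, gz p = 0) :
    ∃ v : F, ∀ p ∈ U, g p = v := by
  rcases U.eq_empty_or_nonempty with rfl | ⟨p₀, hp₀⟩
  · exact ⟨0, fun p hp => hp.elim⟩
  · exact ⟨g p₀, fun p hp => eq_of_partials_eq_zero hU hc (fun q hq => (hx q hq).1)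
      (fun q hq => (hx q hq).pd_eq.trans (ex q hq)) (fun q hq => (hy q hq).pd_eq.trans (ey q hq))
      (fun q hq => (hz q hq).pd_eq.trans (ez q hq)) hp hp₀⟩

theorem StructureA.smul_sign {U : Set R3} {B₀ : E4} {f : R3 → E4} (h : StructureA U B₀ f) {s : ℝ}
    (hs : s = 1 ∨ s = -1) : StructureA U (s • B₀) f := by
  obtain ⟨h1, g, hg⟩ := h
  refine ⟨?_, fun z => s * g z, fun p hp => ?_⟩
  · rw [norm_smul, h1, mul_one]; rcases hs with rfl | rfl <;> simp
  · rw [inner_smul_left, hg p hp]; simp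

/-! ### Structure (a): the dual in closed form -/

namespace Setting

variable {U : Set R3} {lam : ℝ × ℝ → ℝ} {mu : ℝ → ℝ} {c₁ : ℝ} {P κ₁ κ₂ κ₃ : R3 → ℝ}
  {f N : R3 → E4} (H : Setting U lam mu c₁ P κ₁ κ₂ κ₃ f N)

include H

theorem hasPartial_dual {fs : R3 → E4} (hfs : IsDual U f κ₁ κ₂ κ₃ fs) {p : R3} (hp : p ∈ U) :
    HasPartial (1, 0, 0) fs (sigma₁ κ₁ κ₂ κ₃ p • dX f p) p ∧
    HasPartial (0, 1, 0) fs (sigma₂ κ₁ κ₂ κ₃ p • dY f p) p ∧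
    HasPartial (0, 0, 1) fs (sigma₃ κ₁ κ₂ κ₃ p • dZ f p) p := by
  obtain ⟨h1, h2, h3⟩ := dual_partials hfs hp
  have hs := H.smooth_dual hfs
  exact ⟨(HasPartial.of_contDiffOn H.isOpen hs hp _).eq h1,
    (HasPartial.of_contDiffOn H.isOpen hs hp _).eq h2,
    (HasPartial.of_contDiffOn H.isOpen hs hp _).eq h3⟩

theorem hasPartial_f_xyz {p : R3} (hp : p ∈ U) :
    HasPartial (1, 0, 0) f (dX f p) p ∧ HasPartial (0, 1, 0) f (dY f p) p ∧
    HasPartial (0, 0, 1) f (dZ f p) p :=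
  ⟨H.hasPartial_f hp _, H.hasPartial_f hp _, H.hasPartial_f hp _⟩

theorem hasPartial_N_xyz {p : R3} (hp : p ∈ U) :
    HasPartial (1, 0, 0) N (-(κ₁ p • dX f p)) p ∧ HasPartial (0, 1, 0) N (-(κ₂ p • dY f p)) p ∧
    HasPartial (0, 0, 1) N (-(κ₃ p • dZ f p)) p :=
  ⟨(H.hasPartial_N hp _).eq (H.hyp.weingarten_x p hp),
    (H.hasPartial_N hp _).eq (H.hyp.weingarten_y p hp),
    (H.hasPartial_N hp _).eq (H.hyp.weingarten_z p hp)⟩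

theorem vecA_eq {p : R3} (hp : p ∈ U) : vecA (angle lam mu) P f N p =
    -(invFactor P p • dZ f p) + deriv mu p.2.2 • N p := by
  rw [vecA, Xγ, show dZ (angle lam mu) p = deriv mu p.2.2 from (H.hasPartial_angle_z hp).pd_eq]
  rfl

section StructureA

variable {B₀ : E4} (hA : StructureA U B₀ f) (h1 : c₁ ≠ 0) (hne : U.Nonempty)
  {fs : R3 → E4} (hfs : IsDual U f κ₁ κ₂ κ₃ fs)

include hA h1 hne hfs

/-- Here σ₃ is the constant C²/2 and B₀ is orthogonal to f_x and f_y, so the differential of ⟨B₀,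
f*⟩ is C²/2 times that of ⟨B₀, f⟩. -/
theorem structureA_dual : StructureA U B₀ fs := by
  obtain ⟨C, -, hC⟩ := H.structureA_exists hA h1 hne
  obtain ⟨v, hv⟩ := exists_eq_const_of_partials H.isOpen H.conn
    (fun p hp => ((HasPartial.const B₀).inner (H.hasPartial_dual hfs hp).1).sub
      ((HasPartial.const (C ^ 2 / 2)).mul
        ((HasPartial.const B₀).inner (H.hasPartial_f_xyz hp).1)))
    (fun p hp => ((HasPartial.const B₀).inner (H.hasPartial_dual hfs hp).2.1).sub
      ((HasPartial.const (C ^ 2 / 2)).mul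
        ((HasPartial.const B₀).inner (H.hasPartial_f_xyz hp).2.1)))
    (fun p hp => ((HasPartial.const B₀).inner (H.hasPartial_dual hfs hp).2.2).sub
      ((HasPartial.const (C ^ 2 / 2)).mul
        ((HasPartial.const B₀).inner (H.hasPartial_f_xyz hp).2.2)))
    (fun p hp => by simp [inner_smul_right, (H.structureA_orth hA hp).1])
    (fun p hp => by simp [inner_smul_right, (H.structureA_orth hA hp).2])
    (fun p hp => by
      obtain ⟨e1, e2, -⟩ := hC p hp
      have hsc := Real.sin_sq_add_cos_sq (mu p.2.2)
      rw [H.sigma₃_eq hp, e1, e2]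
      simp only [inner_smul_right, inner_zero_left, zero_mul, zero_add]
      linear_combination C ^ 2 / 2 * ⟪B₀, dZ f p⟫_ℝ * hsc)
  obtain ⟨hB, h, hh⟩ := hA
  refine ⟨hB, fun z => C ^ 2 / 2 * h z + v, fun p hp => ?_⟩
  have := hv p hp
  simp only [hh p hp] at this
  linarith

omit h1 hne hfs in
/-- The common normal of the hyperplanes of structure (a), with the sign given by `-A`. -/
theorem structureA_normal : ∃ s : ℝ, (s = 1 ∨ s = -1) ∧ ∀ p ∈ U,
    vecA (angle lam mu) P f N p = -(Real.sqrt (1 + deriv mu p.2.2 ^ 2) • s • B₀) := by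
  -- The condition ‖B₀‖ = 1 makes this product ±1. Its sign is constant by connectedness and decides
  -- whether B₀ or -B₀ is the normal -A/√(1 + μ'²).
  have hsq : ∀ p ∈ U, (Real.sqrt (1 + deriv mu p.2.2 ^ 2) *
      (invFactor P p * ⟪B₀, dZ f p⟫_ℝ)) ^ 2 = 1 := fun p hp => by
    obtain ⟨ox, oy⟩ := H.structureA_orth hA hp
    obtain ⟨-, e1, -⟩ := H.structureA_rigid hA hp
    have := H.norm_sq_of_orthogonal hp ox oy
    rw [hA.1, e1] at this
    rw [mul_pow, Real.sq_sqrt (by positivity)]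
    linarith
  have hcont : ContinuousOn (fun p : R3 => Real.sqrt (1 + deriv mu p.2.2 ^ 2) *
      (invFactor P p * ⟪B₀, dZ f p⟫_ℝ)) U := by
    have c1 := (contDiffOn_comp_z (contDiffOn_deriv H.isOpen_J H.smooth_mu)).continuousOn
    have c2 : ContinuousOn (fun p => ⟪B₀, dZ f p⟫_ℝ) U :=
      (contDiffOn_const.inner ℝ (contDiffOn_pd H.isOpen H.hyp.smooth_f (0, 0, 1))).continuousOn
    exact (continuousOn_const.add (c1.pow 2)).sqrt.mul (H.smooth_u.continuousOn.mul c2)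
  obtain ⟨s, hs, hsU⟩ : ∃ s : ℝ, (s = 1 ∨ s = -1) ∧ ∀ p ∈ U,
      Real.sqrt (1 + deriv mu p.2.2 ^ 2) * (invFactor P p * ⟪B₀, dZ f p⟫_ℝ) = s := by
    rcases eq_or_eq_of_isPreconnected H.conn hcont (fun p hp => mul_self_eq_one_iff.1 ((sq _).symm.trans (hsq p hp)))
      with h | h
    · exact ⟨1, Or.inl rfl, h⟩
    · exact ⟨-1, Or.inr rfl, h⟩
  refine ⟨s, hs, fun p hp => ?_⟩
  obtain ⟨ox, oy⟩ := H.structureA_orth hA hp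
  obtain ⟨-, e1, -⟩ := H.structureA_rigid hA hp
  have hB := H.eq_of_orthogonal hp ox oy
  have h3 := hsU p hp
  have h4 := hsq p hp
  have h5 : B₀ = (invFactor P p * ⟪B₀, dZ f p⟫_ℝ) •
      (invFactor P p • dZ f p - deriv mu p.2.2 • N p) := by
    nth_rw 1 [hB]
    rw [e1, smul_sub, smul_smul, smul_smul, sub_eq_add_neg, ← neg_smul]
    congr 2 <;> ring
  rw [H.vecA_eq hp]
  have h6 : Real.sqrt (1 + deriv mu p.2.2 ^ 2) • s • B₀ =
      invFactor P p • dZ f p - deriv mu p.2.2 • N p := by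
    nth_rw 1 [h5]
    rw [← h3, smul_smul, smul_smul]
    convert one_smul ℝ _ using 2
    linarith
  rw [h6]
  abel

/-- Now κ₃ = 0 and u = C, so S has eigenvalues -C²/2, -C²/2, C²/2. As f_z = C⁻¹B is constant, f* is,
up to translation, C²/2 times the reflection of f in the line spanned by B; this is also the
conformal equivalence. -/
theorem structureA_dual_of_mu_eq_zero (h0 : ∀ z ∈ zProj U, mu z = 0) :
    ConformallyEquivalentOn U f fs ∧
      ∃ (B : E4) (P₀ t : ℝ) (f₁ : ℝ × ℝ → E4) (v : E4),
        ‖B‖ = 1 ∧ 0 < P₀ ∧ (∀ p ∈ U, P p = P₀ ∧ Xγ P f p = B) ∧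
        (∀ q ∈ xyProj U, inner ℝ B (f₁ q) = 0) ∧
        (∀ p ∈ U, f p = f₁ (p.1, p.2.1) + (P₀ * p.2.2 + t) • B) ∧
        StructureA U B f ∧ StructureA U B fs ∧
        ∀ p ∈ U, fs p - v = ((P₀⁻¹) ^ 2 / 2) • (-f₁ (p.1, p.2.1) + (P₀ * p.2.2) • B) := by
  have hAs := H.structureA_dual hA h1 hne hfs
  obtain ⟨C, hC0, hC⟩ := H.structureA_exists hA h1 hne
  obtain ⟨s, hs, hsA⟩ := H.structureA_normal hA
  have hder : ∀ z ∈ zProj U, deriv mu z = 0 := fun z hz => deriv_eq_zero_of_eq_zero H.isOpen_J h0 hz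
  have hu : ∀ p ∈ U, invFactor P p = C ∧ κ₃ p = 0 := fun p hp => by
    obtain ⟨e1, e2, -⟩ := hC p hp
    rw [h0 _ (mem_zProj hp)] at e1 e2
    exact ⟨by simpa using e1, by simpa using e2⟩
  have hCpos : 0 < C := by
    obtain ⟨p, hp⟩ := hne
    rw [← (hu p hp).1]; exact H.u_pos hp
  set B := s • B₀ with hB
  have hBA : StructureA U B f := hA.smul_sign hs
  have hX : ∀ p ∈ U, dZ f p = C⁻¹ • B := fun p hp => by
    have h2 := hsA p hp
    rw [H.vecA_eq hp, hder _ (mem_zProj hp), (hu p hp).1] at h2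
    have h3 : C • dZ f p = B := by simpa using h2
    rw [← h3, smul_smul, inv_mul_cancel₀ hC0, one_smul]
  have hBn : ⟪B, B⟫_ℝ = 1 := by rw [real_inner_self_eq_norm_sq, hBA.1]; norm_num
  have hz : ∀ p ∈ U, HasPartial (0, 0, 1) (fun r : R3 => C⁻¹ * r.2.2) C⁻¹ p := fun p hp =>
    ((HasPartial.const C⁻¹).mul (HasPartial.comp_z (hasDerivAt_id _) _)).eq (by simp)
  obtain ⟨t, ht⟩ := exists_eq_const_of_partials H.isOpen H.conn
    (g := fun p => ⟪B, f p⟫_ℝ - C⁻¹ * p.2.2)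
    (fun p hp => ((HasPartial.const B).inner (H.hasPartial_f_xyz hp).1).sub
      ((HasPartial.const C⁻¹).mul (HasPartial.comp_z (hasDerivAt_id _) _)))
    (fun p hp => ((HasPartial.const B).inner (H.hasPartial_f_xyz hp).2.1).sub
      ((HasPartial.const C⁻¹).mul (HasPartial.comp_z (hasDerivAt_id _) _)))
    (fun p hp => ((HasPartial.const B).inner (H.hasPartial_f_xyz hp).2.2).sub (hz p hp))
    (fun p hp => by simp [(H.structureA_orth hBA hp).1])
    (fun p hp => by simp [(H.structureA_orth hBA hp).2])
    (fun p hp => by simp [hX p hp, inner_smul_right, hBA.1])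
  have hsm : ContDiffOn ℝ ∞ (fun p : R3 => f p - (C⁻¹ * p.2.2 + t) • B) U :=
    H.hyp.smooth_f.sub (by fun_prop)
  obtain ⟨f₁, -, hf₁⟩ := exists_eq_comp_xy H.isOpen H.fib hsm fun p hp => by
    refine (((H.hasPartial_f_xyz hp).2.2).sub (((hz p hp).add (.const t)).smul
      (HasPartial.const B))).pd_eq.trans ?_
    rw [hX p hp]; simp
  have hf : ∀ p ∈ U, f p = f₁ (p.1, p.2.1) + (C⁻¹ * p.2.2 + t) • B := fun p hp => by
    rw [← hf₁ p hp]; abel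
  have hperp : ∀ q ∈ xyProj U, ⟪B, f₁ q⟫_ℝ = 0 := by
    rintro _ ⟨p, hp, rfl⟩
    have := ht p hp
    rw [← hf₁ p hp, inner_sub_right, inner_smul_right, hBn]
    linarith
  have hσ : ∀ p ∈ U, sigma₁ κ₁ κ₂ κ₃ p = -(C ^ 2 / 2) ∧ sigma₂ κ₁ κ₂ κ₃ p = -(C ^ 2 / 2) ∧
      sigma₃ κ₁ κ₂ κ₃ p = C ^ 2 / 2 := fun p hp => by
    obtain ⟨e1, e2⟩ := hu p hp
    rw [H.sigma₁_eq hp, H.sigma₂_eq hp, H.sigma₃_eq hp, e1, e2]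
    refine ⟨?_, ?_, ?_⟩ <;> ring
  obtain ⟨v, hv⟩ := exists_eq_const_of_partials H.isOpen H.conn
    (g := fun p => fs p - (C ^ 2 / 2) • ((2 * (C⁻¹ * p.2.2)) • B - f p))
    (fun p hp => (H.hasPartial_dual hfs hp).1.sub ((HasPartial.const (C ^ 2 / 2)).smul
      ((((HasPartial.const 2).mul
      ((HasPartial.const C⁻¹).mul (HasPartial.comp_z (hasDerivAt_id _) _))).smul
      (HasPartial.const B)).sub (H.hasPartial_f_xyz hp).1)))
    (fun p hp => (H.hasPartial_dual hfs hp).2.1.sub ((HasPartial.const (C ^ 2 / 2)).smul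
      ((((HasPartial.const 2).mul
      ((HasPartial.const C⁻¹).mul (HasPartial.comp_z (hasDerivAt_id _) _))).smul
      (HasPartial.const B)).sub (H.hasPartial_f_xyz hp).2.1)))
    (fun p hp => (H.hasPartial_dual hfs hp).2.2.sub ((HasPartial.const (C ^ 2 / 2)).smul
      ((((HasPartial.const 2).mul (hz p hp)).smul
      (HasPartial.const B)).sub (H.hasPartial_f_xyz hp).2.2)))
    (fun p hp => by rw [(hσ p hp).1]; simp)
    (fun p hp => by rw [(hσ p hp).2.1]; simp)
    (fun p hp => by rw [(hσ p hp).2.2, hX p hp]; module)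
  -- The translation along B is adjusted because the height t of f does not appear in the normalised
  -- dual.
  have hfin : ∀ p ∈ U, fs p - (v - (C ^ 2 / 2 * t) • B) =
      (C ^ 2 / 2) • (-f₁ (p.1, p.2.1) + (C⁻¹ * p.2.2) • B) := fun p hp => by
    have e := hv p hp
    rw [sub_eq_iff_eq_add.1 e, hf p hp]; module
  refine ⟨⟨(Submodule.span ℝ {B}).reflection, C ^ 2 / 2, v - (C ^ 2 * t) • B, by positivity,
    Or.inl fun p hp => ?_⟩, B, C⁻¹, t, f₁, v - (C ^ 2 / 2 * t) • B, hBA.1, inv_pos.2 hCpos,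
    fun p hp => ⟨?_, ?_⟩, hperp, hf, hBA, hAs.smul_sign hs, fun p hp => ?_⟩
  · have e : (Submodule.span ℝ {B}).reflection (f p) =
        -f₁ (p.1, p.2.1) + (C⁻¹ * p.2.2 + t) • B := by
      have hin : ⟪B, f p⟫_ℝ = C⁻¹ * p.2.2 + t := by
        have := ht p hp; linarith
      rw [Submodule.reflection_singleton_apply, hin, hBA.1, hf p hp]
      norm_num
      module
    rw [e, sub_eq_iff_eq_add.1 (hfin p hp)]
    module
  · rw [← (hu p hp).1, invFactor, inv_inv]
  · have e : (P p)⁻¹ = C := (hu p hp).1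
    rw [Xγ, hX p hp, e, smul_smul, mul_inv_cancel₀ hC0, one_smul]
  · rw [inv_inv]; exact hfin p hp

/-- The function f* + (C²/2) f + κ₃N has no x- and y-derivatives, by σ₁ + σ₃ = κ₃κ₁ and σ₂ + σ₃ =
κ₃κ₂ with σ₃ = C²/2. Its z-derivative is u(u f_z - μ'N) = u√(1 + μ'²) B, and q integrates the
coefficient. -/
theorem structureA_dual_of_mu_ne_zero : ∃ (B : E4) (C : ℝ) (q : ℝ → ℝ) (v : E4),
    StructureA U B f ∧ StructureA U B fs ∧ C ≠ 0 ∧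
    (∀ p ∈ U, vecA (angle lam mu) P f N p = -(Real.sqrt (1 + deriv mu p.2.2 ^ 2) • B)) ∧
    (∀ p ∈ U, (P p)⁻¹ = C * Real.cos (mu p.2.2) ∧ κ₃ p = -(C * Real.sin (mu p.2.2))) ∧
    (∀ p ∈ U, HasDerivAt q ((P p)⁻¹ * Real.sqrt (1 + deriv mu p.2.2 ^ 2)) p.2.2) ∧
    ((∀ z ∈ zProj U, 0 < c₁ * Real.cos (mu z)) →
      ∀ z ∈ zProj U, deriv q z = C * c₁ * Real.cos (mu z) ^ 2) ∧
    ∀ p ∈ U, fs p - v = -((C ^ 2 / 2) • f p) - κ₃ p • N p + q p.2.2 • B := by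
  have hAs := H.structureA_dual hA h1 hne hfs
  obtain ⟨C, hC0, hC⟩ := H.structureA_exists hA h1 hne
  obtain ⟨s, hs, hsA⟩ := H.structureA_normal hA
  set B := s • B₀ with hB
  have hcont : ContinuousOn (fun z => C * Real.cos (mu z) * Real.sqrt (1 + deriv mu z ^ 2))
      (zProj U) :=
    (continuousOn_const.mul (Real.continuous_cos.comp_continuousOn H.smooth_mu.continuousOn)).mul
      (continuousOn_const.add
        ((contDiffOn_deriv H.isOpen_J H.smooth_mu).continuousOn.pow 2)).sqrt
  obtain ⟨q, hq⟩ := exists_hasDerivAt H.isOpen_J (isPreconnected_zProj H.conn) hcont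
  have hq' : ∀ p ∈ U, HasDerivAt q (invFactor P p * Real.sqrt (1 + deriv mu p.2.2 ^ 2)) p.2.2 :=
    fun p hp => by rw [(hC p hp).1]; exact hq _ (mem_zProj hp)
  have hσ : ∀ p ∈ U, sigma₃ κ₁ κ₂ κ₃ p = C ^ 2 / 2 := fun p hp => by
    obtain ⟨e1, e2, -⟩ := hC p hp
    have hsc := Real.sin_sq_add_cos_sq (mu p.2.2)
    rw [H.sigma₃_eq hp, e1, e2]
    linear_combination C ^ 2 / 2 * hsc
  have hk : ∀ p ∈ U, dX κ₃ p = 0 ∧ dY κ₃ p = 0 := fun p hp =>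
    have h := H.structureA_rigid hA hp
    H.partials_k_of_const hp h.2.2.1 h.2.2.2.1
  have hpart : ∀ p ∈ U, ∀ (w : R3) {a b n : E4} {k : ℝ}, HasPartial w fs a p →
      HasPartial w f b p → HasPartial w N n p → HasPartial w κ₃ k p →
      HasPartial w (fun p => fs p - (-((C ^ 2 / 2) • f p) - κ₃ p • N p + q p.2.2 • B))
        (a + (C ^ 2 / 2) • b + (k • N p + κ₃ p • n) -
          (w.2.2 * (invFactor P p * Real.sqrt (1 + deriv mu p.2.2 ^ 2))) • B) p := by
    intro p hp w a b n k ha hb hn hk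
    refine (ha.sub ((((HasPartial.const (C ^ 2 / 2)).smul hb).neg.sub (hk.smul hn)).add
      ((HasPartial.comp_z (hq' p hp) w).smul (HasPartial.const B)))).eq ?_
    simp only [zero_smul, smul_zero, smul_eq_mul]
    module
  obtain ⟨v, hv⟩ := exists_eq_const_of_partials H.isOpen H.conn
    (fun p hp => hpart p hp (1, 0, 0) (H.hasPartial_dual hfs hp).1 (H.hasPartial_f_xyz hp).1
      (H.hasPartial_N_xyz hp).1 (H.hasPartial_k hp _))
    (fun p hp => hpart p hp (0, 1, 0) (H.hasPartial_dual hfs hp).2.1 (H.hasPartial_f_xyz hp).2.1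
      (H.hasPartial_N_xyz hp).2.1 (H.hasPartial_k hp _))
    (fun p hp => hpart p hp (0, 0, 1) (H.hasPartial_dual hfs hp).2.2 (H.hasPartial_f_xyz hp).2.2
      (H.hasPartial_N_xyz hp).2.2 (H.hasPartial_k hp _))
    (fun p hp => by
      rw [show pd (1, 0, 0) κ₃ p = 0 from (hk p hp).1,
        eq_sub_of_add_eq (sigma₁_add_sigma₃ (κ₁ := κ₁) (κ₂ := κ₂) (κ₃ := κ₃) p), hσ p hp]
      simp only [zero_mul]
      module)
    (fun p hp => by
      rw [show pd (0, 1, 0) κ₃ p = 0 from (hk p hp).2,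
        eq_sub_of_add_eq (sigma₂_add_sigma₃ (κ₁ := κ₁) (κ₂ := κ₂) (κ₃ := κ₃) p), hσ p hp]
      simp only [zero_mul]
      module)
    (fun p hp => by
      have h2 := hsA p hp
      rw [H.vecA_eq hp] at h2
      obtain ⟨e1, e2, -⟩ := hC p hp
      have hsc := Real.sin_sq_add_cos_sq (mu p.2.2)
      have e3 : C ^ 2 - κ₃ p ^ 2 = invFactor P p ^ 2 := by
        rw [e1, e2]; linear_combination (-C ^ 2) * hsc
      rw [show pd (0, 0, 1) κ₃ p = _ from H.codazzi_z hp, hσ p hp]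
      have h3 : (1 * (invFactor P p * Real.sqrt (1 + deriv mu p.2.2 ^ 2))) • B =
          invFactor P p • (invFactor P p • dZ f p - deriv mu p.2.2 • N p) := by
        rw [one_mul, mul_smul, ← neg_eq_iff_eq_neg.2 h2]
        module
      rw [h3]
      have h4 : (C ^ 2 / 2) • dZ f p + (C ^ 2 / 2) • dZ f p =
          (invFactor P p ^ 2 + κ₃ p ^ 2) • dZ f p := by
        rw [← e3]; module
      rw [h4]; module)
  refine ⟨B, C, q, v, hA.smul_sign hs, hAs.smul_sign hs, hC0, hsA,
    fun p hp => ⟨(hC p hp).1, (hC p hp).2.1⟩, hq', ?_, fun p hp => ?_⟩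
  · rintro hpos _ ⟨p, hp, rfl⟩
    have hz := mem_zProj hp
    rw [(hq _ hz).deriv, (hC p hp).2.2, ← mul_pow, Real.sqrt_sq (hpos _ hz).le]
    ring
  · rw [← hv p hp]; abel

end StructureA

end Setting

/-! ### Structure (c): rigidity and the formula for the dual -/

namespace Setting

variable {U : Set R3} {lam : ℝ × ℝ → ℝ} {mu : ℝ → ℝ} {c₁ : ℝ} {P κ₁ κ₂ κ₃ : R3 → ℝ}
  {f N : R3 → E4} (H : Setting U lam mu c₁ P κ₁ κ₂ κ₃ f N)

include H

section StructureC

variable (hC : StructureC U f)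

include hC

theorem structureC_orth {p : R3} (hp : p ∈ U) : ⟪f p, dX f p⟫_ℝ = 0 ∧ ⟪f p, dY f p⟫_ℝ = 0 := by
  obtain ⟨r, hr⟩ := hC
  have key : ∀ v : R3, v.2.2 = 0 → ⟪f p, pd v f p⟫_ℝ = 0 := fun v hv => by
    have h1 := (H.hasPartial_f hp v).inner (H.hasPartial_f hp v)
    have h2 := pd_eq_zero_of_eq_comp_z H.isOpen (g := fun q => ⟪f q, f q⟫_ℝ)
      (h := fun z => r z ^ 2) (fun q hq => by rw [real_inner_self_eq_norm_sq, (hr q hq).2])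
      hp h1.1 hv
    have h3 := h1.pd_eq
    rw [h2, real_inner_comm] at h3
    linarith
  exact ⟨key _ rfl, key _ rfl⟩

/-- The position vector itself is the normal field, with ε = 1. The relation u ⟨f, f_z⟩ K = 1 shows
that neither ⟨f, f_z⟩ nor K has a zero, and the z-derivatives then give u_x = u_y = 0 and the
equation for μ''. -/
theorem structureC_rigid {p : R3} (hp : p ∈ U) :
    invFactor P p * ⟪f p, dZ f p⟫_ℝ * (deriv mu p.2.2 * κ₃ p - dZ (invFactor P) p) = 1 ∧
    ⟪f p, N p⟫_ℝ = -(deriv mu p.2.2 * invFactor P p * ⟪f p, dZ f p⟫_ℝ) ∧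
    dX (invFactor P) p = 0 ∧ dY (invFactor P) p = 0 ∧
    deriv (deriv mu) p.2.2 * invFactor P p = κ₃ p + deriv mu p.2.2 * dZ (invFactor P) p := by
  have hx : ∀ p ∈ U, ⟪f p, dX f p⟫_ℝ = 0 := fun p hp => (H.structureC_orth hC hp).1
  have hy : ∀ p ∈ U, ⟪f p, dY f p⟫_ℝ = 0 := fun p hp => (H.structureC_orth hC hp).2
  have hxx : ∀ p ∈ U, ⟪dX f p, dX f p⟫_ℝ = 1 * (P p ^ 2 * Real.cos (angle lam mu p) ^ 2) :=
    fun p hp => by rw [one_mul, H.hyp.metric_xx p hp]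
  have hyy : ∀ p ∈ U, ⟪dY f p, dY f p⟫_ℝ = 1 * (P p ^ 2 * Real.sin (angle lam mu p) ^ 2) :=
    fun p hp => by rw [one_mul, H.hyp.metric_yy p hp]
  obtain ⟨e1, e2⟩ := H.field_normal_and_curvature H.hyp.smooth_f hx hy hxx hyy hp
  obtain ⟨e3, e4, e5⟩ := H.field_deriv_z H.hyp.smooth_f hx hy hxx hyy hp
  have hu := (H.u_pos hp).ne'
  have e0 : invFactor P p * ⟪f p, dZ f p⟫_ℝ * (deriv mu p.2.2 * κ₃ p - dZ (invFactor P) p) = 1 := by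
    linarith
  have hX : ⟪f p, dZ f p⟫_ℝ ≠ 0 := fun h => by rw [h] at e0; norm_num at e0
  rw [real_inner_comm, H.hyp.metric_xz p hp] at e3
  rw [real_inner_comm, H.hyp.metric_yz p hp] at e4
  rw [real_inner_comm, H.hyp.N_z p hp, H.hyp.metric_zz p hp] at e5
  have hP : P p = 1 / invFactor P p := by simp [invFactor]
  rw [hP] at e5
  refine ⟨e0, e1, ?_, ?_, ?_⟩
  · have := div_eq_zero_iff.1 e3.symm
    simpa [hu, hX] using this
  · have := div_eq_zero_iff.1 e4.symm
    simpa [hu, hX] using this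
  · refine mul_left_cancel₀ hX ?_
    field_simp at e5
    refine mul_left_cancel₀ hu ?_
    linear_combination e5 + deriv mu p.2.2 * e0

/-- The curvature function `K = μ' κ₃ - (P⁻¹)_z` is a constant multiple of `P⁻¹`. -/
theorem structureC_exists {c₂ : ℝ}
    (hmu : ∀ z ∈ zProj U, deriv mu z ^ 2 = c₂ ^ 2 - c₁ ^ 2 * Real.sin (mu z) ^ 2) :
    ∃ c : ℝ, c ≠ 0 ∧ ∀ p ∈ U,
      deriv mu p.2.2 * κ₃ p - dZ (invFactor P) p = c * invFactor P p := by
  rcases U.eq_empty_or_nonempty with rfl | ⟨p₀, hp₀⟩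
  · exact ⟨1, one_ne_zero, fun p hp => hp.elim⟩
  have hsq : ∀ p ∈ U, (deriv mu p.2.2 * κ₃ p - dZ (invFactor P) p) ^ 2 =
      (1 + c₂ ^ 2) * (1 + c₂ ^ 2 - c₁ ^ 2) * invFactor P p ^ 2 := by
    intro p hp
    obtain ⟨-, -, -, -, e⟩ := H.structureC_rigid hC hp
    have D := H.gauss_xy_of_const (fun q hq => (H.structureC_rigid hC hq).2.2.1)
      (fun q hq => (H.structureC_rigid hC hq).2.2.2.1) hp e
    have hm := H.mu_snd _ (mem_zProj hp)
    have ha := hmu _ (mem_zProj hp)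
    have hc : Real.cos (mu p.2.2) ^ 2 = 1 - Real.sin (mu p.2.2) ^ 2 := Real.cos_sq' _
    have e' : κ₃ p = deriv (deriv mu) p.2.2 * invFactor P p -
        deriv mu p.2.2 * dZ (invFactor P) p := by linarith
    -- Eliminating κ₃ from the Gauss equation shows that K²/u² equals the left side; the first
    -- integral for μ makes it constant. The sign of K/u is then fixed by connectedness.
    have s1 : (1 + deriv mu p.2.2 ^ 2) ^ 2 - deriv (deriv mu) p.2.2 ^ 2 - c₁ ^ 2 *
        (1 + deriv mu p.2.2 ^ 2) * (Real.cos (mu p.2.2) ^ 2 - Real.sin (mu p.2.2) ^ 2) =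
        (1 + c₂ ^ 2) * (1 + c₂ ^ 2 - c₁ ^ 2) := by
      have : deriv (deriv mu) p.2.2 ^ 2 =
          c₁ ^ 4 * Real.sin (mu p.2.2) ^ 2 * Real.cos (mu p.2.2) ^ 2 := by rw [hm]; ring
      rw [this, hc, ha]; ring
    rw [← s1, e']
    rw [e'] at D
    linear_combination (-(1 + deriv mu p.2.2 ^ 2)) * D
  have hK0 : ∀ p ∈ U, deriv mu p.2.2 * κ₃ p - dZ (invFactor P) p ≠ 0 := fun p hp h => by
    have := (H.structureC_rigid hC hp).1
    rw [h] at this; norm_num at this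
  have hcont : ContinuousOn (fun p : R3 =>
      (deriv mu p.2.2 * κ₃ p - dZ (invFactor P) p) / invFactor P p) U := by
    have c1 := (contDiffOn_comp_z (contDiffOn_deriv H.isOpen_J H.smooth_mu)).continuousOn
    exact ((c1.mul H.smooth_k.continuousOn).sub
      (contDiffOn_pd H.isOpen H.smooth_u (0, 0, 1)).continuousOn).div H.smooth_u.continuousOn
      fun p hp => (H.u_pos hp).ne'
  set c := (deriv mu p₀.2.2 * κ₃ p₀ - dZ (invFactor P) p₀) / invFactor P p₀ with hc
  have hc0 : c ≠ 0 := div_ne_zero (hK0 p₀ hp₀) (H.u_pos hp₀).ne'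
  have hall : ∀ p ∈ U, ((deriv mu p.2.2 * κ₃ p - dZ (invFactor P) p) / invFactor P p) ^ 2 =
      (1 + c₂ ^ 2) * (1 + c₂ ^ 2 - c₁ ^ 2) := fun p hp => by
    have := (H.u_pos hp).ne'
    rw [div_pow, hsq p hp]; field_simp
  rcases eq_or_eq_of_isPreconnected H.conn hcont (a := c) (b := -c) (fun p hp =>
    sq_eq_sq_iff_eq_or_eq_neg.1 ((hall p hp).trans (hall p₀ hp₀).symm)) with h | h
  · exact ⟨c, hc0, fun p hp => (div_eq_iff (H.u_pos hp).ne').1 (h p hp)⟩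
  · exact ⟨-c, neg_ne_zero.2 hc0, fun p hp => (div_eq_iff (H.u_pos hp).ne').1 (h p hp)⟩

variable {c : ℝ} (hc0 : c ≠ 0)
  (hc : ∀ p ∈ U, deriv mu p.2.2 * κ₃ p - dZ (invFactor P) p = c * invFactor P p)

include hc

theorem structureC_k {p : R3} (hp : p ∈ U) : κ₃ p * (1 + deriv mu p.2.2 ^ 2) =
    (deriv (deriv mu) p.2.2 + c * deriv mu p.2.2) * invFactor P p := by
  obtain ⟨-, -, -, -, e⟩ := H.structureC_rigid hC hp
  linear_combination deriv mu p.2.2 * hc p hp - e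

/-- This is K f = -A: the vector f has no components along f_x and f_y, and its other two components
are known from u ⟨f, f_z⟩ K = 1. -/
theorem structureC_smul_f {p : R3} (hp : p ∈ U) : (c * invFactor P p) • f p =
    invFactor P p • dZ f p - deriv mu p.2.2 • N p := by
  obtain ⟨e0, e1, -, -, -⟩ := H.structureC_rigid hC hp
  obtain ⟨ox, oy⟩ := H.structureC_orth hC hp
  rw [hc p hp] at e0
  nth_rw 1 [H.eq_of_orthogonal hp ox oy]
  rw [e1, smul_add, smul_smul, smul_smul, sub_eq_add_neg, ← neg_smul]
  congr 2
  · linear_combination invFactor P p * e0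
  · linear_combination (-deriv mu p.2.2) * e0

theorem structureC_norm {p : R3} (hp : p ∈ U) :
    c ^ 2 * invFactor P p ^ 2 * ‖f p‖ ^ 2 = 1 + deriv mu p.2.2 ^ 2 := by
  obtain ⟨e0, e1, -, -, -⟩ := H.structureC_rigid hC hp
  obtain ⟨ox, oy⟩ := H.structureC_orth hC hp
  rw [hc p hp] at e0
  rw [H.norm_sq_of_orthogonal hp ox oy, e1]
  linear_combination (1 + deriv mu p.2.2 ^ 2) *
    (invFactor P p * ⟪f p, dZ f p⟫_ℝ * (c * invFactor P p) + 1) * e0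

include hc0

/-- Vanishing (x, y)-derivatives would give this only on connected slices. Instead c²u²‖f‖² = 1 +
μ'², with ‖f‖ = r(z), determines u > 0 from z, and the formula for κ₃ then determines κ₃. -/
theorem structureC_eq_of_z_eq {p q : R3} (hp : p ∈ U) (hq : q ∈ U) (hz : p.2.2 = q.2.2) :
    invFactor P p = invFactor P q ∧ κ₃ p = κ₃ q := by
  have n1 := H.structureC_norm hC hc hp
  have n2 := H.structureC_norm hC hc hq
  have k1 := H.structureC_k hC hc hp
  have k2 := H.structureC_k hC hc hq
  obtain ⟨r, hr⟩ := hC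
  rw [(hr p hp).2, hz] at n1
  rw [(hr q hq).2, ← n1] at n2
  have hr0 := (hr q hq).1
  have hu : invFactor P p = invFactor P q := by
    have h : c ^ 2 * r q.2.2 ^ 2 ≠ 0 := by positivity
    have h2 : invFactor P p ^ 2 = invFactor P q ^ 2 :=
      mul_left_cancel₀ h (by linear_combination -n2)
    exact (sq_eq_sq₀ (H.u_pos hp).le (H.u_pos hq).le).1 h2
  refine ⟨hu, ?_⟩
  rw [hz, hu, ← k2] at k1
  exact mul_right_cancel₀ (by positivity) k1

omit hc0 in
-- Along x and y, f* + σ₃f + κ₃N is stationary by σ₁ + σ₃ = κ₃κ₁ and σ₂ + σ₃ = κ₃κ₂. Along z, (σ₃)_z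
-- = uu_z + kk_z = -uK, and K f = -A cancels the remaining terms u²f_z - uμ'N.
theorem structureC_dual_eq {fs : R3 → E4} (hfs : IsDual U f κ₁ κ₂ κ₃ fs) :
    ∃ v : E4, ∀ p ∈ U, fs p - v = -(sigma₃ κ₁ κ₂ κ₃ p • f p + κ₃ p • N p) := by
  have hσ : ∀ p ∈ U, ∀ v, HasPartial v (sigma₃ κ₁ κ₂ κ₃)
      (invFactor P p * pd v (invFactor P) p + κ₃ p * pd v κ₃ p) p := fun p hp v =>
    (((((H.hasPartial_u hp v).sq).add (H.hasPartial_k hp v).sq).mul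
      (HasPartial.const (1 / 2))).congr_on H.isOpen hp fun q hq => by
        rw [H.sigma₃_eq hq]; ring).eq (by ring)
  have hpart : ∀ p ∈ U, ∀ w : R3, ∀ {a b n : E4}, HasPartial w fs a p →
      HasPartial w f b p → HasPartial w N n p →
      HasPartial w (fun p => fs p + (sigma₃ κ₁ κ₂ κ₃ p • f p + κ₃ p • N p))
        (a + (((invFactor P p * pd w (invFactor P) p + κ₃ p * pd w κ₃ p) • f p +
          sigma₃ κ₁ κ₂ κ₃ p • b) + (pd w κ₃ p • N p + κ₃ p • n))) p :=
    fun p hp w a b n ha hb hn =>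
      ha.add (((hσ p hp w).smul hb).add ((H.hasPartial_k hp w).smul hn))
  have hk : ∀ p ∈ U, dX κ₃ p = 0 ∧ dY κ₃ p = 0 := fun p hp =>
    have h := H.structureC_rigid hC hp
    H.partials_k_of_const hp h.2.2.1 h.2.2.2.1
  obtain ⟨v, hv⟩ := exists_eq_const_of_partials H.isOpen H.conn
    (fun p hp => hpart p hp (1, 0, 0) (H.hasPartial_dual hfs hp).1 (H.hasPartial_f_xyz hp).1
      (H.hasPartial_N_xyz hp).1)
    (fun p hp => hpart p hp (0, 1, 0) (H.hasPartial_dual hfs hp).2.1 (H.hasPartial_f_xyz hp).2.1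
      (H.hasPartial_N_xyz hp).2.1)
    (fun p hp => hpart p hp (0, 0, 1) (H.hasPartial_dual hfs hp).2.2 (H.hasPartial_f_xyz hp).2.2
      (H.hasPartial_N_xyz hp).2.2)
    (fun p hp => by
      rw [show pd (1, 0, 0) κ₃ p = 0 from (hk p hp).1,
        show pd (1, 0, 0) (invFactor P) p = 0 from (H.structureC_rigid hC hp).2.2.1,
        eq_sub_of_add_eq (sigma₁_add_sigma₃ (κ₁ := κ₁) (κ₂ := κ₂) (κ₃ := κ₃) p)]
      module)
    (fun p hp => by
      rw [show pd (0, 1, 0) κ₃ p = 0 from (hk p hp).2,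
        show pd (0, 1, 0) (invFactor P) p = 0 from (H.structureC_rigid hC hp).2.2.2.1,
        eq_sub_of_add_eq (sigma₂_add_sigma₃ (κ₁ := κ₁) (κ₂ := κ₂) (κ₃ := κ₃) p)]
      module)
    (fun p hp => by
      have e := H.structureC_smul_f hC hc hp
      have e2 := hc p hp
      have e3 : invFactor P p * pd (0, 0, 1) (invFactor P) p + κ₃ p * pd (0, 0, 1) κ₃ p =
          -(invFactor P p * (c * invFactor P p)) := by
        rw [show pd (0, 0, 1) κ₃ p = _ from H.codazzi_z hp, ← e2]
        change invFactor P p * dZ (invFactor P) p + _ = _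
        ring
      rw [e3, neg_smul, mul_smul, e, show pd (0, 0, 1) κ₃ p = _ from H.codazzi_z hp,
        H.sigma₃_eq hp]
      module)
  exact ⟨v, fun p hp => by rw [← hv p hp]; abel⟩

/-- The squared norm of σ₃f + κ₃N involves only u, κ₃, ‖f‖ and ⟨f, N⟩, which are determined by z. It
is positive because the inner product with f_z is σ₃⟨f, f_z⟩ ≠ 0. -/
theorem structureC_structureC {fs : R3 → E4} {v : E4}
    (hv : ∀ p ∈ U, fs p - v = -(sigma₃ κ₁ κ₂ κ₃ p • f p + κ₃ p • N p)) :
    StructureC U (fun p => fs p - v) := by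
  have hpos : ∀ p ∈ U, 0 < ‖fs p - v‖ := fun p hp => by
    rw [norm_pos_iff, hv p hp, neg_ne_zero]
    intro h
    have h1 := congrArg (fun w => ⟪w, dZ f p⟫_ℝ) h
    simp only [inner_add_left, inner_smul_left, H.hyp.N_z p hp, inner_zero_left] at h1
    have h2 := (H.structureC_rigid hC hp).1
    have h3 := H.sigma₃_pos hp
    have h4 : ⟪f p, dZ f p⟫_ℝ = 0 := by simpa [h3.ne'] using h1
    rw [h4] at h2; norm_num at h2
  have hnorm : ∀ p ∈ U, ‖fs p - v‖ ^ 2 = sigma₃ κ₁ κ₂ κ₃ p ^ 2 * ‖f p‖ ^ 2 +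
      2 * sigma₃ κ₁ κ₂ κ₃ p * κ₃ p * ⟪f p, N p⟫_ℝ + κ₃ p ^ 2 := fun p hp => by
    rw [hv p hp, norm_neg, norm_add_sq_real, norm_smul, norm_smul, inner_smul_left,
      inner_smul_right, H.hyp.norm_N p hp, mul_pow, Real.norm_eq_abs, sq_abs, mul_one,
      Real.norm_eq_abs, sq_abs]
    simp; ring
  obtain ⟨s, hs⟩ := exists_eq_comp_z (U := U) (g := fun p => ‖fs p - v‖) fun p hp q hq hz => by
    obtain ⟨e1, e2⟩ := H.structureC_eq_of_z_eq hC hc0 hc hp hq hz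
    have hN : ⟪f p, N p⟫_ℝ = ⟪f q, N q⟫_ℝ := by
      obtain ⟨a0, a1, -⟩ := H.structureC_rigid hC hp
      obtain ⟨b0, b1, -⟩ := H.structureC_rigid hC hq
      rw [hc p hp] at a0
      rw [hc q hq] at b0
      have hne : c * invFactor P q ≠ 0 := mul_ne_zero hc0 (H.u_pos hq).ne'
      rw [e1] at a0
      have h1 := mul_right_cancel₀ hne (a0.trans b0.symm)
      rw [a1, b1, hz, e1, mul_assoc, mul_assoc, h1]
    have hf : ‖f p‖ = ‖f q‖ := by
      obtain ⟨r, hr⟩ := hC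
      rw [(hr p hp).2, (hr q hq).2, hz]
    refine (sq_eq_sq₀ (norm_nonneg _) (norm_nonneg _)).1 ?_
    rw [hnorm p hp, hnorm q hq, H.sigma₃_eq hp, H.sigma₃_eq hq, e1, e2, hf, hN]
  exact ⟨s, fun p hp => ⟨hs p hp ▸ hpos p hp, hs p hp⟩⟩

omit hc0 in
-- With μ = 0 the equation for μ'' reduces to κ₃ = 0, so K = -u_z, and the Gauss equation becomes
-- u_z² = (1 - c₁²)u².
theorem structureC_of_mu_eq_zero (h0 : ∀ z ∈ zProj U, mu z = 0) {p : R3} (hp : p ∈ U) :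
    κ₃ p = 0 ∧ c ^ 2 = 1 - c₁ ^ 2 ∧ c ^ 2 * invFactor P p ^ 2 * ‖f p‖ ^ 2 = 1 := by
  have hz := mem_zProj hp
  have hder : deriv mu p.2.2 = 0 := deriv_eq_zero_of_eq_zero H.isOpen_J h0 hz
  have hm := H.mu_snd _ hz
  obtain ⟨-, -, -, -, e⟩ := H.structureC_rigid hC hp
  have D := H.gauss_xy_of_const (fun q hq => (H.structureC_rigid hC hq).2.2.1)
    (fun q hq => (H.structureC_rigid hC hq).2.2.2.1) hp e
  have n := H.structureC_norm hC hc hp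
  have hcp := hc p hp
  rw [h0 _ hz] at hm D
  rw [hder] at n hcp e D
  rw [hm] at e
  have hk : κ₃ p = 0 := by simpa using e.symm
  refine ⟨hk, ?_, by simpa using n⟩
  rw [hk] at hcp D
  have h2 : invFactor P p ^ 2 ≠ 0 := pow_ne_zero 2 (H.u_pos hp).ne'
  refine mul_right_cancel₀ h2 ?_
  simp only [Real.sin_zero, Real.cos_zero] at D
  linear_combination (-(0 * 0 - dZ (invFactor P) p + c * invFactor P p)) * hcp - D

end StructureC

end Setting

/-! ### Structure (c): the dual angle and the two cases of the theorem -/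

theorem cos_two_mul_arctan_mul (x : ℝ) :
    Real.cos (2 * Real.arctan x) * (1 + x ^ 2) = 1 - x ^ 2 := by
  have : (1 + x ^ 2) ≠ 0 := by positivity
  rw [Real.cos_two_mul, Real.cos_sq_arctan]; field_simp; ring

theorem sin_two_mul_arctan_mul (x : ℝ) : Real.sin (2 * Real.arctan x) * (1 + x ^ 2) = 2 * x := by
  have h : (1 + x ^ 2) ≠ 0 := by positivity
  have e : Real.sin (Real.arctan x) = x * Real.cos (Real.arctan x) := by
    rw [← div_eq_iff (Real.cos_arctan_pos x).ne', ← Real.tan_eq_sin_div_cos, Real.tan_arctan]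
  have e2 := Real.cos_sq_arctan x
  rw [Real.sin_two_mul, e, show 2 * (x * Real.cos (Real.arctan x)) * Real.cos (Real.arctan x) =
    2 * x * Real.cos (Real.arctan x) ^ 2 by ring, e2]
  field_simp

/-- Adding 2 arctan(k/u) + π to an angle multiplies its exponential by -(u + ik)²/(u² + k²), the
factor that leads from φ to φ*. -/
theorem cos_sin_add_two_mul_arctan {u k : ℝ} (hu : u ≠ 0) (t : ℝ) :
    Real.cos (t + 2 * Real.arctan (k / u) + Real.pi) * (u ^ 2 + k ^ 2) =
      (k ^ 2 - u ^ 2) * Real.cos t + 2 * u * k * Real.sin t ∧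
    Real.sin (t + 2 * Real.arctan (k / u) + Real.pi) * (u ^ 2 + k ^ 2) =
      (k ^ 2 - u ^ 2) * Real.sin t - 2 * u * k * Real.cos t := by
  have h1 := cos_two_mul_arctan_mul (k / u)
  have h2 := sin_two_mul_arctan_mul (k / u)
  field_simp at h1 h2
  rw [Real.cos_add_pi, Real.sin_add_pi, Real.cos_add, Real.sin_add]
  constructor
  · linear_combination (-Real.cos t) * h1 + Real.sin t * h2
  · linear_combination (-Real.sin t) * h1 - Real.cos t * h2

/-- The function `μ + 2 arctan (κ₃ P) + π` of case (c), where `κ₃ P` is expressed by `μ`. -/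
def dualMu (c : ℝ) (mu : ℝ → ℝ) (z : ℝ) : ℝ :=
  mu z + 2 * Real.arctan ((deriv (deriv mu) z + c * deriv mu z) / (1 + deriv mu z ^ 2)) + Real.pi

theorem smooth_dualMu {J : Set ℝ} (hJ : IsOpen J) {mu : ℝ → ℝ} (hmu : ContDiffOn ℝ ∞ mu J) (c : ℝ) :
    ContDiffOn ℝ ∞ (dualMu c mu) J := by
  have h1 := contDiffOn_deriv hJ hmu
  have h2 := contDiffOn_deriv hJ h1
  refine (hmu.add (contDiffOn_const.mul (ContDiffOn.arctan ((h2.add (contDiffOn_const.mul h1)).div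
    (contDiffOn_const.add (h1.pow 2)) fun z _ => ?_)))).add contDiffOn_const
  positivity

namespace Setting

variable {U : Set R3} {lam : ℝ × ℝ → ℝ} {mu : ℝ → ℝ} {c₁ : ℝ} {P κ₁ κ₂ κ₃ : R3 → ℝ}
  {f N : R3 → E4} (H : Setting U lam mu c₁ P κ₁ κ₂ κ₃ f N)

include H

theorem dZ_angle {lams : ℝ × ℝ → ℝ} {mus : ℝ → ℝ}
    (hls : ContDiffOn ℝ ∞ lams (xyProj U)) (hms : ContDiffOn ℝ ∞ mus (zProj U)) {p : R3}
    (hp : p ∈ U) : dZ (angle lams mus) p = deriv mus p.2.2 := by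
  have h := (HasPartial.comp_xy ((hls.contDiffAt (H.isOpen_V.mem_nhds (mem_xyProj hp))).differentiableAt
    (by simp)) (0, 0, 1)).add
        (HasPartial.comp_z (hasDerivAt_of_contDiffOn H.isOpen_J hms (mem_zProj hp)) (0, 0, 1))
  have e := h.pd_eq
  have : (((0, 0, 1) : R3).1, ((0, 0, 1) : R3).2.1) = (0 : ℝ × ℝ) := rfl
  rw [this] at e
  refine e.trans ?_
  simp [pd]

section StructureC

theorem isDualAngle_of_k_eq_zero (hk : ∀ p ∈ U, κ₃ p = 0) (h0 : ∀ z ∈ zProj U, mu z = 0) {ε : ℝ}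
    (hε : ε = 1 ∨ ε = -1) : IsDualAngle U (angle lam mu) κ₁ κ₂ κ₃
      (angle (fun q => lam q + ε * Real.pi) fun z => -mu z) := by
  have hφ : ∀ p ∈ U, angle (fun q => lam q + ε * Real.pi) (fun z => -mu z) p =
      angle lam mu p + ε * Real.pi := fun p hp => by
    simp [angle, h0 _ (mem_zProj hp)]
  refine H.isDualAngle_of (fun p hp => ?_) fun p hp => ?_ <;> rw [hφ p hp, hk p hp] <;>
    rcases hε with rfl | rfl
  · rw [one_mul, Real.cos_add_pi]; ring
  · rw [neg_one_mul, ← sub_eq_add_neg, Real.cos_sub_pi]; ring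
  · rw [one_mul, Real.sin_add_pi]; ring
  · rw [neg_one_mul, ← sub_eq_add_neg, Real.sin_sub_pi]; ring

variable (hC : StructureC U f) {c : ℝ} (hc0 : c ≠ 0)
  (hc : ∀ p ∈ U, deriv mu p.2.2 * κ₃ p - dZ (invFactor P) p = c * invFactor P p)

include hC hc

include hc0 in
-- Here κ₃ = 0, 2σ₃ = u² and c²u²‖f‖² = 1, so σ₃f = f/(2c²‖f‖²) with c² = 1 - c₁²: a multiple of the
-- inversion.
theorem structureC_dual_of_mu_eq_zero (h0 : ∀ z ∈ zProj U, mu z = 0) (hne : U.Nonempty)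
    {fs : R3 → E4} {v : E4}
    (hv : ∀ p ∈ U, fs p - v = -(sigma₃ κ₁ κ₂ κ₃ p • f p + κ₃ p • N p)) :
    ConformallyEquivalentOn U f fs ∧ c₁ ^ 2 < 1 ∧
      (∃ s : ℝ → ℝ, ∀ p ∈ U, sigma₃ κ₁ κ₂ κ₃ p = s p.2.2) ∧
      ∀ p ∈ U, fs p - v = -(sigma₃ κ₁ κ₂ κ₃ p • f p) ∧
        fs p - v = -((1 / (2 * Real.sqrt (1 - c₁ ^ 2) ^ 2)) •
          EuclideanGeometry.inversion (0 : E4) 1 (f p)) := by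
  obtain ⟨p₀, hp₀⟩ := hne
  have hcc : c ^ 2 = 1 - c₁ ^ 2 := (H.structureC_of_mu_eq_zero hC hc h0 hp₀).2.1
  have hcpos : 0 < c ^ 2 := by positivity
  have e1 : ∀ p ∈ U, fs p - v = -(sigma₃ κ₁ κ₂ κ₃ p • f p) := fun p hp => by
    rw [hv p hp, (H.structureC_of_mu_eq_zero hC hc h0 hp).1, zero_smul, add_zero]
  have e2 : ∀ p ∈ U, fs p - v = -((1 / (2 * c ^ 2)) •
      EuclideanGeometry.inversion (0 : E4) 1 (f p)) := fun p hp => by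
    obtain ⟨hk, -, hn⟩ := H.structureC_of_mu_eq_zero hC hc h0 hp
    have hf : ‖f p‖ ≠ 0 := fun h => by rw [h] at hn; norm_num at hn
    rw [e1 p hp, EuclideanGeometry.inversion, H.sigma₃_eq hp, hk, dist_zero_right, vsub_eq_sub,
      sub_zero, vadd_eq_add, add_zero, smul_smul]
    congr 2
    field_simp
    linear_combination hn
  refine ⟨⟨LinearIsometryEquiv.neg ℝ, 1 / (2 * c ^ 2), v, by positivity,
    Or.inr ⟨0, fun p hp => ⟨fun h => ?_, ?_⟩⟩⟩, by linarith, ?_, fun p hp => ⟨e1 p hp, ?_⟩⟩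
  · have hn := (H.structureC_of_mu_eq_zero hC hc h0 hp).2.2
    rw [h] at hn; norm_num at hn
  · rw [← sub_eq_iff_eq_add, e2 p hp]; simp
  · refine exists_eq_comp_z fun p hp q hq hz => ?_
    obtain ⟨h1, h2⟩ := H.structureC_eq_of_z_eq hC hc0 hc hp hq hz
    rw [H.sigma₃_eq hp, H.sigma₃_eq hq, h1, h2]
  · rw [Real.sq_sqrt (by linarith), ← hcc]; exact e2 p hp

theorem structureC_ratio {p : R3} (hp : p ∈ U) :
    (deriv (deriv mu) p.2.2 + c * deriv mu p.2.2) / (1 + deriv mu p.2.2 ^ 2) =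
      κ₃ p / invFactor P p := by
  have h1 := (H.u_pos hp).ne'
  have h2 : (1 + deriv mu p.2.2 ^ 2) ≠ 0 := by positivity
  rw [div_eq_div_iff h2 h1, H.structureC_k hC hc hp]

theorem structureC_sin_cos {p : R3} (hp : p ∈ U) (t : ℝ) :
    Real.cos (t + dualMu c mu p.2.2) * (invFactor P p ^ 2 + κ₃ p ^ 2) =
      (κ₃ p ^ 2 - invFactor P p ^ 2) * Real.cos (t + mu p.2.2) +
        2 * invFactor P p * κ₃ p * Real.sin (t + mu p.2.2) ∧
    Real.sin (t + dualMu c mu p.2.2) * (invFactor P p ^ 2 + κ₃ p ^ 2) =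
      (κ₃ p ^ 2 - invFactor P p ^ 2) * Real.sin (t + mu p.2.2) -
        2 * invFactor P p * κ₃ p * Real.cos (t + mu p.2.2) := by
  rw [show t + dualMu c mu p.2.2 = (t + mu p.2.2) + 2 * Real.arctan (κ₃ p / invFactor P p) +
      Real.pi by rw [dualMu, H.structureC_ratio hC hc hp]; ring]
  exact cos_sin_add_two_mul_arctan (H.u_pos hp).ne' _

theorem structureC_deriv_dualMu {p : R3} (hp : p ∈ U) :
    deriv (dualMu c mu) p.2.2 * (invFactor P p ^ 2 + κ₃ p ^ 2) =
      deriv mu p.2.2 * (κ₃ p ^ 2 - invFactor P p ^ 2) - 2 * κ₃ p * dZ (invFactor P) p := by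
  have hu := (H.u_pos hp).ne'
  have h1 := HasPartial.comp_z (hasDerivAt_of_contDiffOn H.isOpen_J
    (smooth_dualMu H.isOpen_J H.smooth_mu c) (mem_zProj hp)) (0, 0, 1)
  have h2 := ((HasPartial.comp_z (H.hasDerivAt_mu hp) (0, 0, 1)).add
    ((HasPartial.const (2 : ℝ)).mul ((H.hasPartial_k hp (0, 0, 1)).div
      (H.hasPartial_u hp (0, 0, 1)) hu).arctan)).add (HasPartial.const Real.pi)
  have h3 := h1.eq_of_eqOn h2 H.isOpen hp fun q hq => by
    rw [dualMu, H.structureC_ratio hC hc hq]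
  have h4 : (invFactor P p ^ 2 + κ₃ p ^ 2) ≠ 0 := by positivity
  simp only [one_smul] at h3
  rw [h3, show pd (0, 0, 1) κ₃ p = _ from H.codazzi_z hp,
    show pd (0, 0, 1) (invFactor P) p = dZ (invFactor P) p from rfl]
  field_simp
  ring

theorem structureC_isDualAngle :
    IsDualAngle U (angle lam mu) κ₁ κ₂ κ₃ (angle lam (dualMu c mu)) :=
  H.isDualAngle_of (fun _ hp => (H.structureC_sin_cos hC hc hp _).1)
    fun _ hp => (H.structureC_sin_cos hC hc hp _).2

omit hc in
theorem structureC_gauss {p : R3} (hp : p ∈ U) :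
    invFactor P p ^ 2 * (1 + deriv mu p.2.2 ^ 2) - dZ (invFactor P) p ^ 2 - κ₃ p ^ 2 =
      c₁ ^ 2 * invFactor P p ^ 2 * (Real.cos (mu p.2.2) ^ 2 - Real.sin (mu p.2.2) ^ 2) :=
  H.gauss_xy_of_const (fun _ hq => (H.structureC_rigid hC hq).2.2.1)
    (fun _ hq => (H.structureC_rigid hC hq).2.2.2.1) hp (H.structureC_rigid hC hp).2.2.2.2

omit hC in
-- If μ*' vanished identically or equalled μ', the hypothesis would hold with d = 2c or d = c. Its
-- z-derivative is the extra relation that leads to a contradiction in both cases.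
theorem structureC_deriv_relation {d : ℝ} (hd : ∀ p ∈ U, deriv mu p.2.2 *
    (invFactor P p ^ 2 + κ₃ p ^ 2) = d * (invFactor P p * κ₃ p)) {p : R3} (hp : p ∈ U) :
    deriv (deriv mu) p.2.2 * (invFactor P p ^ 2 + κ₃ p ^ 2) =
      2 * c * deriv mu p.2.2 * invFactor P p ^ 2 +
      d * (dZ (invFactor P) p * κ₃ p - invFactor P p ^ 2 * deriv mu p.2.2) := by
  have h1 := (HasPartial.comp_z (H.hasDerivAt_deriv_mu hp) (0, 0, 1)).mul
    ((H.hasPartial_u hp (0, 0, 1)).sq.add (H.hasPartial_k hp (0, 0, 1)).sq)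
  have h2 := (HasPartial.const d).mul
    ((H.hasPartial_u hp (0, 0, 1)).mul (H.hasPartial_k hp (0, 0, 1)))
  have h3 := h1.eq_of_eqOn h2 H.isOpen hp hd
  rw [show pd (0, 0, 1) κ₃ p = _ from H.codazzi_z hp,
    show pd (0, 0, 1) (invFactor P) p = dZ (invFactor P) p from rfl] at h3
  simp only [one_smul] at h3
  linear_combination h3 + 2 * deriv mu p.2.2 * invFactor P p * hc p hp

omit hC hc in
theorem exists_k_ne_zero (hm : ∃ z ∈ zProj U, deriv mu z ≠ 0) : ∃ p ∈ U, κ₃ p ≠ 0 := by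
  by_contra! h
  obtain ⟨_, ⟨p, hp, rfl⟩, hne⟩ := hm
  have h1 := H.codazzi_z hp
  rw [show dZ κ₃ p = 0 from (H.hasPartial_k hp (0, 0, 1)).eq_of_eqOn (.const 0) H.isOpen hp h] at h1
  have := (H.u_pos hp).ne'
  exact (mul_ne_zero this hne) (by linarith)

theorem structureC_deriv_dualMu_ne_zero (hm : ∃ z ∈ zProj U, deriv mu z ≠ 0) :
    ∃ z ∈ zProj U, deriv (dualMu c mu) z ≠ 0 := by
  by_contra! h
  obtain ⟨p, hp, hk⟩ := H.exists_k_ne_zero hm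
  have h1 : ∀ p ∈ U, deriv mu p.2.2 * (invFactor P p ^ 2 + κ₃ p ^ 2) =
      2 * c * (invFactor P p * κ₃ p) := fun p hp => by
    have e := H.structureC_deriv_dualMu hC hc hp
    rw [h _ (mem_zProj hp)] at e
    linear_combination e + 2 * κ₃ p * hc p hp
  have h2 := H.structureC_deriv_relation hc h1 hp
  have h3 := (H.structureC_rigid hC hp).2.2.2.2
  have hR : (invFactor P p ^ 2 + κ₃ p ^ 2) ≠ 0 := by have := H.u_pos hp; positivity
  -- Eliminating μ'' from the two relations leaves κ₃(u² + κ₃²) = 0, impossible at the chosen point.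
  refine mul_ne_zero hk hR ?_
  linear_combination invFactor P p * h2 - (invFactor P p ^ 2 + κ₃ p ^ 2) * h3 -
    dZ (invFactor P) p * h1 p hp

include hc0 in
theorem structureC_deriv_dualMu_ne_neg (hm : ∃ z ∈ zProj U, deriv mu z ≠ 0) :
    ¬ ∀ z ∈ zProj U, deriv (dualMu c mu) z = -deriv mu z := by
  intro h
  obtain ⟨p, hp, hk⟩ := H.exists_k_ne_zero hm
  have e := H.structureC_deriv_dualMu hC hc hp
  rw [h _ (mem_zProj hp)] at e
  refine mul_ne_zero hk (mul_ne_zero hc0 (H.u_pos hp).ne') ?_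
  linear_combination -e / 2 - κ₃ p * hc p hp

/-- Equality of the derivatives would force, at a point with μ' ≠ 0, μ'' = 0 and u_z² = u². The
equation for μ'' then gives sin μ cos μ = 0 and the Gauss equation cos² μ = sin² μ. -/
theorem structureC_deriv_dualMu_ne (hc₁ : c₁ ≠ 0) (hm : ∃ z ∈ zProj U, deriv mu z ≠ 0) :
    ¬ ∀ z ∈ zProj U, deriv (dualMu c mu) z = deriv mu z := by
  intro h
  have h1 : ∀ p ∈ U, κ₃ p * dZ (invFactor P) p = -(deriv mu p.2.2 * invFactor P p ^ 2) :=
    fun p hp => by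
      have e := H.structureC_deriv_dualMu hC hc hp
      rw [h _ (mem_zProj hp)] at e
      linear_combination e / 2
  have h2 : ∀ p ∈ U, deriv mu p.2.2 * (invFactor P p ^ 2 + κ₃ p ^ 2) =
      c * (invFactor P p * κ₃ p) := fun p hp => by
    linear_combination h1 p hp + κ₃ p * hc p hp
  obtain ⟨_, ⟨p, hp, rfl⟩, hne⟩ := hm
  have hne : deriv mu p.2.2 ≠ 0 := hne
  have hu := (H.u_pos hp).ne'
  have h3 := H.structureC_deriv_relation hc h2 hp
  have hR : (invFactor P p ^ 2 + κ₃ p ^ 2) ≠ 0 := by have := H.u_pos hp; positivity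
  have hb : deriv (deriv mu) p.2.2 = 0 := by
    refine (mul_eq_zero.1 ?_).resolve_right hR
    linear_combination h3 + c * h1 p hp
  have h4 := (H.structureC_rigid hC hp).2.2.2.2
  have h5 := H.structureC_gauss hC hp
  have h6 := H.mu_snd _ (mem_zProj hp)
  rw [hb] at h4 h6
  have h7 : dZ (invFactor P) p ^ 2 = invFactor P p ^ 2 := by
    refine mul_left_cancel₀ hne ?_
    linear_combination -h1 p hp - dZ (invFactor P) p * h4
  have h8 : Real.sin (mu p.2.2) * Real.cos (mu p.2.2) = 0 := by
    refine (mul_eq_zero.1 ?_).resolve_left (pow_ne_zero 2 hc₁)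
    linarith
  have h9 : Real.cos (mu p.2.2) ^ 2 - Real.sin (mu p.2.2) ^ 2 = 0 := by
    refine (mul_eq_zero.1 ?_).resolve_left (mul_ne_zero (pow_ne_zero 2 hc₁) (pow_ne_zero 2 hu))
    linear_combination -h5 - (1 + deriv mu p.2.2 ^ 2) * h7 +
      (κ₃ p - deriv mu p.2.2 * dZ (invFactor P) p) * h4
  have h10 := Real.sin_sq_add_cos_sq (mu p.2.2)
  have : (1 : ℝ) = 0 := by
    linear_combination (-(1 + Real.sin (mu p.2.2) ^ 2 + Real.cos (mu p.2.2) ^ 2)) * h10 +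
      (Real.cos (mu p.2.2) ^ 2 - Real.sin (mu p.2.2) ^ 2) * h9 +
      4 * Real.sin (mu p.2.2) * Real.cos (mu p.2.2) * h8
  norm_num at this

/-- The constants c₁, c₂ are unchanged: multiplied by (u² + κ₃²)², the first integral for μ* is a
combination of that for μ, the Gauss equation and the relation for μ''. -/
theorem structureC_guichardEquations {c₂ : ℝ}
    (hφ : GuichardEquations (xyProj U) (zProj U) lam mu c₁ c₂)
    (hm : ∃ z ∈ zProj U, deriv mu z ≠ 0) :
    GuichardEquations (xyProj U) (zProj U) lam (dualMu c mu) c₁ c₂ where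
  c₁_ne := hφ.c₁_ne
  c₂_ne := hφ.c₂_ne
  smooth_lam := hφ.smooth_lam
  smooth_mu := smooth_dualMu H.isOpen_J H.smooth_mu c
  lam_eq := hφ.lam_eq
  mu_eq := by
    refine Or.inr ⟨H.structureC_deriv_dualMu_ne_zero hC hc hm, ?_⟩
    rintro _ ⟨p, hp, rfl⟩
    have hsq : deriv mu p.2.2 ^ 2 = c₂ ^ 2 - c₁ ^ 2 * Real.sin (mu p.2.2) ^ 2 := by
      rcases hφ.mu_eq with h0 | ⟨-, h⟩
      · obtain ⟨z, hz, hne⟩ := hm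
        exact absurd (deriv_eq_zero_of_eq_zero H.isOpen_J h0 hz) hne
      · exact h _ (mem_zProj hp)
    have hR : (invFactor P p ^ 2 + κ₃ p ^ 2) ≠ 0 := by have := H.u_pos hp; positivity
    have e1 := H.structureC_deriv_dualMu hC hc hp
    have e2 := (H.structureC_sin_cos hC hc hp 0).2
    rw [zero_add, zero_add] at e2
    have e3 := (H.structureC_rigid hC hp).2.2.2.2
    rw [H.mu_snd _ (mem_zProj hp)] at e3
    have e4 := H.structureC_gauss hC hp
    refine mul_right_cancel₀ (pow_ne_zero 2 hR) ?_
    have s1 : deriv (dualMu c mu) p.2.2 ^ 2 * (invFactor P p ^ 2 + κ₃ p ^ 2) ^ 2 =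
        (deriv mu p.2.2 * (κ₃ p ^ 2 - invFactor P p ^ 2) -
          2 * κ₃ p * dZ (invFactor P) p) ^ 2 := by rw [← mul_pow, e1]
    have s2 : Real.sin (dualMu c mu p.2.2) ^ 2 * (invFactor P p ^ 2 + κ₃ p ^ 2) ^ 2 =
        ((κ₃ p ^ 2 - invFactor P p ^ 2) * Real.sin (mu p.2.2) -
        2 * invFactor P p * κ₃ p * Real.cos (mu p.2.2)) ^ 2 := by rw [← mul_pow, e2]
    change deriv (dualMu c mu) p.2.2 ^ 2 * _ = (_ - _ * Real.sin (dualMu c mu p.2.2) ^ 2) * _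
    linear_combination s1 + c₁ ^ 2 * s2 + (invFactor P p ^ 2 + κ₃ p ^ 2) ^ 2 * hsq -
      4 * κ₃ p ^ 2 * e4 - 4 * κ₃ p * (invFactor P p ^ 2 - κ₃ p ^ 2) * e3

theorem structureC_funK {p : R3} (hp : p ∈ U) :
    funK (angle lam (dualMu c mu)) (dualP P κ₁ κ₂ κ₃) (dualκ₃ κ₁ κ₂ κ₃) p =
      -(c * invFactor P p / sigma₃ κ₁ κ₂ κ₃ p) := by
  have hu := (H.u_pos hp).ne'
  have hR : (invFactor P p ^ 2 + κ₃ p ^ 2) ≠ 0 := by positivity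
  have h1 : HasPartial (0, 0, 1) (fun r => (dualP P κ₁ κ₂ κ₃ r)⁻¹) _ p :=
    ((H.hasPartial_u hp (0, 0, 1)).div (((H.hasPartial_u hp (0, 0, 1)).sq.add
      (H.hasPartial_k hp (0, 0, 1)).sq).mul (HasPartial.const (1 / 2)))
        (by positivity)).congr_on H.isOpen hp fun q hq => by
          rw [dualP, H.sigma₃_eq hq, invFactor]
          have := (H.hyp.P_pos q hq).ne'
          field_simp
  have h2 := h1.pd_eq
  rw [funK, H.dZ_angle H.smooth_lam (smooth_dualMu H.isOpen_J H.smooth_mu c) hp, dualκ₃]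
  change -pd (0, 0, 1) _ p + _ = _
  rw [h2, H.sigma₃_eq hp, show pd (0, 0, 1) κ₃ p = _ from H.codazzi_z hp,
    show pd (0, 0, 1) (invFactor P) p = dZ (invFactor P) p from rfl]
  have e1 := H.structureC_deriv_dualMu hC hc hp
  have e2 := hc p hp
  have e3 : dZ (invFactor P) p = deriv mu p.2.2 * κ₃ p - c * invFactor P p := by linarith
  rw [← eq_div_iff hR] at e1
  rw [e1, e3]
  field_simp
  ring

omit hC hc in
theorem structureC_vecA {fs : R3 → E4} (hfs : IsDual U f κ₁ κ₂ κ₃ fs) {p : R3} (hp : p ∈ U) :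
    vecA (angle lam (dualMu c mu)) (dualP P κ₁ κ₂ κ₃) fs (dualN N) p =
      -(invFactor P p • dZ f p) - deriv (dualMu c mu) p.2.2 • N p := by
  have h3 := (H.sigma₃_pos hp).ne'
  rw [vecA, Xγ, H.dZ_angle H.smooth_lam (smooth_dualMu H.isOpen_J H.smooth_mu c) hp,
    (dual_partials hfs hp).2.2, dualN, dualP, smul_smul, smul_neg, ← sub_eq_add_neg]
  congr 3
  have := (H.hyp.P_pos p hp).ne'
  rw [invFactor]; field_simp

include hc0 in
theorem structureC_dual_of_deriv_mu_ne_zero {c₂ : ℝ}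
    (hφ : GuichardEquations (xyProj U) (zProj U) lam mu c₁ c₂)
    (hd_x : ∃ q ∈ xyProj U, pX lam q ≠ 0)
    (hm : ∃ z ∈ zProj U, deriv mu z ≠ 0) {fs : R3 → E4} {v : E4}
    (hfs : IsDual U f κ₁ κ₂ κ₃ fs)
    (hv : ∀ p ∈ U, fs p - v = -(sigma₃ κ₁ κ₂ κ₃ p • f p + κ₃ p • N p)) :
    NotConformallyEquivalent U κ₁ κ₂ κ₃ f fs ∧
      (∃ k : ℝ → ℝ, ∀ p ∈ U,
        funK (angle lam (dualMu c mu)) (dualP P κ₁ κ₂ κ₃) (dualκ₃ κ₁ κ₂ κ₃) p = k p.2.2) ∧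
      ∀ p ∈ U,
        funK (angle lam (dualMu c mu)) (dualP P κ₁ κ₂ κ₃) (dualκ₃ κ₁ κ₂ κ₃) p ≠ 0 ∧
        fs p - v = -((funK (angle lam (dualMu c mu)) (dualP P κ₁ κ₂ κ₃) (dualκ₃ κ₁ κ₂ κ₃) p)⁻¹ •
          vecA (angle lam (dualMu c mu)) (dualP P κ₁ κ₂ κ₃) fs (dualN N) p) ∧
        fs p - v = -(sigma₃ κ₁ κ₂ κ₃ p • f p + κ₃ p • N p) := by
  refine ⟨H.notConformallyEquivalent hfs H.smooth_lam
    (smooth_dualMu H.isOpen_J H.smooth_mu c) (H.structureC_isDualAngle hC hc)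
    (fun h => H.structureC_deriv_dualMu_ne hC hc hφ.c₁_ne hm h.2)
    (fun h => ?_), ?_, fun p hp => ⟨?_, ?_, hv p hp⟩⟩
  · obtain ⟨q, hq, hne⟩ := hd_x
    have := (h.1 q hq).1
    exact hne (by linarith)
  · refine exists_eq_comp_z fun p hp q hq hz => ?_
    obtain ⟨h1, h2⟩ := H.structureC_eq_of_z_eq hC hc0 hc hp hq hz
    rw [H.structureC_funK hC hc hp, H.structureC_funK hC hc hq,
      H.sigma₃_eq hp, H.sigma₃_eq hq, h1, h2]
  · rw [H.structureC_funK hC hc hp]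
    exact neg_ne_zero.2 (div_ne_zero (mul_ne_zero hc0 (H.u_pos hp).ne') (H.sigma₃_pos hp).ne')
  · have hu := (H.u_pos hp).ne'
    have h3 := (H.sigma₃_pos hp).ne'
    have e1 := H.structureC_smul_f hC hc hp
    have e2 : f p = (c * invFactor P p)⁻¹ •
        (invFactor P p • dZ f p - deriv mu p.2.2 • N p) := by
      rw [← e1, smul_smul, inv_mul_cancel₀ (mul_ne_zero hc0 hu), one_smul]
    have e3 := H.structureC_deriv_dualMu hC hc hp
    have e4 := hc p hp
    -- With K* = -K/σ₃ and f = -A/K, this is the N-component of -A*/K* = -(σ₃f + κ₃N); the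
    -- f_z-components agree directly.
    have e5 : deriv (dualMu c mu) p.2.2 * sigma₃ κ₁ κ₂ κ₃ p =
        κ₃ p * (c * invFactor P p) - sigma₃ κ₁ κ₂ κ₃ p * deriv mu p.2.2 := by
      rw [H.sigma₃_eq hp]
      linear_combination e3 / 2 + κ₃ p * e4
    rw [← eq_div_iff h3] at e5
    rw [hv p hp, H.structureC_funK hC hc hp, H.structureC_vecA hfs hp, e2, e5]
    match_scalars <;> field_simp
    ring

end StructureC

end Setting

/-! ### Structure (b): rotating hyperplanes and the form of the dual -/

theorem hasDerivAt_circleVec (e₁ e₂ : E4) (t : ℝ) :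
    HasDerivAt (circleVec e₁ e₂) (circleVec e₁ e₂ (t + Real.pi / 2)) t := by
  have h := ((Real.hasDerivAt_sin t).smul_const e₁).neg.add
    ((Real.hasDerivAt_cos t).smul_const e₂)
  rw [circleVec, Real.sin_add_pi_div_two, Real.cos_add_pi_div_two]
  exact h

theorem norm_circleVec {e₁ e₂ : E4} (h₁ : ‖e₁‖ = 1) (h₂ : ‖e₂‖ = 1) (h : ⟪e₁, e₂⟫_ℝ = 0) (t : ℝ) :
    ‖circleVec e₁ e₂ t‖ = 1 := by
  have h3 : ‖circleVec e₁ e₂ t‖ ^ 2 = 1 := by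
    rw [circleVec, norm_add_sq_real, norm_neg, norm_smul, norm_smul, h₁, h₂, inner_neg_left,
      inner_smul_left, inner_smul_right, h]
    simp
  exact (pow_eq_one_iff_of_nonneg (norm_nonneg _) two_ne_zero).1 h3

theorem inner_circleVec_circleVec_add {e₁ e₂ : E4} (h₁ : ‖e₁‖ = 1) (h₂ : ‖e₂‖ = 1)
    (h : ⟪e₁, e₂⟫_ℝ = 0) (t : ℝ) :
    ⟪circleVec e₁ e₂ t, circleVec e₁ e₂ (t + Real.pi / 2)⟫_ℝ = 0 := by
  simp only [circleVec, Real.sin_add_pi_div_two, Real.cos_add_pi_div_two, inner_add_left,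
    inner_add_right, inner_neg_left, inner_neg_right, inner_smul_left, inner_smul_right,
    real_inner_comm e₁ e₂, real_inner_self_eq_norm_sq, h₁, h₂, h]
  simp; ring

theorem inner_eq_zero_of_circleVec {e₁ e₂ w : E4} {t : ℝ} (h1 : ⟪circleVec e₁ e₂ t, w⟫_ℝ = 0)
    (h2 : ⟪circleVec e₁ e₂ (t + Real.pi / 2), w⟫_ℝ = 0) : ⟪e₁, w⟫_ℝ = 0 ∧ ⟪e₂, w⟫_ℝ = 0 := by
  simp only [circleVec, Real.sin_add_pi_div_two, Real.cos_add_pi_div_two, inner_add_left,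
    inner_neg_left, inner_smul_left, conj_trivial, neg_smul] at h1 h2
  have h3 := Real.sin_sq_add_cos_sq t
  constructor
  · linear_combination (-Real.sin t) * h1 - Real.cos t * h2 - ⟪e₁, w⟫_ℝ * h3
  · linear_combination Real.cos t * h1 - Real.sin t * h2 - ⟪e₂, w⟫_ℝ * h3

theorem inner_circleVec_eq_zero {e₁ e₂ w : E4} (h1 : ⟪e₁, w⟫_ℝ = 0) (h2 : ⟪e₂, w⟫_ℝ = 0) (t : ℝ) :
    ⟪circleVec e₁ e₂ t, w⟫_ℝ = 0 := by
  simp [circleVec, inner_add_left, inner_smul_left, h1, h2]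

namespace Setting

variable {U : Set R3} {lam : ℝ × ℝ → ℝ} {mu : ℝ → ℝ} {c₁ : ℝ} {P κ₁ κ₂ κ₃ : R3 → ℝ}
  {f N : R3 → E4} (H : Setting U lam mu c₁ P κ₁ κ₂ κ₃ f N)

include H

section StructureB

variable {e₁ e₂ : E4} {θ : ℝ → ℝ} (hB : StructureB U e₁ e₂ θ f)

include hB

theorem hasPartial_circleVec {p : R3} (hp : p ∈ U) (v : R3) :
    HasPartial v (fun q => circleVec e₁ e₂ (θ q.2.2))
      (v.2.2 • deriv θ p.2.2 • circleVec e₁ e₂ (θ p.2.2 + Real.pi / 2)) p :=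
  HasPartial.comp_z ((hasDerivAt_circleVec e₁ e₂ (θ p.2.2)).scomp p.2.2
    (hasDerivAt_of_contDiffOn H.isOpen_J hB.smooth_θ (mem_zProj hp))) v

omit H in
theorem smooth_circleVec : ContDiffOn ℝ ∞ (fun q : R3 => circleVec e₁ e₂ (θ q.2.2)) U := by
  have h := contDiffOn_comp_z hB.smooth_θ
  exact ((h.sin.smul contDiffOn_const).neg).add (h.cos.smul contDiffOn_const)

theorem structureB_orth {p : R3} (hp : p ∈ U) :
    ⟪circleVec e₁ e₂ (θ p.2.2), dX f p⟫_ℝ = 0 ∧ ⟪circleVec e₁ e₂ (θ p.2.2), dY f p⟫_ℝ = 0 := by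
  have key : ∀ v : R3, v.2.2 = 0 → ⟪circleVec e₁ e₂ (θ p.2.2), pd v f p⟫_ℝ = 0 := fun v hv => by
    have h1 := ((H.hasPartial_circleVec hB hp v).inner (H.hasPartial_f hp v)).eq_of_eqOn
      (.const 0) H.isOpen hp hB.mem
    simpa [hv] using h1
  exact ⟨key _ rfl, key _ rfl⟩

/-- The moving normal B(z) has no x- and y-derivatives, so ε = 0 and K = 0. If the three equations
in the second part held, which are those of structure (a), then B' would be orthogonal to f_x and
f_y. The relation B ⊥ B' and the derivative of the relation between ⟨B, N⟩ and ⟨B, f_z⟩ would remove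
the other components, contrary to B' ≠ 0. -/
theorem structureB_partials {p : R3} (hp : p ∈ U) :
    dZ (invFactor P) p = deriv mu p.2.2 * κ₃ p ∧
    ¬ (dX (invFactor P) p = 0 ∧ dY (invFactor P) p = 0 ∧
      deriv (deriv mu) p.2.2 * invFactor P p = κ₃ p * (1 + deriv mu p.2.2 ^ 2)) := by
  set F : R3 → E4 := fun q => circleVec e₁ e₂ (θ q.2.2)
  have hF : ContDiffOn ℝ ∞ F U := smooth_circleVec hB
  have h0 : ∀ p ∈ U, dX F p = 0 ∧ dY F p = 0 := fun p hp =>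
    ⟨(H.hasPartial_circleVec hB hp (1, 0, 0)).pd_eq.trans (zero_smul ℝ _),
      (H.hasPartial_circleVec hB hp (0, 1, 0)).pd_eq.trans (zero_smul ℝ _)⟩
  have hFz : dZ F p = deriv θ p.2.2 • circleVec e₁ e₂ (θ p.2.2 + Real.pi / 2) :=
    (H.hasPartial_circleVec hB hp (0, 0, 1)).pd_eq.trans (one_smul ℝ _)
  have hx : ∀ p ∈ U, ⟪F p, dX f p⟫_ℝ = 0 := fun p hp => (H.structureB_orth hB hp).1
  have hy : ∀ p ∈ U, ⟪F p, dY f p⟫_ℝ = 0 := fun p hp => (H.structureB_orth hB hp).2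
  have hxx : ∀ p ∈ U, ⟪dX F p, dX f p⟫_ℝ =
      0 * (P p ^ 2 * Real.cos (angle lam mu p) ^ 2) := fun p hp => by
    rw [(h0 p hp).1, inner_zero_left, zero_mul]
  have hyy : ∀ p ∈ U, ⟪dY F p, dY f p⟫_ℝ =
      0 * (P p ^ 2 * Real.sin (angle lam mu p) ^ 2) := fun p hp => by
    rw [(h0 p hp).2, inner_zero_left, zero_mul]
  obtain ⟨a1, a2⟩ := H.field_normal_and_curvature hF hx hy hxx hyy hp
  obtain ⟨a3, a4, a5⟩ := H.field_deriv_z hF hx hy hxx hyy hp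
  have hu := (H.u_pos hp).ne'
  have hX : ⟪F p, dZ f p⟫_ℝ ≠ 0 := fun h => by
    have := H.norm_sq_of_orthogonal hp (hx p hp) (hy p hp)
    rw [a1, h, norm_circleVec hB.norm_e₁ hB.norm_e₂ hB.orth] at this
    norm_num at this
  refine ⟨?_, ?_⟩
  · have := (mul_eq_zero.1 (a2.trans neg_zero)).resolve_left (mul_ne_zero hu hX)
    linarith
  · rintro ⟨b1, b2, b3⟩
    rw [b1, mul_zero, zero_div] at a3
    rw [b2, mul_zero, zero_div] at a4
    have a6 := H.inner_eq_of_orthogonal hp (hx p hp) (hy p hp) (dZ F p)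
    have a7 : ⟪F p, dZ F p⟫_ℝ = 0 := by
      rw [hFz, inner_smul_right,
        inner_circleVec_circleVec_add hB.norm_e₁ hB.norm_e₂ hB.orth, mul_zero]
    rw [a7, a1] at a6
    have a8 : ⟪dZ F p, dZ f p⟫_ℝ * invFactor P p = deriv mu p.2.2 * ⟪dZ F p, N p⟫_ℝ := by
      refine mul_left_cancel₀ (mul_ne_zero hX hu) ?_
      linear_combination -a6
    have a9 : ⟪dZ F p, N p⟫_ℝ = 0 := by
      have : (1 + deriv mu p.2.2 ^ 2) ≠ 0 := by positivity
      refine (mul_eq_zero.1 ?_).resolve_right this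
      linear_combination a5 - deriv mu p.2.2 * a8 - ⟪F p, dZ f p⟫_ℝ * b3
    rw [a9, mul_zero] at a8
    have a10 := (mul_eq_zero.1 a8).resolve_right hu
    have a11 := H.norm_sq_of_orthogonal hp a3 a4
    rw [a9, a10, hFz, norm_smul, norm_circleVec hB.norm_e₁ hB.norm_e₂ hB.orth] at a11
    have := hB.moves _ (mem_zProj hp)
    simp [this] at a11

/-- w_z = -iμ'w is an infinitesimal rotation and preserves |w|² = 2σ₃. -/
theorem structureB_dZ_sigma₃ {p : R3} (hp : p ∈ U) :
    HasPartial (0, 0, 1) (sigma₃ κ₁ κ₂ κ₃) 0 p :=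
  (((((H.hasPartial_u hp _).sq).add (H.hasPartial_k hp _).sq).mul
      (HasPartial.const (1 / 2))).congr_on H.isOpen hp fun q hq => by
        rw [H.sigma₃_eq hq]; ring).eq (by
    rw [show pd (0, 0, 1) κ₃ p = _ from H.codazzi_z hp,
      show pd (0, 0, 1) (invFactor P) p = _ from (H.structureB_partials hB hp).1]
    ring)

/-- W₀ = f* - σ₃f is independent of z, because f*_z = σ₃f_z and (σ₃)_z = 0. Its x- and y-derivatives
are orthogonal to B(z) for each z, hence to L, so its L-component is a constant vector. Translating
it away gives W. -/
theorem structureB_dual {fs : R3 → E4} (hfs : IsDual U f κ₁ κ₂ κ₃ fs) :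
    ∃ (v : E4) (s : ℝ × ℝ → ℝ) (W : ℝ × ℝ → E4),
      StructureB U e₁ e₂ θ (fun p => fs p - v) ∧
      ContDiffOn ℝ ∞ W (xyProj U) ∧
      (∀ q ∈ xyProj U, inner ℝ e₁ (W q) = 0 ∧ inner ℝ e₂ (W q) = 0) ∧
      (∀ p ∈ U, sigma₃ κ₁ κ₂ κ₃ p = s (p.1, p.2.1)) ∧
      ∀ p ∈ U, fs p - v = s (p.1, p.2.1) • f p + W (p.1, p.2.1) := by
  have hs3 := H.smooth_sigma.2.2
  obtain ⟨s, -, hs⟩ := exists_eq_comp_xy H.isOpen H.fib hs3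
    fun p hp => (H.structureB_dZ_sigma₃ hB hp).pd_eq
  set W₀ : R3 → E4 := fun p => fs p - sigma₃ κ₁ κ₂ κ₃ p • f p with hW₀
  have hW₀s : ContDiffOn ℝ ∞ W₀ U := (H.smooth_dual hfs).sub (hs3.smul H.hyp.smooth_f)
  have hσ : ∀ p ∈ U, ∀ w, HasPartial w (sigma₃ κ₁ κ₂ κ₃) (pd w (sigma₃ κ₁ κ₂ κ₃) p) p :=
    fun p hp w => .of_contDiffOn H.isOpen hs3 hp w
  have hWz : ∀ p ∈ U, pd (0, 0, 1) W₀ p = 0 := fun p hp => by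
    refine ((H.hasPartial_dual hfs hp).2.2.sub
      ((H.structureB_dZ_sigma₃ hB hp).smul (H.hasPartial_f hp _))).pd_eq.trans ?_
    rw [zero_smul, zero_add]; exact sub_self _
  obtain ⟨W, hWs, hW⟩ := exists_eq_comp_xy H.isOpen H.fib hW₀s hWz
  have horth : ∀ p ∈ U, ⟪circleVec e₁ e₂ (θ p.2.2), pd (1, 0, 0) W₀ p⟫_ℝ = 0 ∧
      ⟪circleVec e₁ e₂ (θ p.2.2), pd (0, 1, 0) W₀ p⟫_ℝ = 0 := fun p hp => by
    obtain ⟨o1, o2⟩ := H.structureB_orth hB hp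
    have o3 := hB.mem p hp
    rw [((H.hasPartial_dual hfs hp).1.sub ((hσ p hp _).smul (H.hasPartial_f_xyz hp).1)).pd_eq,
      ((H.hasPartial_dual hfs hp).2.1.sub ((hσ p hp _).smul (H.hasPartial_f_xyz hp).2.1)).pd_eq]
    simp [inner_sub_right, inner_add_right, inner_smul_right, o1, o2, o3]
  -- Since the derivative of W₀ does not depend on z, its orthogonality to B(z) passes to B'(z), and
  -- B, B' span L because θ' ≠ 0.
  have hperp : ∀ w : R3, (∀ p ∈ U, ⟪circleVec e₁ e₂ (θ p.2.2), pd w W₀ p⟫_ℝ = 0) →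
      ∀ p ∈ U, ⟪e₁, pd w W₀ p⟫_ℝ = 0 ∧ ⟪e₂, pd w W₀ p⟫_ℝ = 0 := fun w hw p hp => by
    have h1 := ((H.hasPartial_circleVec hB hp (0, 0, 1)).inner
      (HasPartial.of_contDiffOn H.isOpen (contDiffOn_pd H.isOpen hW₀s w) hp (0, 0, 1))).eq_of_eqOn
        (.const 0) H.isOpen hp hw
    rw [pd_comm H.isOpen hW₀s hp, pd_congr H.isOpen hp hWz w,
      (HasPartial.const (0 : E4)).pd_eq, inner_zero_right, add_zero, one_smul,
      inner_smul_left] at h1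
    exact inner_eq_zero_of_circleVec (hw p hp)
      ((mul_eq_zero.1 h1).resolve_left (by simpa using hB.moves _ (mem_zProj hp)))
  have hconst : ∀ e : E4, (∀ p ∈ U, ⟪e, pd (1, 0, 0) W₀ p⟫_ℝ = 0) →
      (∀ p ∈ U, ⟪e, pd (0, 1, 0) W₀ p⟫_ℝ = 0) → ∃ α : ℝ, ∀ p ∈ U, ⟪e, W₀ p⟫_ℝ = α := by
    intro e hex hey
    have hpart : ∀ w, ∀ p ∈ U, HasPartial w (fun p => ⟪e, W₀ p⟫_ℝ) ⟪e, pd w W₀ p⟫_ℝ p :=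
      fun w p hp => ((HasPartial.const e).inner (.of_contDiffOn H.isOpen hW₀s hp w)).eq (by simp)
    exact exists_eq_const_of_partials H.isOpen H.conn (hpart _) (hpart _) (hpart _) hex hey
      fun p hp => by rw [hWz p hp, inner_zero_right]
  have hpx := hperp _ fun p hp => (horth p hp).1
  have hpy := hperp _ fun p hp => (horth p hp).2
  obtain ⟨α₁, h1⟩ := hconst e₁ (fun p hp => (hpx p hp).1) fun p hp => (hpy p hp).1
  obtain ⟨α₂, h2⟩ := hconst e₂ (fun p hp => (hpx p hp).2) fun p hp => (hpy p hp).2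
  have hperp2 : ∀ q ∈ xyProj U, ⟪e₁, W q - (α₁ • e₁ + α₂ • e₂)⟫_ℝ = 0 ∧
      ⟪e₂, W q - (α₁ • e₁ + α₂ • e₂)⟫_ℝ = 0 := by
    rintro _ ⟨p, hp, rfl⟩
    change ⟪e₁, W (p.1, p.2.1) - _⟫_ℝ = 0 ∧ ⟪e₂, W (p.1, p.2.1) - _⟫_ℝ = 0
    rw [← hW p hp]
    simp only [inner_sub_right, inner_add_right, inner_smul_right, h1 p hp, h2 p hp,
      real_inner_self_eq_norm_sq, hB.norm_e₁, hB.norm_e₂, hB.orth,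
      (real_inner_comm e₁ e₂).trans hB.orth]
    constructor <;> ring
  have hfs' : ∀ p ∈ U, fs p - (α₁ • e₁ + α₂ • e₂) =
      s (p.1, p.2.1) • f p + (W (p.1, p.2.1) - (α₁ • e₁ + α₂ • e₂)) := fun p hp => by
    rw [← hW p hp, ← hs p hp, hW₀]; module
  refine ⟨α₁ • e₁ + α₂ • e₂, s, fun q => W q - (α₁ • e₁ + α₂ • e₂), { hB with mem := fun p hp => ?_ },
    hWs.sub contDiffOn_const, hperp2, hs, hfs'⟩
  obtain ⟨q1, q2⟩ := hperp2 _ (mem_xyProj hp)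
  rw [hfs' p hp, inner_add_right, inner_smul_right, hB.mem p hp,
    inner_circleVec_eq_zero q1 q2, mul_zero, add_zero]

end StructureB

end Setting

/-! ### Structure (b): the Gauss equations when K = 0 -/

theorem gauss_solve_x {S C u k a b a₁ a₂ x y xx : ℝ} (hS : S ≠ 0) (hC : C ≠ 0) (hu : u ≠ 0)
    (G : k ^ 2 - u ^ 2 * a ^ 2 - u ^ 2 * (S / C) * b + S / C * a * u * (a * k) -
      u * (b * k - u * a ^ 2) + (a * k) ^ 2 - u * xx / C ^ 2 + x ^ 2 / C ^ 2 -
      u * x * (S / C) * a₁ / C ^ 2 + a₂ * u * y / (S * C) + y ^ 2 / S ^ 2 + k * u * (S / C) = 0) :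
    (xx * C - x * (-S * a₁)) / C ^ 2 = a₂ * (y / S) +
      C * (((x / C) ^ 2 + (y / S) ^ 2 - k * (b * u - (1 + a ^ 2) * k)) / u) -
      S * (b * u - (1 + a ^ 2) * k) := by
  linear_combination (norm := skip) (-(C / u)) * G
  field_simp
  ring

/-- S, C, k stand for sin φ, cos φ, κ₃; a, b for μ', μ''; a₁, a₂ for λ_x, λ_y; x, y, xx, yy for
derivatives of u. The (y, z)-equation is solved for l_y with l = u_y/sin φ, as the (x, z)-equation
above is for m_x with m = u_x/cos φ; u_z and u_zz have been eliminated by u_z = μ'k. -/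
theorem gauss_solve_y {S C u k a b a₁ a₂ x y yy : ℝ} (hS : S ≠ 0) (hC : C ≠ 0) (hu : u ≠ 0)
    (G : k ^ 2 - u ^ 2 * a ^ 2 + u ^ 2 * (C / S) * b - C / S * a * u * (a * k) -
      u * (b * k - u * a ^ 2) + (a * k) ^ 2 - u * yy / S ^ 2 + y ^ 2 / S ^ 2 +
      u * y * (C / S) * a₂ / S ^ 2 - a₁ * u * x / (S * C) + x ^ 2 / C ^ 2 - k * u * (C / S) = 0) :
    (yy * S - y * (C * a₂)) / S ^ 2 = -(a₁ * (x / C)) +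
      S * (((x / C) ^ 2 + (y / S) ^ 2 - k * (b * u - (1 + a ^ 2) * k)) / u) +
      C * (b * u - (1 + a ^ 2) * k) := by
  linear_combination (norm := skip) (-(S / u)) * G
  field_simp
  ring

/-- Once m_x and l_y are inserted, the (x, y)-equation contains no second derivatives of u and
becomes an algebraic second expression for M, next to its definition by uM = m² + l² - kE. -/
theorem gauss_solve_xy {S C u k a b a₁ a₂ x y xx yy L c sm cm M : ℝ} (hS : S ≠ 0) (hC : C ≠ 0)
    (hu : u ≠ 0) (h : S ^ 2 + C ^ 2 = 1)
    (hM : u * M = (x / C) ^ 2 + (y / S) ^ 2 - k * (b * u - (1 + a ^ 2) * k))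
    (A : (xx * C - x * (-S * a₁)) / C ^ 2 = a₂ * (y / S) + C * M - S * (b * u - (1 + a ^ 2) * k))
    (B : (yy * S - y * (C * a₂)) / S ^ 2 = -(a₁ * (x / C)) + S * M + C * (b * u - (1 + a ^ 2) * k))
    (hL : L = c ^ 2 / 2 * (2 * (S * cm - C * sm) * (C * cm + S * sm)))
    (hb : b = -(c ^ 2 * (sm * cm)))
    (G : L - yy * C / (S * u) + y * a₂ / (S ^ 2 * u) + y ^ 2 * C / (S * u ^ 2) - xx * S / (C * u) -
      x * a₁ / (C ^ 2 * u) + x ^ 2 * S / (C * u ^ 2) =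
      S * C * (1 + a ^ 2 - (a * k) ^ 2 / u ^ 2 - k ^ 2 / u ^ 2) +
      (C ^ 2 - S ^ 2) * (a * (a * k) + k) / u) :
    M = c ^ 2 * (cm ^ 2 - sm ^ 2) * u + k * b - (1 + a ^ 2) * u := by
  have key : S * C / u * (M - (c ^ 2 * (cm ^ 2 - sm ^ 2) * u + k * b - (1 + a ^ 2) * u)) = 0 := by
    linear_combination (norm := skip) -G + hL - (S / u) * A - (C / u) * B +
      (x * a₁ / (C ^ 2 * u) - y * a₂ / (S ^ 2 * u)) * h - S * C / u ^ 2 * hM -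
      (C ^ 2 - S ^ 2) * hb
    field_simp
    ring
  exact sub_eq_zero.1 ((mul_eq_zero.1 key).resolve_left
    (div_ne_zero (mul_ne_zero hS hC) hu))

namespace Setting

variable {U : Set R3} {lam : ℝ × ℝ → ℝ} {mu : ℝ → ℝ} {c₁ : ℝ} {P κ₁ κ₂ κ₃ : R3 → ℝ}
  {f N : R3 → E4} (H : Setting U lam mu c₁ P κ₁ κ₂ κ₃ f N)

include H

section CurvatureAngle

variable (hz : ∀ p ∈ U, dZ (invFactor P) p = deriv mu p.2.2 * κ₃ p)

include hz

/-- The Gauss equations in the case `(P⁻¹)_z = μ' κ₃`, solved for the second derivatives. -/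
theorem gauss_of_dZ_eq {p : R3} (hp : p ∈ U) :
    ∃ m l E M : ℝ, m = dX (invFactor P) p / Real.cos (angle lam mu p) ∧
      l = dY (invFactor P) p / Real.sin (angle lam mu p) ∧
      E = deriv (deriv mu) p.2.2 * invFactor P p - (1 + deriv mu p.2.2 ^ 2) * κ₃ p ∧
      M = c₁ ^ 2 * (Real.cos (mu p.2.2) ^ 2 - Real.sin (mu p.2.2) ^ 2) * invFactor P p +
        κ₃ p * deriv (deriv mu) p.2.2 - (1 + deriv mu p.2.2 ^ 2) * invFactor P p ∧
      invFactor P p * M = m ^ 2 + l ^ 2 - κ₃ p * E ∧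
      HasPartial (1, 0, 0) (fun q => dX (invFactor P) q / Real.cos (angle lam mu q))
        (pY lam (p.1, p.2.1) * l + Real.cos (angle lam mu p) * M -
          Real.sin (angle lam mu p) * E) p ∧
      HasPartial (0, 1, 0) (fun q => dY (invFactor P) q / Real.sin (angle lam mu q))
        (-(pX lam (p.1, p.2.1) * m) + Real.sin (angle lam mu p) * M +
          Real.cos (angle lam mu p) * E) p := by
  have hS := H.sin_ne hp
  have hC := H.cos_ne hp
  have hu := (H.u_pos hp).ne'
  have hzz : dZ (dZ (invFactor P)) p =
      deriv (deriv mu) p.2.2 * κ₃ p - invFactor P p * deriv mu p.2.2 ^ 2 := by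
    refine (pd_congr H.isOpen hp hz (0, 0, 1)).trans ?_
    rw [((H.hasPartial_deriv_mu_z hp).mul (H.hasPartial_k hp _)).pd_eq,
      show pd (0, 0, 1) κ₃ p = _ from H.codazzi_z hp]
    ring
  have G1 := H.gauss_xz hp
  have G2 := H.gauss_yz hp
  have G3 := H.gauss_xy hp
  have hl := H.lam_eq _ (mem_xyProj hp)
  rw [show lam (p.1, p.2.1) = angle lam mu p - mu p.2.2 by simp [angle], Real.sin_two_mul,
    Real.sin_sub, Real.cos_sub] at hl
  dsimp only at G1 G2 G3
  rw [hz p hp, hzz] at G1 G2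
  rw [hz p hp] at G3
  have A := gauss_solve_x hS hC hu G1
  have B := gauss_solve_y hS hC hu G2
  refine ⟨_, _, _, _, rfl, rfl, rfl, gauss_solve_xy hS hC hu (Real.sin_sq_add_cos_sq _)
    (mul_div_cancel₀ _ hu) A B hl (H.mu_snd _ (mem_zProj hp)) G3, mul_div_cancel₀ _ hu, ?_, ?_⟩
  · exact ((H.hasPartial_pd_u hp (1, 0, 0) (1, 0, 0)).div (H.hasPartial_angle_x hp).cos hC).eq A
  · exact ((H.hasPartial_pd_u hp (0, 1, 0) (0, 1, 0)).div (H.hasPartial_angle_y hp).sin hS).eq B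

end CurvatureAngle

end Setting

/-- The left side is Ψ_xx - Ψ_yy written out by the quotient rule, T is sin 2Ψ and Q is cos 2(λ +
Ψ). The formulas for E and M give uE - kM = -(c²/2) T (u² + k²), and uM = m² + l² - kE absorbs the
terms quadratic in m and l. -/
theorem curvature_angle_laplace {S C u k a b a₁ a₂ m l E M c sm cm T Q : ℝ} (hu : u ≠ 0)
    (hE : E = b * u - (1 + a ^ 2) * k)
    (hM : M = c ^ 2 * (cm ^ 2 - sm ^ 2) * u + k * b - (1 + a ^ 2) * u)
    (huM : u * M = m ^ 2 + l ^ 2 - k * E) (hb : b = -(c ^ 2 * (sm * cm)))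
    (hT : T * (u ^ 2 + k ^ 2) = (u ^ 2 - k ^ 2) * (2 * sm * cm) + 2 * u * k * (cm ^ 2 - sm ^ 2))
    (hQ : Q * (u ^ 2 + k ^ 2) = (C ^ 2 - S ^ 2) * (u ^ 2 - k ^ 2) - 4 * S * C * u * k) :
    -(((a₂ * l + C * M - S * E) * (S * u + k * C) + m * (C * a₁ * u + S * (m * C) +
        (-(m * S) * C + k * (-S * a₁)))) * (u ^ 2 + k ^ 2) -
        m * (S * u + k * C) * (2 * u * (m * C) + 2 * k * -(m * S))) / (u ^ 2 + k ^ 2) ^ 2 -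
      ((((-(a₁ * m) + S * M + C * E) * (C * u - S * k) + l * (-S * a₂ * u + C * (l * S) -
        (C * a₂ * k + S * (l * C)))) * (u ^ 2 + k ^ 2) -
        l * (C * u - S * k) * (2 * u * (l * S) + 2 * k * (l * C))) / (u ^ 2 + k ^ 2) ^ 2) =
      c ^ 2 / 2 * (T * Q) := by
  have hR : (u ^ 2 + k ^ 2) ≠ 0 := by positivity
  rw [← sub_div, div_eq_iff (pow_ne_zero 2 hR)]
  have h1 : u * E - k * M = -(c ^ 2 / 2) * (T * (u ^ 2 + k ^ 2)) := by
    rw [hT, hE, hM, hb]; ring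
  have h2 : c ^ 2 / 2 * (T * Q) * (u ^ 2 + k ^ 2) ^ 2 =
      -((u * E - k * M) * (Q * (u ^ 2 + k ^ 2))) := by rw [h1]; ring
  rw [h2, hQ]
  linear_combination (-2 * (S * u + k * C) * (C * u - S * k)) * huM

/-! ### Structure (b): the curvature angle Ψ -/

namespace Setting

variable {U : Set R3} {lam : ℝ × ℝ → ℝ} {mu : ℝ → ℝ} {c₁ : ℝ} {P κ₁ κ₂ κ₃ : R3 → ℝ}
  {f N : R3 → E4} (H : Setting U lam mu c₁ P κ₁ κ₂ κ₃ f N)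

include H

theorem hasPartial_comp_xy {g : ℝ × ℝ → ℝ} (hg : ContDiffOn ℝ ∞ g (xyProj U)) {p : R3}
    (hp : p ∈ U) :
    HasPartial (1, 0, 0) (fun r : R3 => g (r.1, r.2.1)) (pX g (p.1, p.2.1)) p ∧
    HasPartial (0, 1, 0) (fun r : R3 => g (r.1, r.2.1)) (pY g (p.1, p.2.1)) p :=
  have h := (hg.contDiffAt (H.isOpen_V.mem_nhds (mem_xyProj hp))).differentiableAt (by simp)
  ⟨HasPartial.comp_xy h _, HasPartial.comp_xy h _⟩

theorem dXY_eq {p : R3} (hp : p ∈ U) :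
    dX (invFactor P) p = dX (invFactor P) p / Real.cos (angle lam mu p) *
      Real.cos (angle lam mu p) ∧
    dX κ₃ p = -(dX (invFactor P) p / Real.cos (angle lam mu p) * Real.sin (angle lam mu p)) ∧
    dY (invFactor P) p = dY (invFactor P) p / Real.sin (angle lam mu p) *
      Real.sin (angle lam mu p) ∧
    dY κ₃ p = dY (invFactor P) p / Real.sin (angle lam mu p) * Real.cos (angle lam mu p) := by
  have hS := H.sin_ne hp
  have hC := H.cos_ne hp
  refine ⟨(div_mul_cancel₀ _ hC).symm, ?_, (div_mul_cancel₀ _ hS).symm, ?_⟩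
  · field_simp
    linear_combination H.codazzi_x hp
  · field_simp
    linear_combination H.codazzi_y hp

section CurvatureAngle

variable (hz : ∀ p ∈ U, dZ (invFactor P) p = deriv mu p.2.2 * κ₃ p)

include hz

/-- Ψ is the argument of w e^{iμ}, where u > 0 makes arctan(k/u) the argument of w. By w_z = -iμ'w
it does not depend on z. -/
theorem exists_curvatureAngle : ∃ Ψ : ℝ × ℝ → ℝ, ContDiffOn ℝ ∞ Ψ (xyProj U) ∧
    ∀ p ∈ U, Real.arctan (κ₃ p / invFactor P p) + mu p.2.2 = Ψ (p.1, p.2.1) := by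
  refine exists_eq_comp_xy H.isOpen H.fib
    ((ContDiffOn.arctan (H.smooth_k.div H.smooth_u fun p hp => (H.u_pos hp).ne')).add
      (contDiffOn_comp_z H.smooth_mu)) fun p hp => ?_
  have hu := (H.u_pos hp).ne'
  refine (((H.hasPartial_k hp (0, 0, 1)).div (H.hasPartial_u hp (0, 0, 1)) hu).arctan.add
    (H.hasPartial_mu hp (0, 0, 1))).pd_eq.trans ?_
  rw [show pd (0, 0, 1) κ₃ p = _ from H.codazzi_z hp,
    show pd (0, 0, 1) (invFactor P) p = _ from hz p hp]
  have hR : (invFactor P p ^ 2 + κ₃ p ^ 2) ≠ 0 := by positivity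
  field_simp
  ring

variable {Ψ : ℝ × ℝ → ℝ} (hΨs : ContDiffOn ℝ ∞ Ψ (xyProj U))
  (hΨ : ∀ p ∈ U, Real.arctan (κ₃ p / invFactor P p) + mu p.2.2 = Ψ (p.1, p.2.1))

include hΨs hΨ

omit hz in
-- The derivative of arg w is (u dk - k du)/(u² + k²), and by Codazzi (u_x, k_x) = m(cos φ, -sin φ),
-- (u_y, k_y) = l(sin φ, cos φ).
theorem partials_curvatureAngle {p : R3} (hp : p ∈ U) :
    pX Ψ (p.1, p.2.1) = -(dX (invFactor P) p / Real.cos (angle lam mu p) *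
      (Real.sin (angle lam mu p) * invFactor P p + κ₃ p * Real.cos (angle lam mu p)) /
      (invFactor P p ^ 2 + κ₃ p ^ 2)) ∧
    pY Ψ (p.1, p.2.1) = dY (invFactor P) p / Real.sin (angle lam mu p) *
      (Real.cos (angle lam mu p) * invFactor P p - Real.sin (angle lam mu p) * κ₃ p) /
      (invFactor P p ^ 2 + κ₃ p ^ 2) := by
  have hu := (H.u_pos hp).ne'
  have hR : (invFactor P p ^ 2 + κ₃ p ^ 2) ≠ 0 := by positivity
  obtain ⟨x1, x2, y1, y2⟩ := H.dXY_eq hp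
  have key : ∀ v : R3, HasPartial v (fun r => Ψ (r.1, r.2.1)) _ p := fun v =>
    (((H.hasPartial_k hp v).div (H.hasPartial_u hp v) hu).arctan.add
      (H.hasPartial_mu hp v)).congr_on H.isOpen hp hΨ
  obtain ⟨h1, h2⟩ := H.hasPartial_comp_xy hΨs hp
  have k1 := h1.unique (key _)
  have k2 := h2.unique (key _)
  rw [show pd (1, 0, 0) κ₃ p = _ from x2, show pd (1, 0, 0) (invFactor P) p = _ from x1] at k1
  rw [show pd (0, 1, 0) κ₃ p = _ from y2, show pd (0, 1, 0) (invFactor P) p = _ from y1] at k2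
  generalize dX (invFactor P) p / Real.cos (angle lam mu p) = m at *
  generalize dY (invFactor P) p / Real.sin (angle lam mu p) = l at *
  rw [k1, k2]
  constructor
  · field_simp; ring
  · field_simp; ring

omit hz hΨs in
theorem curvatureAngle_sin_cos {p : R3} (hp : p ∈ U) :
    Real.sin (2 * Ψ (p.1, p.2.1)) * (invFactor P p ^ 2 + κ₃ p ^ 2) =
      (invFactor P p ^ 2 - κ₃ p ^ 2) * (2 * Real.sin (mu p.2.2) * Real.cos (mu p.2.2)) +
      2 * invFactor P p * κ₃ p * (Real.cos (mu p.2.2) ^ 2 - Real.sin (mu p.2.2) ^ 2) ∧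
    Real.cos (2 * (lam (p.1, p.2.1) + Ψ (p.1, p.2.1))) * (invFactor P p ^ 2 + κ₃ p ^ 2) =
      (Real.cos (angle lam mu p) ^ 2 - Real.sin (angle lam mu p) ^ 2) *
        (invFactor P p ^ 2 - κ₃ p ^ 2) -
      4 * Real.sin (angle lam mu p) * Real.cos (angle lam mu p) * invFactor P p * κ₃ p := by
  have hu := (H.u_pos hp).ne'
  have h1 := cos_two_mul_arctan_mul (κ₃ p / invFactor P p)
  have h2 := sin_two_mul_arctan_mul (κ₃ p / invFactor P p)
  field_simp at h1 h2
  rw [show 2 * (lam (p.1, p.2.1) + Ψ (p.1, p.2.1)) = 2 * Real.arctan (κ₃ p / invFactor P p) +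
    2 * angle lam mu p by rw [← hΨ p hp, angle]; ring, ← hΨ p hp,
    mul_add 2 (Real.arctan _) (mu p.2.2),
    Real.sin_add, Real.cos_add, Real.sin_two_mul (mu p.2.2), Real.cos_two_mul' (mu p.2.2),
    Real.sin_two_mul (angle lam mu p), Real.cos_two_mul' (angle lam mu p)]
  constructor
  · linear_combination (2 * Real.sin (mu p.2.2) * Real.cos (mu p.2.2)) * h1 +
      (Real.cos (mu p.2.2) ^ 2 - Real.sin (mu p.2.2) ^ 2) * h2
  · linear_combination
      (Real.cos (angle lam mu p) ^ 2 - Real.sin (angle lam mu p) ^ 2) * h1 -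
      (2 * Real.sin (angle lam mu p) * Real.cos (angle lam mu p)) * h2

theorem laplace_curvatureAngle {q : ℝ × ℝ} (hq : q ∈ xyProj U) :
    pX (pX Ψ) q - pY (pY Ψ) q =
      c₁ ^ 2 / 2 * (Real.sin (2 * Ψ q) * Real.cos (2 * (lam q + Ψ q))) := by
  obtain ⟨p, hp, rfl⟩ := hq
  have hu := (H.u_pos hp).ne'
  have hR : (invFactor P p ^ 2 + κ₃ p ^ 2) ≠ 0 := by positivity
  obtain ⟨m, l, E, M, hm, hl, hE, hM, huM, hmx, hly⟩ := H.gauss_of_dZ_eq hz hp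
  obtain ⟨x1, x2, y1, y2⟩ := H.dXY_eq hp
  rw [← hm] at x1 x2
  rw [← hl] at y1 y2
  have hu1 : ∀ v, HasPartial v (fun q => invFactor P q ^ 2 + κ₃ q ^ 2) _ p := fun v =>
    (H.hasPartial_u hp v).sq.add (H.hasPartial_k hp v).sq
  have Vx := (H.hasPartial_comp_xy (contDiffOn_pd H.isOpen_V hΨs (1, 0)) hp).1.eq_of_eqOn
    ((hmx.mul (((H.hasPartial_angle_x hp).sin.mul (H.hasPartial_u hp _)).add
      ((H.hasPartial_k hp _).mul (H.hasPartial_angle_x hp).cos))).div (hu1 _) hR).neg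
    H.isOpen hp fun q hq => (H.partials_curvatureAngle hΨs hΨ hq).1
  have Vy := (H.hasPartial_comp_xy (contDiffOn_pd H.isOpen_V hΨs (0, 1)) hp).2.eq_of_eqOn
    ((hly.mul (((H.hasPartial_angle_y hp).cos.mul (H.hasPartial_u hp _)).sub
      ((H.hasPartial_angle_y hp).sin.mul (H.hasPartial_k hp _)))).div (hu1 _) hR)
    H.isOpen hp fun q hq => (H.partials_curvatureAngle hΨs hΨ hq).2
  rw [← hm, show pd (1, 0, 0) κ₃ p = _ from x2,
    show pd (1, 0, 0) (invFactor P) p = _ from x1] at Vx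
  rw [← hl, show pd (0, 1, 0) κ₃ p = _ from y2,
    show pd (0, 1, 0) (invFactor P) p = _ from y1] at Vy
  obtain ⟨hT, hQ⟩ := H.curvatureAngle_sin_cos hΨ hp
  have key := curvature_angle_laplace (a₁ := pX lam (p.1, p.2.1)) (a₂ := pY lam (p.1, p.2.1))
    hu hE hM huM (H.mu_snd _ (mem_zProj hp)) hT hQ
  change pX (pX Ψ) (p.1, p.2.1) - pY (pY Ψ) (p.1, p.2.1) = _
  change pX (pX Ψ) (p.1, p.2.1) = _ at Vx
  change pY (pY Ψ) (p.1, p.2.1) = _ at Vy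
  rw [Vx, Vy]
  refine Eq.trans ?_ key
  rw [neg_div]

omit hz hΨs in
theorem curvatureAngle_isDualAngle : IsDualAngle U (angle lam mu) κ₁ κ₂ κ₃
    (angle (fun q => lam q + 2 * Ψ q + Real.pi) fun z => -mu z) := by
  have e : ∀ p ∈ U, angle (fun q => lam q + 2 * Ψ q + Real.pi) (fun z => -mu z) p =
      angle lam mu p + 2 * Real.arctan (κ₃ p / invFactor P p) + Real.pi := fun p hp => by
    simp only [angle, ← hΨ p hp]; ring
  refine H.isDualAngle_of (fun p hp => ?_) fun p hp => ?_ <;> rw [e p hp]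
  · exact (cos_sin_add_two_mul_arctan (H.u_pos hp).ne' _).1
  · exact (cos_sin_add_two_mul_arctan (H.u_pos hp).ne' _).2

end CurvatureAngle

end Setting

theorem sin_arctan_div_mul {u : ℝ} (k : ℝ) (hu : u ≠ 0) :
    Real.sin (Real.arctan (k / u)) * u = k * Real.cos (Real.arctan (k / u)) := by
  have h := Real.tan_arctan (k / u)
  rw [Real.tan_eq_sin_div_cos, div_eq_div_iff (Real.cos_arctan_pos _).ne' hu] at h
  exact h

/-! ### Structure (b): the equations for λ* and the exclusion of equal or opposite gradients -/

namespace Setting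

variable {U : Set R3} {lam : ℝ × ℝ → ℝ} {mu : ℝ → ℝ} {c₁ : ℝ} {P κ₁ κ₂ κ₃ : R3 → ℝ}
  {f N : R3 → E4} (H : Setting U lam mu c₁ P κ₁ κ₂ κ₃ f N)

include H

section CurvatureAngle

variable {Ψ : ℝ × ℝ → ℝ} (hΨs : ContDiffOn ℝ ∞ Ψ (xyProj U))
  (hΨ : ∀ p ∈ U, Real.arctan (κ₃ p / invFactor P p) + mu p.2.2 = Ψ (p.1, p.2.1))

theorem hasPartial_xy {g : ℝ × ℝ → ℝ} (hg : ContDiffOn ℝ ∞ g (xyProj U)) {q : ℝ × ℝ}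
    (hq : q ∈ xyProj U) : HasPartial (1, 0) g (pX g q) q ∧ HasPartial (0, 1) g (pY g q) q :=
  ⟨.of_contDiffOn H.isOpen_V hg hq _, .of_contDiffOn H.isOpen_V hg hq _⟩

theorem smooth_dualLam (hΨs : ContDiffOn ℝ ∞ Ψ (xyProj U)) :
    ContDiffOn ℝ ∞ (fun q => lam q + 2 * Ψ q + Real.pi) (xyProj U) :=
  (H.smooth_lam.add (contDiffOn_const.mul hΨs)).add contDiffOn_const

include hΨs

theorem partials_dualLam {q : ℝ × ℝ} (hq : q ∈ xyProj U) :
    pX (fun q => lam q + 2 * Ψ q + Real.pi) q = pX lam q + 2 * pX Ψ q ∧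
    pY (fun q => lam q + 2 * Ψ q + Real.pi) q = pY lam q + 2 * pY Ψ q := by
  obtain ⟨h1, h2⟩ := H.hasPartial_xy H.smooth_lam hq
  obtain ⟨h3, h4⟩ := H.hasPartial_xy hΨs hq
  exact ⟨(((h1.add ((HasPartial.const 2).mul h3)).add (.const Real.pi)).eq (by ring)).pd_eq,
    (((h2.add ((HasPartial.const 2).mul h4)).add (.const Real.pi)).eq (by ring)).pd_eq⟩

theorem laplace_dualLam {q : ℝ × ℝ} (hq : q ∈ xyProj U) :
    pX (pX (fun q => lam q + 2 * Ψ q + Real.pi)) q - pY (pY (fun q => lam q + 2 * Ψ q + Real.pi)) q =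
      c₁ ^ 2 / 2 * Real.sin (2 * lam q) + 2 * (pX (pX Ψ) q - pY (pY Ψ) q) := by
  have s := fun {g : ℝ × ℝ → ℝ} (hg : ContDiffOn ℝ ∞ g (xyProj U)) v =>
    contDiffOn_pd H.isOpen_V hg v
  have e1 : pX (pX (fun q => lam q + 2 * Ψ q + Real.pi)) q = pX (pX lam) q + 2 * pX (pX Ψ) q :=
    (pd_congr H.isOpen_V hq (fun q hq => (H.partials_dualLam hΨs hq).1) (1, 0)).trans
      (((H.hasPartial_xy (s H.smooth_lam (1, 0)) hq).1.add
        ((HasPartial.const 2).mul (H.hasPartial_xy (s hΨs (1, 0)) hq).1)).pd_eq.trans (by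
          rw [zero_mul, zero_add]; rfl))
  have e2 : pY (pY (fun q => lam q + 2 * Ψ q + Real.pi)) q = pY (pY lam) q + 2 * pY (pY Ψ) q :=
    (pd_congr H.isOpen_V hq (fun q hq => (H.partials_dualLam hΨs hq).2) (0, 1)).trans
      (((H.hasPartial_xy (s H.smooth_lam (0, 1)) hq).2.add
        ((HasPartial.const 2).mul (H.hasPartial_xy (s hΨs (0, 1)) hq).2)).pd_eq.trans (by
          rw [zero_mul, zero_add]; rfl))
  have e3 := H.lam_eq q hq
  rw [e1, e2]
  linear_combination e3

include hΨ

/-- With A = 2(λ + Ψ) and B = 2Ψ, the equations for λ and Ψ add up through sin(A - B) + 2 sin B cos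
A = sin(A + B), where A + B = 2λ* up to 2π. -/
theorem guichardEquations_dualLam (hz : ∀ p ∈ U, dZ (invFactor P) p = deriv mu p.2.2 * κ₃ p) {c₂ : ℝ}
    (hφ : GuichardEquations (xyProj U) (zProj U) lam mu c₁ c₂) :
    GuichardEquations (xyProj U) (zProj U) (fun q => lam q + 2 * Ψ q + Real.pi) (fun z => -mu z)
      c₁ c₂ :=
  { hφ.add_const_neg (Or.inl rfl) with
    smooth_lam := H.smooth_dualLam hΨs
    lam_eq := fun q hq => by
      rw [H.laplace_dualLam hΨs hq, H.laplace_curvatureAngle hz hΨs hΨ hq,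
        show 2 * (lam q + 2 * Ψ q + Real.pi) = 2 * (lam q + Ψ q) + 2 * Ψ q + 2 * Real.pi by ring,
        Real.sin_add_two_pi, Real.sin_add,
        show 2 * lam q = 2 * (lam q + Ψ q) - 2 * Ψ q by ring, Real.sin_sub]
      ring }

omit hΨs in
-- Because λ + Ψ = φ + arctan(k/u), the factors accompanying m and l in the gradient of Ψ are
-- positive multiples of sin(λ + Ψ) and cos(λ + Ψ).
theorem curvatureAngle_sin_cos_add {p : R3} (hp : p ∈ U) :
    (Real.sin (angle lam mu p) * invFactor P p + κ₃ p * Real.cos (angle lam mu p)) *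
      Real.cos (Real.arctan (κ₃ p / invFactor P p)) =
        invFactor P p * Real.sin (lam (p.1, p.2.1) + Ψ (p.1, p.2.1)) ∧
    (Real.cos (angle lam mu p) * invFactor P p - Real.sin (angle lam mu p) * κ₃ p) *
      Real.cos (Real.arctan (κ₃ p / invFactor P p)) =
        invFactor P p * Real.cos (lam (p.1, p.2.1) + Ψ (p.1, p.2.1)) := by
  have h := sin_arctan_div_mul (κ₃ p) (H.u_pos hp).ne'
  rw [show lam (p.1, p.2.1) + Ψ (p.1, p.2.1) = angle lam mu p +
    Real.arctan (κ₃ p / invFactor P p) by rw [← hΨ p hp, angle]; ring, Real.sin_add, Real.cos_add]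
  constructor
  · linear_combination (-Real.cos (angle lam mu p)) * h
  · linear_combination Real.sin (angle lam mu p) * h

/-- Equal gradients mean that Ψ has zero gradient. If sin 2(λ + Ψ) ≡ 0, then λ_x ≡ 0, against
condition (d). Otherwise m = l = 0 on a non-empty open set; the formulas for m_x and l_y give E = 0
there, and this is what the motion of B(z) excludes. -/
theorem dualLam_gradient_ne {e₁ e₂ : E4} {θ : ℝ → ℝ} (hB : StructureB U e₁ e₂ θ f)
    (hd_x : ∃ q ∈ xyProj U, pX lam q ≠ 0) :
    ¬ ∀ q ∈ xyProj U, pX (fun q => lam q + 2 * Ψ q + Real.pi) q = pX lam q ∧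
      pY (fun q => lam q + 2 * Ψ q + Real.pi) q = pY lam q := by
  intro h
  have h0 : ∀ q ∈ xyProj U, pX Ψ q = 0 ∧ pY Ψ q = 0 := fun q hq => by
    obtain ⟨a1, a2⟩ := h q hq
    obtain ⟨b1, b2⟩ := H.partials_dualLam hΨs hq
    constructor <;> linarith
  set D : R3 → ℝ := fun p =>
    (Real.sin (angle lam mu p) * invFactor P p + κ₃ p * Real.cos (angle lam mu p)) *
    (Real.cos (angle lam mu p) * invFactor P p - Real.sin (angle lam mu p) * κ₃ p) with hD
  have hDc : ContinuousOn D U := by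
    have h1 := H.smooth_angle
    have h2 := H.smooth_u
    have h3 := H.smooth_k
    exact (((h1.sin.mul h2).add (h3.mul h1.cos)).mul
      ((h1.cos.mul h2).sub (h1.sin.mul h3))).continuousOn
  obtain ⟨p, hp, hne⟩ : ∃ p ∈ U, D p ≠ 0 := by
    by_contra! hcon
    obtain ⟨q, hq, hne⟩ := hd_x
    have hsin : ∀ q ∈ xyProj U, Real.sin (2 * (lam q + Ψ q)) = 0 := by
      rintro _ ⟨p, hp, rfl⟩
      obtain ⟨h1, h2⟩ := H.curvatureAngle_sin_cos_add hΨ hp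
      change Real.sin (2 * (lam (p.1, p.2.1) + Ψ (p.1, p.2.1))) = 0
      have h3 : invFactor P p ^ 2 ≠ 0 := pow_ne_zero 2 (H.u_pos hp).ne'
      have h4 := hcon p hp
      simp only [hD] at h4
      rw [Real.sin_two_mul]
      refine mul_left_cancel₀ h3 ?_
      linear_combination (-2 * invFactor P p * Real.cos (lam (p.1, p.2.1) + Ψ (p.1, p.2.1))) * h1 -
        2 * ((Real.sin (angle lam mu p) * invFactor P p + κ₃ p * Real.cos (angle lam mu p)) *
      Real.cos (Real.arctan (κ₃ p / invFactor P p))) * h2 +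
        2 * Real.cos (Real.arctan (κ₃ p / invFactor P p)) ^ 2 * h4
    have h1 := ((HasPartial.const 2).mul ((H.hasPartial_xy H.smooth_lam hq).1.add
      (H.hasPartial_xy hΨs hq).1)).sin.eq_of_eqOn (.const 0) H.isOpen_V hq hsin
    have h2 := Real.sin_sq_add_cos_sq (2 * (lam q + Ψ q))
    rw [hsin q hq] at h2
    have h3 : Real.cos (2 * (lam q + Ψ q)) ≠ 0 := fun h => by rw [h] at h2; norm_num at h2
    have h4 := (mul_eq_zero.1 h1).resolve_left h3
    rw [(h0 q hq).1] at h4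
    exact hne (by linarith)
  have hU' : IsOpen {p ∈ U | D p ≠ 0} :=
    hDc.isOpen_inter_preimage H.isOpen isOpen_compl_singleton
  have hml : ∀ p ∈ {p ∈ U | D p ≠ 0}, dX (invFactor P) p / Real.cos (angle lam mu p) = 0 ∧
      dY (invFactor P) p / Real.sin (angle lam mu p) = 0 := by
    rintro p ⟨hp, hDp⟩
    obtain ⟨h1, h2⟩ := H.partials_curvatureAngle hΨs hΨ hp
    obtain ⟨h3, h4⟩ := h0 _ (mem_xyProj hp)
    have hR : (invFactor P p ^ 2 + κ₃ p ^ 2) ≠ 0 := by have := H.u_pos hp; positivity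
    rw [h3, eq_comm, neg_eq_zero] at h1
    rw [h4, eq_comm] at h2
    exact ⟨(mul_eq_zero.1 ((div_eq_zero_iff.1 h1).resolve_right hR)).resolve_right
        (left_ne_zero_of_mul hDp),
      (mul_eq_zero.1 ((div_eq_zero_iff.1 h2).resolve_right hR)).resolve_right
        (right_ne_zero_of_mul hDp)⟩
  have hp' : p ∈ {p ∈ U | D p ≠ 0} := ⟨hp, hne⟩
  obtain ⟨m, l, E, M, hm, hl, hE, -, -, hmx, hly⟩ :=
    H.gauss_of_dZ_eq (fun q hq => (H.structureB_partials hB hq).1) hp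
  have h1 := hmx.eq_of_eqOn (.const 0) hU' hp' fun q hq => (hml q hq).1
  have h2 := hly.eq_of_eqOn (.const 0) hU' hp' fun q hq => (hml q hq).2
  obtain ⟨m0, l0⟩ := hml p hp'
  refine (H.structureB_partials hB hp).2 ⟨(div_eq_zero_iff.1 m0).resolve_right (H.cos_ne hp),
    (div_eq_zero_iff.1 l0).resolve_right (H.sin_ne hp), ?_⟩
  rw [← hm] at m0
  rw [← hl] at l0
  have hSC := Real.sin_sq_add_cos_sq (angle lam mu p)
  rw [m0] at h2
  rw [l0] at h1
  linear_combination Real.cos (angle lam mu p) * h2 - Real.sin (angle lam mu p) * h1 - hE - E * hSC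

/-- Opposite gradients mean that λ + Ψ is a constant α. Comparing the equations for λ and Ψ gives
sin 2α cos 2Ψ ≡ 0. Either Ψ_x vanishes where λ_x does not, because cos 2Ψ ≡ 0, or sin α = 0 or cos α
= 0, which makes Ψ_x or Ψ_y vanish identically. Each contradicts condition (d). -/
theorem dualLam_gradient_ne_neg (hz : ∀ p ∈ U, dZ (invFactor P) p = deriv mu p.2.2 * κ₃ p)
    (hc₁ : c₁ ≠ 0) (hd_x : ∃ q ∈ xyProj U, pX lam q ≠ 0) (hd_y : ∃ q ∈ xyProj U, pY lam q ≠ 0) :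
    ¬ ∀ q ∈ xyProj U, pX (fun q => lam q + 2 * Ψ q + Real.pi) q = -pX lam q ∧
      pY (fun q => lam q + 2 * Ψ q + Real.pi) q = -pY lam q := by
  intro h
  have h0 : ∀ q ∈ xyProj U, pX Ψ q = -pX lam q ∧ pY Ψ q = -pY lam q := fun q hq => by
    obtain ⟨a1, a2⟩ := h q hq
    obtain ⟨b1, b2⟩ := H.partials_dualLam hΨs hq
    constructor <;> linarith
  obtain ⟨q₀, hq₀, hne⟩ := hd_x
  have hconst : ∀ q ∈ xyProj U, lam q + Ψ q = lam q₀ + Ψ q₀ := fun q hq => by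
    have hpart := fun q (hq : q ∈ xyProj U) => And.intro
      ((H.hasPartial_xy H.smooth_lam hq).1.add (H.hasPartial_xy hΨs hq).1)
      ((H.hasPartial_xy H.smooth_lam hq).2.add (H.hasPartial_xy hΨs hq).2)
    refine eq_of_pX_pY_eq_zero H.isOpen_V (isPreconnected_xyProj H.conn)
      (g := fun q => lam q + Ψ q) (fun q hq => (hpart q hq).1.1)
      (fun q hq => (hpart q hq).1.pd_eq.trans ?_) (fun q hq => (hpart q hq).2.pd_eq.trans ?_) hq hq₀
    · rw [(h0 q hq).1]; ring
    · rw [(h0 q hq).2]; ring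
  have key : ∀ q ∈ xyProj U, Real.sin (2 * (lam q₀ + Ψ q₀)) * Real.cos (2 * Ψ q) = 0 := by
    intro q hq
    have e2 := H.laplace_curvatureAngle hz hΨs hΨ hq
    have e3 := H.lam_eq q hq
    have s := fun v => contDiffOn_pd H.isOpen_V H.smooth_lam v
    have e4 : pX (pX Ψ) q = -pX (pX lam) q :=
      (pd_congr H.isOpen_V hq (fun q hq => (h0 q hq).1) (1, 0)).trans
        (H.hasPartial_xy (s (1, 0)) hq).1.neg.pd_eq
    have e5 : pY (pY Ψ) q = -pY (pY lam) q :=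
      (pd_congr H.isOpen_V hq (fun q hq => (h0 q hq).2) (0, 1)).trans
        (H.hasPartial_xy (s (0, 1)) hq).2.neg.pd_eq
    rw [e4, e5] at e2
    rw [show 2 * lam q = 2 * (lam q + Ψ q) - 2 * Ψ q by ring, Real.sin_sub] at e3
    have hc2 : c₁ ^ 2 / 2 ≠ 0 := div_ne_zero (pow_ne_zero 2 hc₁) two_ne_zero
    rw [← hconst q hq]
    refine mul_left_cancel₀ hc2 ?_
    linear_combination -e2 - e3
  have hcase : Real.sin (lam q₀ + Ψ q₀) = 0 ∨ Real.cos (lam q₀ + Ψ q₀) = 0 := by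
    by_contra! hcon
    have hsin : Real.sin (2 * (lam q₀ + Ψ q₀)) ≠ 0 := by
      rw [Real.sin_two_mul]
      exact mul_ne_zero (mul_ne_zero two_ne_zero hcon.1) hcon.2
    have hcos := fun q hq => (mul_eq_zero.1 (key q hq)).resolve_left hsin
    have h1 := ((HasPartial.const 2).mul (H.hasPartial_xy hΨs hq₀).1).cos.eq_of_eqOn (.const 0)
      H.isOpen_V hq₀ hcos
    have h2 := Real.sin_sq_add_cos_sq (2 * Ψ q₀)
    rw [hcos q₀ hq₀] at h2
    have h3 : -Real.sin (2 * Ψ q₀) ≠ 0 := fun h => by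
      rw [neg_eq_zero] at h; rw [h] at h2; norm_num at h2
    have h4 := (mul_eq_zero.1 h1).resolve_left h3
    rw [(h0 q₀ hq₀).1] at h4
    exact hne (by linarith)
  rcases hcase with hs | hc
  · obtain ⟨p, hp, rfl⟩ := hq₀
    obtain ⟨h1, -⟩ := H.curvatureAngle_sin_cos_add hΨ hp
    rw [hs, mul_zero] at h1
    have h2 := (mul_eq_zero.1 h1).resolve_right (Real.cos_arctan_pos _).ne'
    have h3 := (H.partials_curvatureAngle hΨs hΨ hp).1
    rw [h2, mul_zero, zero_div, neg_zero, (h0 _ (mem_xyProj hp)).1, neg_eq_zero] at h3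
    exact hne h3
  · obtain ⟨_, ⟨p, hp, rfl⟩, hne⟩ := hd_y
    obtain ⟨-, h1⟩ := H.curvatureAngle_sin_cos_add hΨ hp
    rw [hconst _ (mem_xyProj hp), hc, mul_zero] at h1
    have h2 := (mul_eq_zero.1 h1).resolve_right (Real.cos_arctan_pos _).ne'
    have h3 := (H.partials_curvatureAngle hΨs hΨ hp).2
    rw [h2, mul_zero, zero_div, (h0 _ (mem_xyProj hp)).2, neg_eq_zero] at h3
    exact hne h3

end CurvatureAngle

/-- The structures (a) and (b) exclude each other. -/
theorem not_structureA_structureB {B₀ e₁ e₂ : E4} {θ : ℝ → ℝ} (hne : U.Nonempty)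
    (hA : StructureA U B₀ f) (hB : StructureB U e₁ e₂ θ f) : False := by
  obtain ⟨p, hp⟩ := hne
  obtain ⟨-, -, h1, h2, -, h3⟩ := H.structureA_rigid hA hp
  exact (H.structureB_partials hB hp).2 ⟨h1, h2, h3⟩

theorem not_structureC_of_dZ_eq (hne : U.Nonempty)
    (hz : ∀ p ∈ U, dZ (invFactor P) p = deriv mu p.2.2 * κ₃ p) (hC : StructureC U f) : False := by
  obtain ⟨p, hp⟩ := hne
  have h := (H.structureC_rigid hC hp).1
  rw [hz p hp] at h
  norm_num at h

end Setting

end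

end GuichardDual

/-! ### The theorem: choice of λ* and μ* for each structure -/

open GuichardDual in
theorem theorem4p3
    (U : Set R3) (hU_open : IsOpen U) (hU_conn : IsConnected U)
    (hU_fib : ∀ x y : ℝ, {z : ℝ | ((x, y, z) : R3) ∈ U}.OrdConnected)
    (lam : ℝ × ℝ → ℝ) (mu : ℝ → ℝ) (c₁ c₂ : ℝ)
    (hφ : GuichardEquations (xyProj U) (zProj U) lam mu c₁ c₂)
    (hφ_range : ∀ p ∈ U, angle lam mu p ∈ Set.Ioo (-Real.pi) Real.pi)
    -- condition (d)
    (hd_x : ∃ q ∈ xyProj U, pX lam q ≠ 0)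
    (hd_y : ∃ q ∈ xyProj U, pY lam q ≠ 0)
    (P κ₁ κ₂ κ₃ : R3 → ℝ) (f N : R3 → E4)
    (hf : IsGuichardHypersurface U (angle lam mu) P κ₁ κ₂ κ₃ f N)
    -- `f` is a normal form
    (hnf : (∃ B, StructureA U B f) ∨ (∃ e₁ e₂ θ, StructureB U e₁ e₂ θ f) ∨ StructureC U f)
    (fs : R3 → E4) (hfs : IsDual U f κ₁ κ₂ κ₃ fs) :
    ∃ (lams : ℝ × ℝ → ℝ) (mus : ℝ → ℝ) (c₁s c₂s : ℝ),
      -- the Guichard net of the dual is given by `φ* = λ* + μ*`, again of the same kind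
      GuichardEquations (xyProj U) (zProj U) lams mus c₁s c₂s ∧
      IsDualAngle U (angle lam mu) κ₁ κ₂ κ₃ (angle lams mus) ∧
      IsGuichardHypersurface (regularSet U κ₁ κ₂ κ₃) (angle lams mus) (dualP P κ₁ κ₂ κ₃)
        (dualκ₁ κ₁ κ₂ κ₃) (dualκ₂ κ₁ κ₂ κ₃) (dualκ₃ κ₁ κ₂ κ₃) fs (dualN N) ∧
      ((∀ z ∈ zProj U, mu z = 0) → ∀ z ∈ zProj U, mus z = 0) ∧
      ((∃ z ∈ zProj U, deriv mu z ≠ 0) → ∃ z ∈ zProj U, deriv mus z ≠ 0) ∧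
      -- structure (a)
      (∀ B₀, StructureA U B₀ f →
        StructureA U B₀ fs ∧
        ((∀ z ∈ zProj U, mu z = 0) →
          (∃ ε : ℝ, (ε = 1 ∨ ε = -1) ∧ ∀ q ∈ xyProj U, lams q = lam q + ε * Real.pi) ∧
          (∀ p ∈ U, angle lams mus p ∈ Set.Ioo (-Real.pi) Real.pi) ∧
          ConformallyEquivalentOn U f fs ∧
          ∃ (B : E4) (P₀ t : ℝ) (f₁ : ℝ × ℝ → E4) (v : E4),
            ‖B‖ = 1 ∧ 0 < P₀ ∧ (∀ p ∈ U, P p = P₀ ∧ Xγ P f p = B) ∧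
            (∀ q ∈ xyProj U, inner ℝ B (f₁ q) = 0) ∧
            (∀ p ∈ U, f p = f₁ (p.1, p.2.1) + (P₀ * p.2.2 + t) • B) ∧
            StructureA U B f ∧ StructureA U B fs ∧
            ∀ p ∈ U, fs p - v =
              ((P₀⁻¹) ^ 2 / 2) • (-f₁ (p.1, p.2.1) + (P₀ * p.2.2) • B)) ∧
        ((∃ z ∈ zProj U, deriv mu z ≠ 0) →
          NotConformallyEquivalent U κ₁ κ₂ κ₃ f fs ∧
          (∃ ε : ℝ, (ε = 1 ∨ ε = -1) ∧ ∀ q ∈ xyProj U, lams q = lam q + ε * Real.pi) ∧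
          (∀ z ∈ zProj U, mus z = -mu z) ∧
          ∃ (B : E4) (C : ℝ) (q : ℝ → ℝ) (v : E4),
            StructureA U B f ∧ StructureA U B fs ∧ C ≠ 0 ∧
            (∀ p ∈ U, vecA (angle lam mu) P f N p =
              -(Real.sqrt (1 + deriv mu p.2.2 ^ 2) • B)) ∧
            (∀ p ∈ U, (P p)⁻¹ = C * Real.cos (mu p.2.2) ∧ κ₃ p = -(C * Real.sin (mu p.2.2))) ∧
            (∀ p ∈ U, HasDerivAt q ((P p)⁻¹ * Real.sqrt (1 + deriv mu p.2.2 ^ 2)) p.2.2) ∧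
            ((∀ z ∈ zProj U, 0 < c₁ * Real.cos (mu z)) →
              ∀ z ∈ zProj U, deriv q z = C * c₁ * Real.cos (mu z) ^ 2) ∧
            ∀ p ∈ U, fs p - v = -((C ^ 2 / 2) • f p) - κ₃ p • N p + q p.2.2 • B)) ∧
      -- structure (b)
      (∀ e₁ e₂ θ, StructureB U e₁ e₂ θ f →
        NotConformallyEquivalent U κ₁ κ₂ κ₃ f fs ∧
        (∀ z ∈ zProj U, mus z = -mu z) ∧
        ¬ (∀ q ∈ xyProj U, pX lams q = pX lam q ∧ pY lams q = pY lam q) ∧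
        ¬ (∀ q ∈ xyProj U, pX lams q = -pX lam q ∧ pY lams q = -pY lam q) ∧
        ∃ (v : E4) (s : ℝ × ℝ → ℝ) (W : ℝ × ℝ → E4),
          -- the same linear hyperplanes `H(z)` for `f` and for the translated dual
          StructureB U e₁ e₂ θ (fun p => fs p - v) ∧
          ContDiffOn ℝ ∞ W (xyProj U) ∧
          (∀ q ∈ xyProj U, inner ℝ e₁ (W q) = 0 ∧ inner ℝ e₂ (W q) = 0) ∧
          (∀ p ∈ U, sigma₃ κ₁ κ₂ κ₃ p = s (p.1, p.2.1)) ∧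
          ∀ p ∈ U, fs p - v = s (p.1, p.2.1) • f p + W (p.1, p.2.1)) ∧
      -- structure (c)
      (StructureC U f →
        ∃ v : E4, StructureC U (fun p => fs p - v) ∧
          ((∀ z ∈ zProj U, mu z = 0) →
            (∃ ε : ℝ, (ε = 1 ∨ ε = -1) ∧ ∀ q ∈ xyProj U, lams q = lam q + ε * Real.pi) ∧
            (∀ p ∈ U, angle lams mus p ∈ Set.Ioo (-Real.pi) Real.pi) ∧
            ConformallyEquivalentOn U f fs ∧
            c₁ ^ 2 < 1 ∧
            (∃ s : ℝ → ℝ, ∀ p ∈ U, sigma₃ κ₁ κ₂ κ₃ p = s p.2.2) ∧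
            ∀ p ∈ U,
              fs p - v = -(sigma₃ κ₁ κ₂ κ₃ p • f p) ∧
              fs p - v = -((1 / (2 * Real.sqrt (1 - c₁ ^ 2) ^ 2)) •
                EuclideanGeometry.inversion (0 : E4) 1 (f p))) ∧
          ((∃ z ∈ zProj U, deriv mu z ≠ 0) →
            NotConformallyEquivalent U κ₁ κ₂ κ₃ f fs ∧
            (∀ q ∈ xyProj U, lams q = lam q) ∧
            ¬ (∀ z ∈ zProj U, deriv mus z = deriv mu z) ∧
            ¬ (∀ z ∈ zProj U, deriv mus z = -deriv mu z) ∧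
            (∃ k : ℝ → ℝ, ∀ p ∈ U,
              funK (angle lams mus) (dualP P κ₁ κ₂ κ₃) (dualκ₃ κ₁ κ₂ κ₃) p = k p.2.2) ∧
            ∀ p ∈ U,
              funK (angle lams mus) (dualP P κ₁ κ₂ κ₃) (dualκ₃ κ₁ κ₂ κ₃) p ≠ 0 ∧
              fs p - v = -((funK (angle lams mus) (dualP P κ₁ κ₂ κ₃) (dualκ₃ κ₁ κ₂ κ₃) p)⁻¹ •
                vecA (angle lams mus) (dualP P κ₁ κ₂ κ₃) fs (dualN N) p) ∧
              fs p - v = -(sigma₃ κ₁ κ₂ κ₃ p • f p + κ₃ p • N p))) := by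
  have hJ := isOpen_zProj hU_open
  have H : Setting U lam mu c₁ P κ₁ κ₂ κ₃ f N :=
    ⟨hU_open, hU_conn.isPreconnected, hU_fib, hφ.smooth_lam, hφ.smooth_mu, hφ.lam_eq,
      fun z hz => hφ.mu_snd hJ (isPreconnected_zProj hU_conn.isPreconnected) hz, hf⟩
  have hne := hU_conn.nonempty
  have hmu0 : (∀ z ∈ zProj U, mu z = 0) → ∀ z ∈ zProj U, -mu z = 0 := fun h z hz => by
    rw [h z hz, neg_zero]
  have hneg : ∀ z, deriv (fun z => -mu z) z = -deriv mu z := fun z => deriv.fun_neg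
  have hmu1 : (∃ z ∈ zProj U, deriv mu z ≠ 0) →
      ∃ z ∈ zProj U, deriv (fun z => -mu z) z ≠ 0 := fun ⟨z, hz, h⟩ =>
    ⟨z, hz, by rw [hneg]; exact neg_ne_zero.2 h⟩
  obtain ⟨ε, hε, hεr⟩ := H.exists_shift hφ_range
  have hangle : (∀ z ∈ zProj U, mu z = 0) → ∀ p ∈ U,
      angle (fun q => lam q + ε * Real.pi) (fun z => -mu z) p ∈ Set.Ioo (-Real.pi) Real.pi :=
    fun h0 p hp => by
      have : angle (fun q => lam q + ε * Real.pi) (fun z => -mu z) p =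
          angle lam mu p + ε * Real.pi := by
        simp [angle, h0 _ (mem_zProj hp)]
      rw [this]; exact hεr p hp
  have hGε := hφ.add_const_neg hε
  -- The three structures exclude one another: (a) and (b) by their rigidity relations, (c) from
  -- both because K = 0 fails there. So λ* and μ* may be chosen for each structure separately, and
  -- the claims about the other two are vacuous.
  rcases hnf with ⟨B, hA⟩ | ⟨e₁, e₂, θ, hB⟩ | hC
  · have hz : ∀ p ∈ U, dZ (invFactor P) p = deriv mu p.2.2 * κ₃ p := fun p hp =>
      (H.structureA_rigid hA hp).2.2.2.2.1
    have hang := H.structureA_isDualAngle hA hφ.c₁_ne hne hε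
    refine ⟨fun q => lam q + ε * Real.pi, fun z => -mu z, c₁, c₂, hGε, hang,
      H.isGuichardHypersurface_dual hfs hang, hmu0, hmu1, fun B₀ hA₀ =>
        ⟨H.structureA_dual hA₀ hφ.c₁_ne hne hfs, fun h0 => ?_, fun h1 => ?_⟩,
      fun e₁ e₂ θ hB => (H.not_structureA_structureB hne hA hB).elim,
      fun hC => (H.not_structureC_of_dZ_eq hne hz hC).elim⟩
    · obtain ⟨h2, h3⟩ := H.structureA_dual_of_mu_eq_zero hA₀ hφ.c₁_ne hne hfs h0
      exact ⟨⟨ε, hε, fun _ _ => rfl⟩, hangle h0, h2, h3⟩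
    · refine ⟨H.notConformallyEquivalent hfs hGε.smooth_lam hGε.smooth_mu hang (fun h => ?_)
        (fun h => ?_), ⟨ε, hε, fun _ _ => rfl⟩, fun _ _ => rfl,
        H.structureA_dual_of_mu_ne_zero hA₀ hφ.c₁_ne hne hfs⟩
      · obtain ⟨z, hz, hne⟩ := h1
        have := h.2 z hz
        rw [hneg] at this
        exact hne (by linarith)
      · obtain ⟨q, hq, hne⟩ := hd_x
        have h2 := (h.1 q hq).1
        rw [show pX (fun q => lam q + ε * Real.pi) q = pX lam q by simp [pX]] at h2
        exact hne (by linarith)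
  · have hz : ∀ p ∈ U, dZ (invFactor P) p = deriv mu p.2.2 * κ₃ p := fun p hp =>
      (H.structureB_partials hB hp).1
    obtain ⟨Ψ, hΨs, hΨ⟩ := H.exists_curvatureAngle hz
    have hang := H.curvatureAngle_isDualAngle hΨ
    have hG := H.guichardEquations_dualLam hΨs hΨ hz hφ
    have h₁ := H.dualLam_gradient_ne hΨs hΨ hB hd_x
    have h₂ := H.dualLam_gradient_ne_neg hΨs hΨ hz hφ.c₁_ne hd_x hd_y
    exact ⟨fun q => lam q + 2 * Ψ q + Real.pi, fun z => -mu z, c₁, c₂, hG, hang,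
      H.isGuichardHypersurface_dual hfs hang, hmu0, hmu1,
      fun B₀ hA => (H.not_structureA_structureB hne hA hB).elim,
      fun e₁ e₂ θ hB => ⟨H.notConformallyEquivalent hfs hG.smooth_lam hG.smooth_mu hang
        (fun h => h₁ h.1) (fun h => h₂ h.1), fun _ _ => rfl, h₁, h₂, H.structureB_dual hB hfs⟩,
      fun hC => (H.not_structureC_of_dZ_eq hne hz hC).elim⟩
  · have hnA : ∀ B₀, ¬ StructureA U B₀ f := fun B₀ hA => H.not_structureC_of_dZ_eq hne
      (fun p hp => (H.structureA_rigid hA hp).2.2.2.2.1) hC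
    have hnB : ∀ e₁ e₂ θ, ¬ StructureB U e₁ e₂ θ f := fun e₁ e₂ θ hB =>
      H.not_structureC_of_dZ_eq hne (fun p hp => (H.structureB_partials hB hp).1) hC
    rcases hφ.mu_eq with h0 | ⟨h1, hmu⟩
    · have hd0 : ∀ z ∈ zProj U, deriv mu z = 0 := fun z hz => deriv_eq_zero_of_eq_zero hJ h0 hz
      -- The given c₂ is non-zero and need not fit μ ≡ 0; the first integral of the zero function
      -- has constant 0.
      obtain ⟨c, hc0, hc⟩ := H.structureC_exists hC (c₂ := 0) fun z hz => by
        rw [hd0 z hz, h0 z hz]; simp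
      obtain ⟨v, hv⟩ := H.structureC_dual_eq hC hc hfs
      have hang := H.isDualAngle_of_k_eq_zero
        (fun p hp => (H.structureC_of_mu_eq_zero hC hc h0 hp).1) h0 hε
      refine ⟨fun q => lam q + ε * Real.pi, fun z => -mu z, c₁, c₂, hGε, hang,
        H.isGuichardHypersurface_dual hfs hang, hmu0, hmu1, fun B₀ hA => (hnA B₀ hA).elim,
        fun e₁ e₂ θ hB => (hnB e₁ e₂ θ hB).elim, fun _ => ⟨v, H.structureC_structureC hC hc0 hc hv,
          fun _ => ⟨⟨ε, hε, fun _ _ => rfl⟩, hangle h0,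
            H.structureC_dual_of_mu_eq_zero hC hc0 hc h0 hne hv⟩, ?_⟩⟩
      rintro ⟨z, hz, h⟩
      exact absurd (hd0 z hz) h
    · obtain ⟨c, hc0, hc⟩ := H.structureC_exists hC hmu
      obtain ⟨v, hv⟩ := H.structureC_dual_eq hC hc hfs
      have hang := H.structureC_isDualAngle hC hc
      have hn0 : ¬ ∀ z ∈ zProj U, mu z = 0 := fun h0 => by
        obtain ⟨z, hz, h⟩ := h1
        exact h (deriv_eq_zero_of_eq_zero hJ h0 hz)
      obtain ⟨r1, r2⟩ := H.structureC_dual_of_deriv_mu_ne_zero hC hc0 hc hφ hd_x h1 hfs hv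
      -- Here the shift by π is part of μ*, which keeps λ* equal to λ; the equation for μ* contains
      -- only sin² μ* and does not see it.
      exact ⟨lam, dualMu c mu, c₁, c₂, H.structureC_guichardEquations hC hc hφ h1, hang,
        H.isGuichardHypersurface_dual hfs hang, fun h0 => (hn0 h0).elim,
        fun _ => H.structureC_deriv_dualMu_ne_zero hC hc h1, fun B₀ hA => (hnA B₀ hA).elim,
        fun e₁ e₂ θ hB => (hnB e₁ e₂ θ hB).elim, fun _ => ⟨v, H.structureC_structureC hC hc0 hc hv,
          fun h0 => (hn0 h0).elim, fun _ => ⟨r1, fun _ _ => rfl,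
            H.structureC_deriv_dualMu_ne hC hc hφ.c₁_ne h1,
            H.structureC_deriv_dualMu_ne_neg hC hc0 hc h1, r2⟩⟩⟩
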